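/- Let $q>1$ be an integer, let $\sum^{+*}_{\chi \bmod q}$ denote the sum over the even ($\chi(-1)=1$) primitive Dirichlet characters modulo $q$, let $\varphi$ and $\mu$ be the Euler and Möbius functions, let $\varphi^*(q)=\sum_{d\mid q}\varphi(d)\mu(q/d)$ be the number of primitive characters modulo $q$, and put $$\zeta_q(s)=\zeta(s)\prod_{p\mid q}\bigl(1-p^{-s}\bigr),\qquad L_q(s,\psi)=L(s,\psi)\prod_{p\mid q}\bigl(1-\psi(p)p^{-s}\bigr),$$ $$g(z)=\Gamma(\tfrac12-z)\cos\tfrac{\pi}{2}(\tfrac12-z),\qquad X^+(q,\alpha,\beta)=\frac4q\Bigl(\frac q{2\pi}\Bigr)^{1-\alpha-\beta}g(\alpha)g(\beta),\qquad \tau(\psi)=\sum_{a=1}^{m}\psi(a)e^{2\pi i a/m}\ \ (\psi \bmod m).$$ Let $C>0$, $0<\delta<\frac12$ and $\varepsilon>0$. Then for all integers $q>1$, all complex $\alpha,\beta$ with $|\alpha|,|\beta|\le \min(C/\log q,\ \delta)$ and $\alpha+\beta\neq0$, and every real parameter $D$, $$\sum^{+*}_{\chi \bmod q}L(\tfrac12+\alpha,\chi)L(\tfrac12+\beta,\overline\chi)=\frac{\varphi^*(q)}2\Bigl(\zeta_q(1+\alpha+\beta)+X^+(q,\alpha,\beta)\,\zeta_q(1-\alpha-\beta)\Bigr)$$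 $$+\,2\,\frac{\varphi(q)}q\sum_{\substack{cd=q\\(c,d)=1}}\frac{\mu^2(c)}{\varphi(c)}\frac1{\varphi(m)}\sum_{\substack{\psi \bmod m\\ \psi(-1)=1}}\tau(\overline\psi)\overline\psi(M)\Bigl(g(\beta)\Bigl(\frac q{2\pi}\Bigr)^{\frac12-\beta}L_q(\tfrac12+\alpha,\psi)L_q(\tfrac12-\beta,\psi)+g(\alpha)\Bigl(\frac q{2\pi}\Bigr)^{\frac12-\alpha}L_q(\tfrac12-\alpha,\psi)L_q(\tfrac12+\beta,\psi)\Bigr)$$ $$+\,O\Bigl(\frac1q\sum_{\substack{d\mid q\\ d\le D}}\varphi(d)d^{3/2}+\sqrt q\sum_{\substack{d\mid q\\ d>D}}\frac{\varphi(d)}{d^{3/2}}+q^{\varepsilon}+q^{\varepsilon-1}D^2\Bigr),$$ where $m=\min\{c,d\}$, $M=\max\{c,d\}$, $\psi$ runs over all even characters modulo $m$, primitive or not, and the implied constant depends only on $C$, $\delta$ and $\varepsilon$. -/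

import Mathlib

namespace DirichletMeanSquare

open Complex

noncomputable section

/-- `ζ_q(s) = ζ(s) ∏_{p ∣ q} (1 - p^{-s})`, the continuation of `∑_{(n,q)=1} n^{-s}`. -/
def zetaCoprime (q : ℕ) (s : ℂ) : ℂ :=
  riemannZeta s * ∏ p ∈ q.primeFactors, (1 - (p : ℂ) ^ (-s))

/-- `L_q(s, ψ) = L(s, ψ) ∏_{p ∣ q} (1 - ψ(p) p^{-s})`, the continuation of
`∑_{(n,q)=1} ψ(n) n^{-s}`. -/
def lCoprime (q : ℕ) {m : ℕ} [NeZero m] (ψ : DirichletCharacter ℂ m) (s : ℂ) : ℂ :=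
  ψ.LFunction s * ∏ p ∈ q.primeFactors, (1 - ψ (p : ZMod m) * (p : ℂ) ^ (-s))

/-- The Gauss sum `τ(ψ) = ∑_{a mod m} ψ(a) e(a/m)`. -/
def tau {m : ℕ} [NeZero m] (ψ : DirichletCharacter ℂ m) : ℂ :=
  gaussSum ψ ZMod.stdAddChar

open Classical in
/-- `φ^*(q)`, the number of primitive Dirichlet characters modulo `q`. -/
def phiStar (q : ℕ) [NeZero q] : ℕ :=
  (Finset.univ.filter fun χ : DirichletCharacter ℂ q => χ.IsPrimitive).card

/-- `Γ(1/2 - z) cos(π/2 (1/2 - z))`. -/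
def gammaCos (z : ℂ) : ℂ :=
  Gamma (1 / 2 - z) * cos ((Real.pi : ℂ) / 2 * (1 / 2 - z))

/-- `X⁺(q, α, β)`, the common value of `X(1/2 + α, χ) X(1/2 + β, χ̄)` over the even primitive
characters modulo `q`, where `X` is the factor in the functional equation. -/
def xPlus (q : ℕ) (α β : ℂ) : ℂ :=
  4 / (q : ℂ) * ((q : ℂ) / (2 * (Real.pi : ℂ))) ^ (1 - α - β) * gammaCos α * gammaCos β

open Classical in
/-- The shifted mean square: the sum of `L(1/2 + α, χ) L(1/2 + β, χ̄)` over the even primitive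
characters modulo `q` (the complex conjugate of `χ` is `χ⁻¹`). -/
def evenMeanSquare (q : ℕ) [NeZero q] (α β : ℂ) : ℂ :=
  ∑ χ : DirichletCharacter ℂ q with χ.IsPrimitive ∧ χ.Even,
    χ.LFunction (1 / 2 + α) * χ⁻¹.LFunction (1 / 2 + β)

/-- The main term. -/
def mainTerm (q : ℕ) [NeZero q] (α β : ℂ) : ℂ :=
  (phiStar q : ℂ) / 2 *
    (zetaCoprime q (1 + α + β) + xPlus q α β * zetaCoprime q (1 - α - β))

open Classical in
/-- The sum over all even characters `ψ` modulo `m` (the principal one and the imprimitive ones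
included) that occurs in the secondary term. -/
def evenGaussSum (q m M : ℕ) [NeZero m] (α β : ℂ) : ℂ :=
  ∑ ψ : DirichletCharacter ℂ m with ψ.Even,
    tau ψ⁻¹ * ψ⁻¹ (M : ZMod m) *
      (gammaCos β * ((q : ℂ) / (2 * (Real.pi : ℂ))) ^ (1 / 2 - β) *
          lCoprime q ψ (1 / 2 + α) * lCoprime q ψ (1 / 2 - β) +
        gammaCos α * ((q : ℂ) / (2 * (Real.pi : ℂ))) ^ (1 / 2 - α) *
          lCoprime q ψ (1 / 2 - α) * lCoprime q ψ (1 / 2 + β))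

theorem min_neZero {q : ℕ} (p : q.divisorsAntidiagonal) : NeZero (min p.1.1 p.1.2) := by
  refine ⟨fun h => ?_⟩
  have h1 := Nat.ne_zero_of_mem_divisorsAntidiagonal p.2
  rcases min_choice p.1.1 p.1.2 with h2 | h2 <;> simp_all

/-- The secondary term: a sum over the ordered factorizations `q = c d` with `(c, d) = 1`; here
`p = (c, d)`. -/
def secondaryTerm (q : ℕ) (α β : ℂ) : ℂ :=
  2 * ((q.totient : ℂ) / (q : ℂ)) * ∑ p : q.divisorsAntidiagonal,
    if Nat.Coprime p.1.1 p.1.2 then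
      haveI : NeZero (min p.1.1 p.1.2) := min_neZero p
      ((ArithmeticFunction.moebius p.1.1 : ℤ) : ℂ) ^ 2 / (p.1.1.totient : ℂ) *
        (1 / ((min p.1.1 p.1.2).totient : ℂ)) *
        evenGaussSum q (min p.1.1 p.1.2) (max p.1.1 p.1.2) α β
    else 0

/-- The bound for the error term, with the free parameter `D`. -/
def errorBound (ε D : ℝ) (q : ℕ) : ℝ :=
  1 / (q : ℝ) * (∑ d ∈ q.divisors with ((d : ℕ) : ℝ) ≤ D, (d.totient : ℝ) * (d : ℝ) ^ (3 / 2 : ℝ)) +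
    Real.sqrt q * (∑ d ∈ q.divisors with D < ((d : ℕ) : ℝ),
      (d.totient : ℝ) / (d : ℝ) ^ (3 / 2 : ℝ)) +
    (q : ℝ) ^ ε + (q : ℝ) ^ (ε - 1) * D ^ 2

end

end DirichletMeanSquare

/-! Put s = 1/2 + α, w = 1/2 + β, and let Z_s be the even Hurwitz zeta function on the circle,
Z_s(x) = ½ ∑_{n ∈ ℤ} |n + x|^(-s) for re s > 1. Both sides of the formula are expressed through the
correlation sums `ded s w h₁ h₂ k` = ∑_{ky = 0} Z_s(h₂ y) Z_w(h₁ y), which are generalized Dedekind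
sums, and the theorem follows from a reciprocity law for them.

Left side: Möbius inversion over the conductor, orthogonality of characters and removal of Euler
factors give a signed average (`levelAvg`) over m ∣ q of n₁^(-s) n₂^(-w) `ded s w n₁ n₂ k`, with k ∣
m and n₁, n₂ ∣ q prime to m (`evenMeanSquare_eq_levelAvg`). Secondary term: opening the Gauss sums
and applying Hurwitz's formula to one L-value gives correlation sums of modulus min(c, d), collected
in `dualSum` (`secondaryTerm_eq`).

Reciprocity (`exists_reciprocity`, `exists_reciprocity_gcd`): the distribution relation ∑_{ht = 0}
Z_s(x + t) = h^s Z_s(hx) turns h₂^s h₁^w `ded s w h₁ h₂ k` into a triple sum of Z_s(a + x) Z_w(b +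
x) over the torsion of orders h₂, h₁, k. For fixed θ = b - a, subtract from Z_s(y) Z_w(y + θ) its
singular parts at y = 0 and y = -θ. The subtracted parts sum exactly: to the two reciprocal sums, of
moduli h₂ and h₁, and, from θ = 0, to a multiple of ζ(s + w). What remains (`zetaKernel`) has
integrable derivative, so its sum over k points is k times its mean, up to an error bounded
uniformly in k by a power of ‖θ‖. The means add up to a multiple of the mean `kernelMean` at θ = 0.
That constant is not integrated directly: the functional equation gives a second expansion of `ded s
w 1 1 k`, and comparing coefficients of k identifies it as a Γ-factor times ζ(2 - s - w)
(`kernelMean_eq`).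

Averaging the reciprocity law, the ζ(s + w) and mean terms give the two halves of the main term,
through Euler products (`mainTerm_eq`). The two reciprocal terms become exactly sums over coprime cd
= q of μ²(c) φ(d) times a dual sum of modulus c (`levelAvg_reciprocal`). The secondary term has
modulus min(c, d) instead, so when d < c the two moduli must be exchanged; a second use of
reciprocity does this at cost q^η, because then d ≤ √q (`exists_norm_ded_sub_ded_le`). Here ζ(s +
w)/2 and the mean each have a pole at s + w = 1, but their sum stays bounded.

Since |α|, |β| ≤ C / log q, shifting exponents by α or β changes powers of integers polynomial in q
by bounded factors only. All errors are then O(q^ε), with the divisor bound absorbing the number of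
terms. As q^ε is one of the summands of the stated bound and the others are nonnegative, every D is
covered. -/

namespace DirichletMeanSquare

/-! ### The distribution relation for the even Hurwitz zeta function. -/

open Complex HurwitzZeta Filter Topology

/-- The sum of `F` over the subgroup of order `k` of the circle. -/
noncomputable def circleSum (k : ℕ) (F : UnitAddCircle → ℂ) : ℂ :=
  ∑ j ∈ Finset.range k, F (((j : ℝ) / (k : ℝ) : ℝ) : UnitAddCircle)

theorem circleSum_eq_sum_zmod (k : ℕ) [NeZero k] (F : UnitAddCircle → ℂ) :
    circleSum k F = ∑ j : ZMod k, F (ZMod.toAddCircle j) := by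
  unfold circleSum
  refine Finset.sum_nbij' (fun j => (j : ZMod k)) ZMod.val (by simp) ?_ ?_ (by simp) ?_
  · intro j _
    simpa using ZMod.val_lt j
  · intro j hj
    exact ZMod.val_cast_of_lt (by simpa using hj)
  · intro j _
    rw [ZMod.toAddCircle_natCast]

/-- Two functions that are holomorphic off `s = 1` and agree for `1 < re s` agree off `s = 1`. -/
theorem eq_of_eq_of_one_lt_re {f g : ℂ → ℂ} (hf : ∀ s ≠ 1, DifferentiableAt ℂ f s)
    (hg : ∀ s ≠ 1, DifferentiableAt ℂ g s) (h : ∀ s : ℂ, 1 < s.re → f s = g s) {s : ℂ}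
    (hs : s ≠ 1) : f s = g s := by
  let U : Set ℂ := {z | z ≠ 1}
  have hU : IsOpen U := isOpen_ne
  have hf' : AnalyticOnNhd ℂ f U :=
    DifferentiableOn.analyticOnNhd (fun z hz => (hf z hz).differentiableWithinAt) hU
  have hg' : AnalyticOnNhd ℂ g U :=
    DifferentiableOn.analyticOnNhd (fun z hz => (hg z hz).differentiableWithinAt) hU
  have hpre : IsPreconnected U :=
    (isConnected_compl_singleton_of_one_lt_rank (by simp) _).isPreconnected
  have h2 : (2 : ℂ) ∈ U := by simp [U]
  refine hf'.eqOn_of_preconnected_of_eventuallyEq hg' hpre h2 ?_ hs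
  have : {z : ℂ | 1 < z.re} ∈ 𝓝 (2 : ℂ) :=
    (isOpen_lt continuous_const continuous_re).mem_nhds (by simp)
  filter_upwards [this] with z hz using h z hz

/-- Division with remainder, n = mk + c, regroups the series on the right, since |mk + c + ka| = k
|m + (a + c/k)|. -/
theorem hurwitzZetaEven_distribution_of_one_lt_re (k : ℕ) (hk : k ≠ 0) (x : UnitAddCircle) {s : ℂ}
    (hs : 1 < s.re) :
    circleSum k (fun y => hurwitzZetaEven (x + y) s) =
      (k : ℂ) ^ s * hurwitzZetaEven (k • x) s := by
  have : NeZero k := ⟨hk⟩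
  induction x using QuotientAddGroup.induction_on with
  | H a =>
    have hkpos : (0 : ℝ) < k := by positivity
    have h1 : HasSum (fun n : ℤ => ∑ j ∈ Finset.range k,
        1 / (↑|(n : ℝ) + (a + (j : ℝ) / k)| : ℂ) ^ s / 2)
        (∑ j ∈ Finset.range k, hurwitzZetaEven ((a + (j : ℝ) / k : ℝ) : UnitAddCircle) s) :=
      hasSum_sum fun j _ => hasSum_int_hurwitzZetaEven _ hs
    have h2 := (hasSum_int_hurwitzZetaEven ((k : ℝ) * a) hs).mul_left ((k : ℂ) ^ s)
    rw [← (Int.divModEquiv k).symm.hasSum_iff] at h2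
    have h3 := h2.prod_fiberwise (fun m => hasSum_fintype _)
    have h4 : (fun n : ℤ => ∑ j ∈ Finset.range k,
        1 / (↑|(n : ℝ) + (a + (j : ℝ) / k)| : ℂ) ^ s / 2) = fun m : ℤ => ∑ c : Fin k,
        ((fun n : ℤ => (k : ℂ) ^ s * (1 / (↑|(n : ℝ) + (k : ℝ) * a| : ℂ) ^ s / 2)) ∘
          (Int.divModEquiv k).symm) (m, c) := by
      funext m
      rw [Finset.sum_range]
      refine Finset.sum_congr rfl fun c _ => ?_
      have e1 : ((Int.divModEquiv k).symm (m, c) : ℤ) = m * k + (c : ℕ) := by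
        simp [Int.divModEquiv]
      simp only [Function.comp_apply, e1]
      have e2 : |((m * k + (c : ℕ) : ℤ) : ℝ) + (k : ℝ) * a|
          = k * |(m : ℝ) + (a + ((c : ℕ) : ℝ) / k)| := by
        rw [← abs_of_pos hkpos, ← abs_mul, abs_of_pos hkpos]
        congr 1
        push_cast
        field_simp
        ring
      rw [e2, ofReal_mul, mul_cpow_ofReal_nonneg hkpos.le (abs_nonneg _)]
      have : ((k : ℝ) : ℂ) ^ s ≠ 0 := by
        rw [Ne, cpow_eq_zero_iff]
        simp [hk]
      simp only [ofReal_natCast] at this ⊢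
      by_cases h0 : (↑|(m : ℝ) + (a + ((c : ℕ) : ℝ) / k)| : ℂ) ^ s = 0
      · simp [h0]
      · field_simp
    rw [h4] at h1
    have := h1.unique h3
    unfold circleSum
    have e5 : (k • (a : UnitAddCircle) : UnitAddCircle) = ((k * a : ℝ) : UnitAddCircle) := by
      rw [← AddCircle.coe_nsmul, nsmul_eq_mul]
    change ∑ j ∈ Finset.range k, hurwitzZetaEven ((a : UnitAddCircle) + _) s
      = (k : ℂ) ^ s * hurwitzZetaEven (k • (a : UnitAddCircle)) s
    rw [e5, ← this]
    refine Finset.sum_congr rfl fun j _ => ?_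
    rw [← AddCircle.coe_add]

theorem hurwitzZetaEven_distribution (k : ℕ) (hk : k ≠ 0) (x : UnitAddCircle) {s : ℂ}
    (hs : s ≠ 1) :
    circleSum k (fun y => hurwitzZetaEven (x + y) s) =
      (k : ℂ) ^ s * hurwitzZetaEven (k • x) s := by
  refine eq_of_eq_of_one_lt_re (f := fun s => circleSum k (fun y => hurwitzZetaEven (x + y) s))
    (g := fun s => (k : ℂ) ^ s * hurwitzZetaEven (k • x) s) ?_ ?_
    (fun s h => hurwitzZetaEven_distribution_of_one_lt_re k hk x h) hs
  · intro s hs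
    unfold circleSum
    exact DifferentiableAt.fun_sum fun j _ => differentiableAt_hurwitzZetaEven _ hs
  · intro s hs
    exact (differentiableAt_id.const_cpow (Or.inl (by exact_mod_cast hk))).mul
      (differentiableAt_hurwitzZetaEven _ hs)

theorem hurwitzZetaEven_zero_left (s : ℂ) : hurwitzZetaEven 0 s = riemannZeta s := by
  rfl

/-! ### The expansion of the even Hurwitz zeta function at a lattice point -/

theorem hasDerivAt_ofReal_cpow_neg (s : ℂ) {t : ℝ} (ht : 0 < t) :
    HasDerivAt (fun t : ℝ => (t : ℂ) ^ (-s)) (-s * (t : ℂ) ^ (-s - 1)) t := by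
  have := ((hasDerivAt_id (t : ℂ)).cpow_const (c := -s)
    (Or.inl (by simpa using ht))).comp_ofReal
  simpa using this

theorem norm_ofReal_cpow_neg (s : ℂ) {t : ℝ} (ht : 0 < t) :
    ‖(t : ℂ) ^ (-s)‖ = t ^ (-s.re) := by
  rw [norm_cpow_eq_rpow_re_of_pos ht, neg_re]

theorem norm_ofReal_cpow_neg_sub_one (s : ℂ) {t : ℝ} (ht : 0 < t) :
    ‖(t : ℂ) ^ (-s - 1)‖ = t ^ (-s.re - 1) := by
  rw [norm_cpow_eq_rpow_re_of_pos ht, sub_re, neg_re, one_re]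

/-- The summand of the regular part of the even Hurwitz zeta function at `0`. -/
noncomputable def regularTerm (s : ℂ) (n : ℕ) (x : ℝ) : ℂ :=
  ((((n : ℝ) + 1 + x : ℝ) : ℂ) ^ (-s) + (((n : ℝ) + 1 - x : ℝ) : ℂ) ^ (-s)
    - 2 * (((n : ℝ) + 1 : ℝ) : ℂ) ^ (-s)) / 2

noncomputable def regularTermDeriv (s : ℂ) (n : ℕ) (x : ℝ) : ℂ :=
  (-s * (((n : ℝ) + 1 + x : ℝ) : ℂ) ^ (-s - 1) + s * (((n : ℝ) + 1 - x : ℝ) : ℂ) ^ (-s - 1)) / 2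

/-- The regular part: `ζ(s, x)` (even version) minus `ζ(s)` and `|x| ^ (-s) / 2`. -/
noncomputable def regularPart (s : ℂ) (x : ℝ) : ℂ := ∑' n : ℕ, regularTerm s n x

theorem hasDerivAt_regularTerm (s : ℂ) (n : ℕ) {x : ℝ} (hx : |x| < 3 / 4) :
    HasDerivAt (regularTerm s n) (regularTermDeriv s n x) x := by
  have hx' := abs_lt.mp hx
  have hn : (0 : ℝ) ≤ n := n.cast_nonneg
  have h1 := (hasDerivAt_ofReal_cpow_neg s (t := (n : ℝ) + 1 + x) (by linarith)).scomp x
    ((hasDerivAt_id x).const_add ((n : ℝ) + 1))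
  have h2 := (hasDerivAt_ofReal_cpow_neg s (t := (n : ℝ) + 1 - x) (by linarith)).scomp x
    ((hasDerivAt_id x).const_sub ((n : ℝ) + 1))
  have h3 := ((h1.add h2).sub_const (2 * (((n : ℝ) + 1 : ℝ) : ℂ) ^ (-s))).div_const 2
  convert! h3 using 1
  simp [regularTermDeriv]

/-- A summable majorant of `regularTermDeriv`. -/
noncomputable def regularMajorant (σ₀ : ℝ) (n : ℕ) : ℝ := 768 * (1 / ((n : ℝ) + 1) ^ (1 + σ₀))

theorem summable_regularMajorant {σ₀ : ℝ} (h : 0 < σ₀) : Summable (regularMajorant σ₀) := by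
  refine Summable.mul_left _ ?_
  have := (summable_nat_add_iff 1).mpr (Real.summable_one_div_nat_rpow.mpr (by linarith : 1 < 1 + σ₀))
  simpa using this

/-- For |x| < 3/4 both n + 1 + x and n + 1 - x are at least (n + 1)/4, so this applies to both
halves of `regularTermDeriv`. -/
theorem norm_cpow_le_of_quarter {σ₀ : ℝ} (h : 0 < σ₀) {s : ℂ} (hs : σ₀ ≤ s.re) (hs3 : ‖s‖ ≤ 3) (n : ℕ)
    {t : ℝ} (ht : ((n : ℝ) + 1) / 4 ≤ t) :
    ‖(t : ℂ) ^ (-s - 1)‖ ≤ 256 * (1 / ((n : ℝ) + 1) ^ (1 + σ₀)) := by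
  have hn : (0 : ℝ) < (n : ℝ) + 1 := by positivity
  have ht0 : 0 < t := by linarith [div_pos hn (by norm_num : (0 : ℝ) < 4)]
  have hre : s.re ≤ 3 := (le_abs_self _).trans ((abs_re_le_norm s).trans hs3)
  rw [norm_ofReal_cpow_neg_sub_one s ht0]
  calc t ^ (-s.re - 1) ≤ (((n : ℝ) + 1) / 4) ^ (-s.re - 1) :=
        Real.rpow_le_rpow_of_nonpos (by positivity) ht (by linarith)
    _ = ((n : ℝ) + 1) ^ (-s.re - 1) * 4 ^ (s.re + 1) := by
        rw [Real.div_rpow hn.le (by norm_num), div_eq_mul_inv, ← Real.rpow_neg (by norm_num)]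
        congr 2; ring
    -- re s + 1 ≤ 4 gives 4⁴ = 256; multiplied by ‖s‖ ≤ 3 this is the 768 of `regularMajorant`.
    _ ≤ ((n : ℝ) + 1) ^ (-(1 + σ₀)) * 4 ^ (4 : ℝ) := by
        gcongr
        · linarith
        · linarith
        · norm_num
        · linarith
    _ = 256 * (1 / ((n : ℝ) + 1) ^ (1 + σ₀)) := by
        rw [Real.rpow_neg hn.le, one_div, mul_comm]; norm_num

theorem norm_regularTermDeriv_le {σ₀ : ℝ} (h : 0 < σ₀) {s : ℂ} (hs : σ₀ ≤ s.re) (hs3 : ‖s‖ ≤ 3)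
    (n : ℕ) {x : ℝ} (hx : |x| < 3 / 4) : ‖regularTermDeriv s n x‖ ≤ regularMajorant σ₀ n := by
  have hx' := abs_lt.mp hx
  have hn : (0 : ℝ) ≤ n := n.cast_nonneg
  have h1 := norm_cpow_le_of_quarter h hs hs3 n (t := (n : ℝ) + 1 + x) (by linarith)
  have h2 := norm_cpow_le_of_quarter h hs hs3 n (t := (n : ℝ) + 1 - x) (by linarith)
  unfold regularTermDeriv regularMajorant
  rw [norm_div, norm_ofNat]
  have h3 := norm_add_le (-s * (((n : ℝ) + 1 + x : ℝ) : ℂ) ^ (-s - 1))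
    (s * (((n : ℝ) + 1 - x : ℝ) : ℂ) ^ (-s - 1))
  rw [norm_mul, norm_mul, norm_neg] at h3
  have h4 := mul_le_mul hs3 h1 (norm_nonneg _) (by norm_num)
  have h5 := mul_le_mul hs3 h2 (norm_nonneg _) (by norm_num)
  linarith

theorem regularTerm_zero (s : ℂ) (n : ℕ) : regularTerm s n 0 = 0 := by
  simp [regularTerm]; ring

theorem regularPart_zero (s : ℂ) : regularPart s 0 = 0 := by
  simp [regularPart, regularTerm_zero]

theorem mem_ball_three_quarters {x : ℝ} : x ∈ Metric.ball (0 : ℝ) (3 / 4) ↔ |x| < 3 / 4 := by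
  simp [Metric.mem_ball]

/-- Differentiation in x gains one power of n, so the differentiated series converges absolutely for
re s > 0, whereas ∑ (n + x)^(-s) itself needs re s > 1. This is what makes the expansion usable near
re s = 1/2. -/
theorem hasDerivAt_regularPart {σ₀ : ℝ} (h : 0 < σ₀) {s : ℂ} (hs : σ₀ ≤ s.re) (hs3 : ‖s‖ ≤ 3)
    {x : ℝ} (hx : |x| < 3 / 4) :
    HasDerivAt (regularPart s) (∑' n, regularTermDeriv s n x) x :=
  hasDerivAt_tsum_of_isPreconnected (summable_regularMajorant h) Metric.isOpen_ball
    (convex_ball (0 : ℝ) (3 / 4)).isPreconnected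
    (fun n _ hy => hasDerivAt_regularTerm s n (mem_ball_three_quarters.mp hy))
    (fun n _ hy => norm_regularTermDeriv_le h hs hs3 n (mem_ball_three_quarters.mp hy))
    (Metric.mem_ball_self (by norm_num)) (by simp [regularTerm_zero])
    (mem_ball_three_quarters.mpr hx)

theorem norm_regularPart_deriv_le {σ₀ : ℝ} (h : 0 < σ₀) {s : ℂ} (hs : σ₀ ≤ s.re) (hs3 : ‖s‖ ≤ 3)
    {x : ℝ} (hx : |x| < 3 / 4) :
    ‖∑' n, regularTermDeriv s n x‖ ≤ ∑' n, regularMajorant σ₀ n :=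
  tsum_of_norm_bounded (summable_regularMajorant h).hasSum
    fun n => norm_regularTermDeriv_le h hs hs3 n hx

theorem norm_regularTerm_le {σ₀ : ℝ} (h : 0 < σ₀) {s : ℂ} (hs : σ₀ ≤ s.re) (hs3 : ‖s‖ ≤ 3)
    (n : ℕ) {x : ℝ} (hx : |x| < 3 / 4) : ‖regularTerm s n x‖ ≤ regularMajorant σ₀ n := by
  have := (convex_ball (0 : ℝ) (3 / 4)).norm_image_sub_le_of_norm_hasDerivWithin_le
    (fun y hy => (hasDerivAt_regularTerm s n (mem_ball_three_quarters.mp hy)).hasDerivWithinAt)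
    (fun y hy => norm_regularTermDeriv_le h hs hs3 n (mem_ball_three_quarters.mp hy))
    (Metric.mem_ball_self (by norm_num)) (mem_ball_three_quarters.mpr hx)
  rw [regularTerm_zero, sub_zero, sub_zero, Real.norm_eq_abs] at this
  refine this.trans (mul_le_of_le_one_right ?_ (by linarith))
  unfold regularMajorant; positivity

theorem norm_regularPart_le {σ₀ : ℝ} (h : 0 < σ₀) {s : ℂ} (hs : σ₀ ≤ s.re) (hs3 : ‖s‖ ≤ 3)
    {x : ℝ} (hx : |x| < 3 / 4) :
    ‖regularPart s x‖ ≤ (∑' n, regularMajorant σ₀ n) * |x| := by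
  have := (convex_ball (0 : ℝ) (3 / 4)).norm_image_sub_le_of_norm_hasDerivWithin_le
    (fun y hy => (hasDerivAt_regularPart h hs hs3 (mem_ball_three_quarters.mp hy)).hasDerivWithinAt)
    (fun y hy => norm_regularPart_deriv_le h hs hs3 (mem_ball_three_quarters.mp hy))
    (Metric.mem_ball_self (by norm_num)) (mem_ball_three_quarters.mpr hx)
  rwa [regularPart_zero, sub_zero, sub_zero, Real.norm_eq_abs] at this

theorem regularPart_neg (s : ℂ) (x : ℝ) : regularPart s (-x) = regularPart s x := by
  unfold regularPart
  refine tsum_congr fun n => ?_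
  unfold regularTerm
  rw [sub_neg_eq_add, ← sub_eq_add_neg]
  ring

/-- The term of index 0 supplies |x|^(-s)/2; the remaining terms n + 1 ± x, minus their values at x
= 0, are the regular part. -/
theorem hurwitzZetaEven_expansion_of_one_lt_re {x : ℝ} (h0 : 0 < x) (h1 : x < 3 / 4) {s : ℂ}
    (hs : 1 < s.re) :
    hurwitzZetaEven x s - hurwitzZetaEven 0 s = (x : ℂ) ^ (-s) / 2 + regularPart s x := by
  have hA := hasSum_nat_hurwitzZetaEven_of_mem_Icc (a := x) ⟨h0.le, by linarith⟩ hs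
  have hB := hasSum_nat_hurwitzZetaEven_of_mem_Icc (a := 0) ⟨le_rfl, zero_le_one⟩ hs
  have sx : Summable (fun n : ℕ => 1 / ((n : ℂ) + x) ^ s) := by
    have := (Real.summable_one_div_nat_add_rpow x s.re).mpr hs
    refine Summable.of_norm (this.congr fun n => ?_)
    have : (0 : ℝ) < n + x := by positivity
    rw [norm_div, norm_one, ← ofReal_natCast, ← ofReal_add, norm_cpow_eq_rpow_re_of_pos this,
      abs_of_pos this]
  have s0 : Summable (fun n : ℕ => 1 / ((n : ℂ)) ^ s) := summable_one_div_nat_cpow.mpr hs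
  have s1 : Summable (fun n : ℕ => 1 / ((n : ℂ) + 1) ^ s) := by
    simpa using (summable_nat_add_iff 1).mpr s0
  have sx1 : Summable (fun n : ℕ => 1 / ((n : ℂ) + 1 + x) ^ s) := by
    have := (summable_nat_add_iff 1).mpr sx
    refine this.congr fun n => by push_cast; ring_nf
  have sy : Summable (fun n : ℕ => 1 / ((n : ℂ) + 1 - x) ^ s) := by
    have := (hA.summable.mul_left 2).sub sx
    refine this.congr fun n => by ring
  have hs0 : s ≠ 0 := by rintro rfl; simp at hs; linarith
  have eA : hurwitzZetaEven x s = (1 / (x : ℂ) ^ s + ∑' n : ℕ, 1 / ((n : ℂ) + 1 + x) ^ s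
      + ∑' n : ℕ, 1 / ((n : ℂ) + 1 - x) ^ s) / 2 := by
    rw [← hA.tsum_eq, tsum_div_const, sx.tsum_add sy, sx.tsum_eq_zero_add]
    congr 3
    · simp
    · refine tsum_congr fun n => by push_cast; ring_nf
  have eB : hurwitzZetaEven 0 s = ∑' n : ℕ, 1 / ((n : ℂ) + 1) ^ s := by
    have := hB.tsum_eq
    simp only [ofReal_zero, add_zero, sub_zero, QuotientAddGroup.mk_zero] at this
    rw [← this, tsum_div_const, s0.tsum_add s1, s0.tsum_eq_zero_add]
    simp [hs0]
  have eR : regularPart s x = (∑' n : ℕ, 1 / ((n : ℂ) + 1 + x) ^ s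
      + ∑' n : ℕ, 1 / ((n : ℂ) + 1 - x) ^ s - 2 * ∑' n : ℕ, 1 / ((n : ℂ) + 1) ^ s) / 2 := by
    unfold regularPart regularTerm
    rw [tsum_div_const, ← tsum_mul_left, ← sx1.tsum_add sy, ← (sx1.add sy).tsum_sub (s1.mul_left 2)]
    congr 1
    refine tsum_congr fun n => ?_
    push_cast
    rw [cpow_neg, cpow_neg, cpow_neg, one_div, one_div, one_div]
  rw [eA, eB, eR, cpow_neg]
  ring

theorem differentiableOn_regularPart {x : ℝ} (hx : |x| < 3 / 4) {σ₀ : ℝ} (h : 0 < σ₀) :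
    DifferentiableOn ℂ (fun z => regularPart z x) ({z : ℂ | σ₀ < z.re} ∩ Metric.ball 0 3) := by
  refine differentiableOn_tsum_of_summable_norm (summable_regularMajorant h) ?_
    ((isOpen_lt continuous_const continuous_re).inter Metric.isOpen_ball) ?_
  · intro n z _
    have hn : (0 : ℝ) ≤ n := n.cast_nonneg
    have hx' := abs_lt.mp hx
    have : ∀ t : ℝ, 0 < t → DifferentiableAt ℂ (fun z : ℂ => (t : ℂ) ^ (-z)) z := fun t ht =>
      differentiableAt_id.neg.const_cpow (Or.inl (by simpa using ht.ne'))
    exact (((this _ (by linarith)).add (this _ (by linarith))).sub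
      ((this _ (by linarith)).const_mul 2)).div_const 2 |>.differentiableWithinAt
  · rintro n z ⟨hz, hz3⟩
    exact norm_regularTerm_le h (le_of_lt hz) (by simpa using (Metric.mem_ball.mp hz3).le) n hx

/-- Analytic continuation on the convex region re s > 0, ‖s‖ < 3. Subtracting the value at 0 removes
the pole at s = 1, so the left side is entire and the region need not be punctured. -/
theorem hurwitzZetaEven_expansion_of_pos {x : ℝ} (h0 : 0 < x) (h1 : x < 3 / 4) {s : ℂ}
    (hs : 0 < s.re) (hs3 : ‖s‖ < 3) :
    hurwitzZetaEven x s - hurwitzZetaEven 0 s = (x : ℂ) ^ (-s) / 2 + regularPart s x := by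
  let U : Set ℂ := {z | 0 < z.re} ∩ Metric.ball 0 3
  have hU : IsOpen U := (isOpen_lt continuous_const continuous_re).inter Metric.isOpen_ball
  have hreg : DifferentiableOn ℂ (fun z => regularPart z x) U := by
    rintro z ⟨hz, hz3⟩
    have hz' : 0 < z.re := hz
    have := differentiableOn_regularPart (x := x) (by rwa [abs_of_pos h0]) (half_pos hz')
    refine (this.differentiableAt (IsOpen.mem_nhds ?_ ⟨?_, hz3⟩)).differentiableWithinAt
    · exact (isOpen_lt continuous_const continuous_re).inter Metric.isOpen_ball
    · exact half_lt_self hz'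
  have hf : AnalyticOnNhd ℂ (fun z => hurwitzZetaEven x z - hurwitzZetaEven 0 z) U :=
    (differentiable_hurwitzZetaEven_sub_hurwitzZetaEven _ _).differentiableOn.analyticOnNhd hU
  have hg : AnalyticOnNhd ℂ (fun z => (x : ℂ) ^ (-z) / 2 + regularPart z x) U := by
    refine DifferentiableOn.analyticOnNhd (DifferentiableOn.add ?_ hreg) hU
    intro z _
    exact ((differentiableAt_id.neg.const_cpow (Or.inl (by simpa using h0.ne'))).div_const
      2).differentiableWithinAt
  have hpre : IsPreconnected U :=
    ((convex_halfSpace_re_gt 0).inter (convex_ball 0 3)).isPreconnected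
  refine hf.eqOn_of_preconnected_of_eventuallyEq hg hpre (z₀ := 2) ⟨by simp, by simp; norm_num⟩ ?_
    ⟨hs, by simpa using hs3⟩
  have : {z : ℂ | 1 < z.re} ∈ 𝓝 (2 : ℂ) :=
    (isOpen_lt continuous_const continuous_re).mem_nhds (by simp)
  filter_upwards [this] with z hz using hurwitzZetaEven_expansion_of_one_lt_re h0 h1 hz

theorem hurwitzZetaEven_expansion {x : ℝ} (h0 : x ≠ 0) (h1 : |x| < 3 / 4) {s : ℂ}
    (hs : 0 < s.re) (hs3 : ‖s‖ < 3) :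
    hurwitzZetaEven x s = riemannZeta s + ((|x| : ℝ) : ℂ) ^ (-s) / 2 + regularPart s x := by
  have key : hurwitzZetaEven ((|x| : ℝ) : UnitAddCircle) s = riemannZeta s + ((|x| : ℝ) : ℂ) ^ (-s) / 2 + regularPart s |x| := by
    have := hurwitzZetaEven_expansion_of_pos (abs_pos.mpr h0) h1 hs hs3
    rw [hurwitzZetaEven_zero_left] at this
    linear_combination this
  rcases abs_choice x with h | h
  · rwa [h] at key ⊢
  · rw [h] at key ⊢
    rwa [AddCircle.coe_neg, hurwitzZetaEven_neg, regularPart_neg] at key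

end DirichletMeanSquare

namespace DirichletMeanSquare

open Complex HurwitzZeta Filter Topology MeasureTheory

/-! ### Riemann sums of periodic functions -/

/-- On an interval of length 1/k, F differs from its left endpoint value by at most the integral of
G there; multiplying by k · (1/k) and summing gives the total variation, with no dependence on k or
on the starting point. The countable exceptional set is harmless because F is continuous. -/
theorem norm_riemannSum_sub_integral_le {F : ℝ → ℂ} {G : ℝ → ℝ} {S : Set ℝ} (hS : S.Countable)
    (hF : Continuous F) (hFper : Function.Periodic F 1) (hGper : Function.Periodic G 1)
    (hG : IntervalIntegrable G volume 0 1)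
    (hd : ∀ x ∉ S, ∃ d, HasDerivAt F d x ∧ ‖d‖ ≤ G x) {k : ℕ} (hk : k ≠ 0) (x₀ : ℝ) :
    ‖∑ j ∈ Finset.range k, F (x₀ + (j : ℝ) / k) - k * ∫ x in (0 : ℝ)..1, F x‖
      ≤ ∫ x in (0 : ℝ)..1, G x := by
  have hk0 : (0 : ℝ) < k := by positivity
  have hGi : ∀ a b : ℝ, IntervalIntegrable G volume a b := fun a b =>
    hGper.intervalIntegrable (t := 0) one_ne_zero (by simpa using hG) a b
  have hae : ∀ a b : ℝ, a ≤ b → ∀ᵐ x ∂volume.restrict (Set.uIoc a b), ‖deriv F x‖ ≤ G x := by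
    intro a b _
    refine ae_restrict_of_ae ?_
    filter_upwards [hS.ae_notMem volume] with x hx
    obtain ⟨d, h1, h2⟩ := hd x hx
    rwa [h1.deriv]
  have hFd : ∀ a b : ℝ, a ≤ b → IntervalIntegrable (deriv F) volume a b := fun a b hab =>
    (hGi a b).mono_fun (aestronglyMeasurable_deriv F _) (by
      filter_upwards [hae a b hab] with x hx using hx.trans (le_abs_self _))
  have hdiff : ∀ a b : ℝ, a ≤ b → ‖F b - F a‖ ≤ ∫ x in a..b, G x := by
    intro a b hab
    rw [← integral_eq_of_hasDerivAt_off_countable F (deriv F) hS hF.continuousOn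
      (fun x hx => by
        obtain ⟨d, h1, _⟩ := hd x hx.2
        rwa [h1.deriv]) (hFd a b hab)]
    refine intervalIntegral.norm_integral_le_of_norm_le hab ?_ (hGi a b)
    have := hae a b hab
    rw [Set.uIoc_of_le hab, ae_restrict_iff' measurableSet_Ioc] at this
    exact this
  have hpos : ∀ a b : ℝ, a ≤ b → 0 ≤ ∫ x in a..b, G x := fun a b hab =>
    (norm_nonneg _).trans (hdiff a b hab)
  have hpiece : ∀ a b : ℝ, a ≤ b → ‖F a * ((b - a : ℝ) : ℂ) - ∫ x in a..b, F x‖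
      ≤ (b - a) * ∫ x in a..b, G x := by
    intro a b hab
    have e : F a * ((b - a : ℝ) : ℂ) - ∫ x in a..b, F x = ∫ x in a..b, (F a - F x) := by
      rw [intervalIntegral.integral_sub (by simp) (hF.intervalIntegrable _ _)]
      simp [mul_comm]
    rw [e]
    have := intervalIntegral.norm_integral_le_of_norm_le_const (a := a) (b := b)
      (C := ∫ x in a..b, G x) (f := fun x => F a - F x) (fun x hx => by
        rw [Set.uIoc_of_le hab] at hx
        rw [norm_sub_rev]
        refine (hdiff a x hx.1.le).trans ?_
        rw [← intervalIntegral.integral_add_adjacent_intervals (hGi a x) (hGi x b)]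
        linarith [hpos x b hx.2])
    rwa [abs_of_nonneg (by linarith), mul_comm] at this
  let p : ℕ → ℝ := fun j => x₀ + (j : ℝ) / k
  have hp : ∀ j, p (j + 1) - p j = 1 / k := fun j => by
    simp only [p]; push_cast; field_simp; ring
  have hp' : ∀ j, p j ≤ p (j + 1) := fun j => by
    have := hp j
    have : (0 : ℝ) < 1 / k := by positivity
    linarith
  have hp0 : p 0 = x₀ := by simp [p]
  have hpk : p k = x₀ + 1 := by simp [p, hk]
  have hsumF : ∑ j ∈ Finset.range k, ∫ x in p j..p (j + 1), F x = ∫ x in (0 : ℝ)..1, F x := by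
    rw [intervalIntegral.sum_integral_adjacent_intervals
      (fun j _ => hF.intervalIntegrable _ _), hp0, hpk, hFper.intervalIntegral_add_eq x₀ 0, zero_add]
  have hsumG : ∑ j ∈ Finset.range k, ∫ x in p j..p (j + 1), G x = ∫ x in (0 : ℝ)..1, G x := by
    rw [intervalIntegral.sum_integral_adjacent_intervals
      (fun j _ => hGi _ _), hp0, hpk, hGper.intervalIntegral_add_eq x₀ 0, zero_add]
  have hk' : (k : ℂ) ≠ 0 := by exact_mod_cast hk
  have e : ∑ j ∈ Finset.range k, F (x₀ + (j : ℝ) / k) - k * ∫ x in (0 : ℝ)..1, F x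
      = ∑ j ∈ Finset.range k,
        (k : ℂ) * (F (p j) * ((p (j + 1) - p j : ℝ) : ℂ) - ∫ x in p j..p (j + 1), F x) := by
    rw [← hsumF, Finset.mul_sum, ← Finset.sum_sub_distrib]
    refine Finset.sum_congr rfl fun j _ => ?_
    have h1 : (k : ℂ) * (F (p j) * ((1 / k : ℝ) : ℂ)) = F (p j) := by
      push_cast
      field_simp
    rw [hp, mul_sub, h1]
  rw [e, ← hsumG]
  refine (norm_sum_le _ _).trans (Finset.sum_le_sum fun j _ => ?_)
  have := hpiece _ _ (hp' j)
  rw [norm_mul, Complex.norm_natCast]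
  calc (k : ℝ) * _ ≤ k * ((p (j + 1) - p j) * ∫ x in p j..p (j + 1), G x) := by gcongr
    _ = ∫ x in p j..p (j + 1), G x := by rw [hp]; field_simp

/-! ### The distance to the nearest integer -/

theorem exists_rep_norm (x : ℝ) : ∃ n : ℤ, ‖(x : UnitAddCircle)‖ = |x - n| ∧ |x - n| ≤ 1 / 2 :=
  ⟨round x, UnitAddCircle.norm_eq, abs_sub_round x⟩

theorem coe_sub_int (x : ℝ) (n : ℤ) : ((x - n : ℝ) : UnitAddCircle) = (x : UnitAddCircle) := by
  rw [AddCircle.coe_sub]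
  have : ((n : ℝ) : UnitAddCircle) = 0 := by
    rw [AddCircle.coe_eq_zero_iff]
    exact ⟨n, by simp⟩
  rw [this, sub_zero]

theorem norm_coe_of_abs_le_half {x : ℝ} (hx : |x| ≤ 1 / 2) : ‖(x : UnitAddCircle)‖ = |x| := by
  rw [AddCircle.norm_coe_eq_abs_iff (1 : ℝ) one_ne_zero]
  simpa using hx

theorem norm_le_half (x : UnitAddCircle) : ‖x‖ ≤ 1 / 2 := by
  simpa using AddCircle.norm_le_half_period (1 : ℝ) (x := x) one_ne_zero

theorem intervalIntegrable_norm_rpow {η : ℝ} (hη : 0 < η) :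
    IntervalIntegrable (fun x : ℝ => ‖(x : UnitAddCircle)‖ ^ (η - 1)) volume 0 1 := by
  have h1 : IntervalIntegrable (fun x : ℝ => ‖(x : UnitAddCircle)‖ ^ (η - 1)) volume 0 (1 / 2) := by
    refine (intervalIntegral.intervalIntegrable_rpow' (r := η - 1) (by linarith)).congr ?_
    intro x hx
    rw [Set.uIoc_of_le (by norm_num)] at hx
    have : |x| = x := abs_of_pos hx.1
    simp only
    rw [norm_coe_of_abs_le_half (by rw [this]; exact hx.2), this]
  have h2 : IntervalIntegrable (fun x : ℝ => ‖(x : UnitAddCircle)‖ ^ (η - 1)) volume (1 / 2) 1 := by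
    have := (h1.comp_sub_left 1).symm
    norm_num at this
    refine this.congr ?_
    intro x _
    simp only
    congr 1
    rw [norm_sub_rev]
    have := coe_sub_int x 1
    rw [AddCircle.coe_sub] at this
    simpa using congrArg norm this
  exact h1.trans h2

/-! ### Even functions on the circle with a power singularity at `0` -/

/-- Modelled on Z_s with σ = re s. The value at 0 is left free (for Z_s it is ζ(s)), and derivatives
are taken along the covering line. -/
structure IsPowerSingular (u : UnitAddCircle → ℂ) (σ K : ℝ) : Prop where
  even : ∀ x, u (-x) = u x
  bound : ∀ x ≠ 0, ‖u x‖ ≤ K * ‖x‖ ^ (-σ)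
  deriv : ∀ x : ℝ, (x : UnitAddCircle) ≠ 0 →
    ∃ d, HasDerivAt (fun t : ℝ => u t) d x ∧ ‖d‖ ≤ K * ‖(x : UnitAddCircle)‖ ^ (-σ - 1)

theorem IsPowerSingular.nonneg {u : UnitAddCircle → ℂ} {σ K : ℝ} (hu : IsPowerSingular u σ K) :
    0 ≤ K := by
  have h2 : ‖((1 / 2 : ℝ) : UnitAddCircle)‖ = 1 / 2 := by
    rw [norm_coe_of_abs_le_half] <;> norm_num [abs_of_pos]
  have h0 : ((1 / 2 : ℝ) : UnitAddCircle) ≠ 0 := by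
    rw [← norm_ne_zero_iff, h2]; norm_num
  have h := (norm_nonneg _).trans (hu.bound _ h0)
  rw [h2] at h
  exact nonneg_of_mul_nonneg_left h (by positivity)

theorem rpow_neg_half_le {θ σ : ℝ} (hθ : 0 < θ) (hσ : σ ≤ 1) : (θ / 2) ^ (-σ) ≤ 2 * θ ^ (-σ) := by
  rw [Real.div_rpow hθ.le (by norm_num), div_eq_mul_inv, ← Real.rpow_neg (by norm_num), neg_neg,
    mul_comm]
  gcongr
  calc (2 : ℝ) ^ σ ≤ 2 ^ (1 : ℝ) := Real.rpow_le_rpow_of_exponent_le (by norm_num) hσ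
    _ = 2 := Real.rpow_one 2

/-- If ‖x‖ ≤ ‖θ‖/2, the segment from θ to θ + x stays at distance at least ‖θ‖/2 from the
singularity and the mean value inequality gives a factor ‖x‖/‖θ‖, at most its p-th power. Otherwise
that ratio is at least 1/2 and the two values are bounded separately. The free exponent p lets this
difference cancel exactly as much of another factor's singularity at x = 0 as needed. -/
theorem IsPowerSingular.norm_sub_le {v : UnitAddCircle → ℂ} {σ K : ℝ}
    (hv : IsPowerSingular v σ K) (hσ0 : 0 ≤ σ) (hσ1 : σ ≤ 1) {θ x : UnitAddCircle} (hθ : θ ≠ 0)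
    (hx : x + θ ≠ 0) {p : ℝ} (hp0 : 0 ≤ p) (hp1 : p ≤ 1) :
    ‖v (x + θ) - v θ‖ ≤ 8 * K * (‖x‖ / ‖θ‖) ^ p * (‖θ‖ ^ (-σ) + ‖x + θ‖ ^ (-σ)) := by
  have hK := hv.nonneg
  have hθ0 : 0 < ‖θ‖ := norm_pos_iff.mpr hθ
  have hx0 : 0 < ‖x + θ‖ := norm_pos_iff.mpr hx
  have hB : 0 ≤ ‖x + θ‖ ^ (-σ) := by positivity
  rcases le_or_gt ‖x‖ (‖θ‖ / 2) with h | h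
  · induction θ using QuotientAddGroup.induction_on with
    | H t =>
    induction x using QuotientAddGroup.induction_on with
    | H y =>
    obtain ⟨n, hn, _⟩ := exists_rep_norm y
    set z := y - n with hz
    have ez : (y : UnitAddCircle) = (z : UnitAddCircle) := (coe_sub_int y n).symm
    change ‖(y : UnitAddCircle)‖ ≤ _ at h
    change ‖v ((y : UnitAddCircle) + t) - v t‖ ≤ 8 * K * (‖(y : UnitAddCircle)‖ / ‖(t : UnitAddCircle)‖) ^ p *
      (‖(t : UnitAddCircle)‖ ^ (-σ) + ‖(y : UnitAddCircle) + t‖ ^ (-σ))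
    change 0 < ‖(t : UnitAddCircle)‖ at hθ0
    change 0 ≤ ‖(y : UnitAddCircle) + t‖ ^ (-σ) at hB
    set T := ‖(t : UnitAddCircle)‖ with hT
    have hseg : ∀ r ∈ Metric.closedBall t |z|, T / 2 ≤ ‖(r : UnitAddCircle)‖ := by
      intro r hr
      have h1 : ‖((r - t : ℝ) : UnitAddCircle)‖ ≤ |r - t| := by
        rw [UnitAddCircle.norm_eq]
        simpa using round_le (r - t) 0
      have h2 : |r - t| ≤ T / 2 := by
        rw [Metric.mem_closedBall, Real.dist_eq] at hr
        rw [hn] at h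
        linarith
      have h3 := norm_sub_norm_le (t : UnitAddCircle) (r : UnitAddCircle)
      rw [norm_sub_rev, ← AddCircle.coe_sub] at h3
      linarith
    have hne : ∀ r ∈ Metric.closedBall t |z|, (r : UnitAddCircle) ≠ 0 := fun r hr => by
      rw [← norm_pos_iff]
      linarith [hseg r hr]
    have hmv := (convex_closedBall t |z|).norm_image_sub_le_of_norm_hasDerivWithin_le
      (f := fun r : ℝ => v r) (f' := fun r => _root_.deriv (fun r : ℝ => v r) r)
      (C := K * (T / 2) ^ (-σ - 1)) (x := t) (y := t + z)
      (fun r hr => by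
        obtain ⟨d, h1, _⟩ := hv.deriv r (hne r hr)
        rw [h1.deriv]
        exact h1.hasDerivWithinAt)
      (fun r hr => by
        obtain ⟨d, h1, h2⟩ := hv.deriv r (hne r hr)
        rw [h1.deriv]
        refine h2.trans ?_
        gcongr K * ?_
        exact Real.rpow_le_rpow_of_nonpos (by positivity) (hseg r hr) (by linarith))
      (by simp) (by simp)
    have e1 : ((t + z : ℝ) : UnitAddCircle) = (y : UnitAddCircle) + t := by
      rw [AddCircle.coe_add, ez, add_comm]
    rw [e1] at hmv
    have e2 : ‖t + z - t‖ = ‖(y : UnitAddCircle)‖ := by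
      rw [add_sub_cancel_left, hn, Real.norm_eq_abs]
    rw [e2] at hmv
    refine hmv.trans ?_
    set X := ‖(y : UnitAddCircle)‖
    have hX : 0 ≤ X := norm_nonneg _
    have e3 : (T / 2) ^ (-σ - 1) ≤ 4 * (T ^ (-σ) / T) := by
      rw [Real.rpow_sub_one (by positivity)]
      have := rpow_neg_half_le hθ0 hσ1
      calc (T / 2) ^ (-σ) / (T / 2) ≤ (2 * T ^ (-σ)) / (T / 2) := by gcongr
        _ = 4 * (T ^ (-σ) / T) := by field_simp; ring
    have e4 : X / T ≤ (X / T) ^ p := by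
      have h1 : X / T ≤ 1 := by
        rw [div_le_one hθ0]; linarith
      calc X / T = (X / T) ^ (1 : ℝ) := (Real.rpow_one _).symm
        _ ≤ (X / T) ^ p := Real.rpow_le_rpow_of_exponent_ge_of_imp (by positivity) h1 hp1
          (fun _ h => by norm_num at h)
    calc K * (T / 2) ^ (-σ - 1) * X ≤ K * (4 * (T ^ (-σ) / T)) * X := by gcongr
      _ = 4 * K * (X / T) * T ^ (-σ) := by ring
      _ ≤ 8 * K * (X / T) ^ p * (T ^ (-σ) + ‖(y : UnitAddCircle) + t‖ ^ (-σ)) := by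
        gcongr
        · norm_num
        · linarith
  · have e4 : 1 / 2 ≤ (‖x‖ / ‖θ‖) ^ p := by
      have h1 : (1 / 2 : ℝ) ≤ ‖x‖ / ‖θ‖ := by
        rw [le_div_iff₀ hθ0]; linarith
      calc (1 / 2 : ℝ) = (1 / 2) ^ (1 : ℝ) := (Real.rpow_one _).symm
        _ ≤ (1 / 2) ^ p := Real.rpow_le_rpow_of_exponent_ge (by norm_num) (by norm_num) hp1
        _ ≤ _ := by gcongr
    have hA : 0 ≤ ‖θ‖ ^ (-σ) := by positivity
    calc ‖v (x + θ) - v θ‖ ≤ ‖v (x + θ)‖ + ‖v θ‖ := _root_.norm_sub_le _ _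
      _ ≤ K * ‖x + θ‖ ^ (-σ) + K * ‖θ‖ ^ (-σ) := add_le_add (hv.bound _ hx) (hv.bound _ hθ)
      _ = 2 * K * (1 / 2) * (‖θ‖ ^ (-σ) + ‖x + θ‖ ^ (-σ)) := by ring
      _ ≤ 8 * K * (‖x‖ / ‖θ‖) ^ p * (‖θ‖ ^ (-σ) + ‖x + θ‖ ^ (-σ)) := by gcongr; norm_num

/-- The larger of A and B is at least θ/2. If it is B, then B^(-σ) is bounded directly; if it is A,
a factor A^(-σ) is split off and the rest, whose exponent η - 1 + σ is not positive, is compared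
with the same power of B. -/
theorem rpow_mul_rpow_le_of_add_ge {A B θ η σ : ℝ} (hA : 0 < A) (hB : 0 < B) (hθ : 0 < θ)
    (hσ0 : 0 ≤ σ) (hση : σ + η ≤ 1) (hη0 : 0 < η) (h : θ ≤ A + B) :
    A ^ (η - 1) * B ^ (-σ) ≤ 2 * θ ^ (-σ) * (A ^ (η - 1) + B ^ (η - 1)) := by
  have hT : 0 ≤ θ ^ (-σ) := by positivity
  have hA' : 0 ≤ A ^ (η - 1) := by positivity
  have hB' : 0 ≤ B ^ (η - 1) := by positivity
  have key : ∀ C : ℝ, θ / 2 ≤ C → C ^ (-σ) ≤ 2 * θ ^ (-σ) := fun C hC =>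
    (Real.rpow_le_rpow_of_nonpos (by positivity) hC (by linarith)).trans
      (rpow_neg_half_le hθ (by linarith))
  rcases le_total A B with h1 | h1
  · have := key B (by linarith)
    nlinarith [mul_nonneg hT hB']
  · have h2 := key A (by linarith)
    have h3 : A ^ (η - 1 + σ) ≤ B ^ (η - 1 + σ) := Real.rpow_le_rpow_of_nonpos hB h1 (by linarith)
    have e1 : A ^ (η - 1) = A ^ (-σ) * A ^ (η - 1 + σ) := by rw [← Real.rpow_add hA]; congr 1; ring
    have e2 : B ^ (η - 1) = B ^ (η - 1 + σ) * B ^ (-σ) := by rw [← Real.rpow_add hB]; congr 1; ring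
    calc A ^ (η - 1) * B ^ (-σ) = A ^ (-σ) * (A ^ (η - 1 + σ) * B ^ (-σ)) := by rw [e1]; ring
      _ ≤ 2 * θ ^ (-σ) * (B ^ (η - 1 + σ) * B ^ (-σ)) := by gcongr
      _ = 2 * θ ^ (-σ) * B ^ (η - 1) := by rw [← e2]
      _ ≤ _ := by nlinarith [mul_nonneg hT hA']

/-- The product of two singular functions, each made to vanish at the singularity of the other. -/
noncomputable def pairKernel (u v : UnitAddCircle → ℂ) (θ x : UnitAddCircle) : ℂ :=
  (u x - u θ) * (v (x + θ) - v θ)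

/-- The reflection x ↦ -x - θ exchanges the two singular points, so only the one at 0 has to be
examined. -/
theorem pairKernel_swap {u v : UnitAddCircle → ℂ} (hu : ∀ x, u (-x) = u x) (hv : ∀ x, v (-x) = v x)
    (θ x : UnitAddCircle) : pairKernel u v θ x = pairKernel v u θ (-x - θ) := by
  unfold pairKernel
  rw [sub_add_cancel, hu, ← neg_add', hv, mul_comm]

/-- One half of the product rule. Near 0, u' has size ‖x‖^(-σ₁ - 1); the difference of v, bounded
with exponent p = σ₁ + η, leaves the integrable ‖x‖^(η - 1), and the scale of θ carries the
remaining homogeneity -σ₁ - σ₂ - η. -/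
theorem exists_deriv_factor_bound {u v : UnitAddCircle → ℂ} {σ₁ σ₂ K η : ℝ}
    (hu : IsPowerSingular u σ₁ K) (hv : IsPowerSingular v σ₂ K) (h1 : 0 ≤ σ₁) (h2 : 0 ≤ σ₂)
    (hη : 0 < η) (h1η : σ₁ + η ≤ 1) (h2η : σ₂ + η ≤ 1) {θ : UnitAddCircle} (hθ : θ ≠ 0)
    {x : ℝ} (hx : (x : UnitAddCircle) ≠ 0) (hxθ : (x : UnitAddCircle) + θ ≠ 0) :
    ∃ d, HasDerivAt (fun t : ℝ => u t) d x ∧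
      ‖d‖ * ‖v (x + θ) - v θ‖ ≤ 24 * K ^ 2 * ‖θ‖ ^ (-σ₁ - σ₂ - η) *
        (‖(x : UnitAddCircle)‖ ^ (η - 1) + ‖(x : UnitAddCircle) + θ‖ ^ (η - 1)) := by
  obtain ⟨d, hd, hdb⟩ := hu.deriv x hx
  refine ⟨d, hd, ?_⟩
  have hK := hu.nonneg
  have hdiff := hv.norm_sub_le h2 (by linarith) hθ hxθ (p := σ₁ + η) (by linarith) (by linarith)
  have hA : 0 < ‖(x : UnitAddCircle)‖ := norm_pos_iff.mpr hx
  have hB : 0 < ‖(x : UnitAddCircle) + θ‖ := norm_pos_iff.mpr hxθ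
  have hT : 0 < ‖θ‖ := norm_pos_iff.mpr hθ
  have htri : ‖θ‖ ≤ ‖(x : UnitAddCircle)‖ + ‖(x : UnitAddCircle) + θ‖ := by
    have := norm_sub_le ((x : UnitAddCircle) + θ) (x : UnitAddCircle)
    rw [add_sub_cancel_left] at this
    linarith
  have hprod := rpow_mul_rpow_le_of_add_ge hA hB hT h2 h2η hη htri
  set A := ‖(x : UnitAddCircle)‖
  set B := ‖(x : UnitAddCircle) + θ‖
  set T := ‖θ‖
  have hA' : 0 ≤ A ^ (η - 1) := by positivity
  have hB' : 0 ≤ B ^ (η - 1) := by positivity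
  have e1 : A ^ (-σ₁ - 1) * (A / T) ^ (σ₁ + η) = A ^ (η - 1) * T ^ (-σ₁ - η) := by
    rw [Real.div_rpow hA.le hT.le, div_eq_mul_inv, ← Real.rpow_neg hT.le, ← mul_assoc,
      ← Real.rpow_add hA]
    congr 2 <;> ring
  have e2 : T ^ (-σ₁ - σ₂ - η) = T ^ (-σ₁ - η) * T ^ (-σ₂) := by
    rw [← Real.rpow_add hT]; congr 1; ring
  have hT1 : 0 ≤ T ^ (-σ₁ - η) := by positivity
  have hT2 : 0 ≤ T ^ (-σ₂) := by positivity
  calc ‖d‖ * ‖v (x + θ) - v θ‖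
      ≤ (K * A ^ (-σ₁ - 1)) * (8 * K * (A / T) ^ (σ₁ + η) * (T ^ (-σ₂) + B ^ (-σ₂))) := by gcongr
    _ = 8 * K ^ 2 * (A ^ (-σ₁ - 1) * (A / T) ^ (σ₁ + η)) * (T ^ (-σ₂) + B ^ (-σ₂)) := by ring
    _ = 8 * K ^ 2 * T ^ (-σ₁ - η) * (A ^ (η - 1) * T ^ (-σ₂) + A ^ (η - 1) * B ^ (-σ₂)) := by
        rw [e1]; ring
    _ ≤ 8 * K ^ 2 * T ^ (-σ₁ - η) * (A ^ (η - 1) * T ^ (-σ₂)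
          + 2 * T ^ (-σ₂) * (A ^ (η - 1) + B ^ (η - 1))) := by gcongr
    _ ≤ 8 * K ^ 2 * T ^ (-σ₁ - η) * (3 * T ^ (-σ₂) * (A ^ (η - 1) + B ^ (η - 1))) := by
        gcongr
        nlinarith [mul_nonneg hT2 hB']
    _ = 24 * K ^ 2 * T ^ (-σ₁ - σ₂ - η) * (A ^ (η - 1) + B ^ (η - 1)) := by rw [e2]; ring

/-- The other half of the product rule is the same estimate with u and v exchanged, taken at the
reflected point -(x + θ). -/
theorem exists_deriv_pairKernel {u v : UnitAddCircle → ℂ} {σ₁ σ₂ K η : ℝ}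
    (hu : IsPowerSingular u σ₁ K) (hv : IsPowerSingular v σ₂ K) (h1 : 0 ≤ σ₁) (h2 : 0 ≤ σ₂)
    (hη : 0 < η) (h1η : σ₁ + η ≤ 1) (h2η : σ₂ + η ≤ 1) {θ : UnitAddCircle} (hθ : θ ≠ 0)
    {x : ℝ} (hx : (x : UnitAddCircle) ≠ 0) (hxθ : (x : UnitAddCircle) + θ ≠ 0) :
    ∃ d, HasDerivAt (fun t : ℝ => pairKernel u v θ t) d x ∧
      ‖d‖ ≤ 48 * K ^ 2 * ‖θ‖ ^ (-σ₁ - σ₂ - η) *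
        (‖(x : UnitAddCircle)‖ ^ (η - 1) + ‖(x : UnitAddCircle) + θ‖ ^ (η - 1)) := by
  obtain ⟨a, ha, hab⟩ := exists_deriv_factor_bound hu hv h1 h2 hη h1η h2η hθ hx hxθ
  induction θ using QuotientAddGroup.induction_on with
  | H t =>
  have hxt : ((x + t : ℝ) : UnitAddCircle) = (x : UnitAddCircle) + (t : UnitAddCircle) :=
    AddCircle.coe_add 1 x t
  have en : ((-(x + t) : ℝ) : UnitAddCircle) = -((x : UnitAddCircle) + (t : UnitAddCircle)) := by
    rw [AddCircle.coe_neg, hxt]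
  have en2 : ((-(x + t) : ℝ) : UnitAddCircle) + (t : UnitAddCircle) = -(x : UnitAddCircle) := by
    rw [en]; abel
  obtain ⟨b, hb, hbb⟩ := exists_deriv_factor_bound hv hu h2 h1 hη h2η h1η hθ (x := -(x + t))
    (by rw [en]; exact neg_ne_zero.mpr hxθ)
    (by
      change ((-(x + t) : ℝ) : UnitAddCircle) + (t : UnitAddCircle) ≠ 0
      rw [en2]; exact neg_ne_zero.mpr hx)
  change ‖b‖ * ‖u (((-(x + t) : ℝ) : UnitAddCircle) + (t : UnitAddCircle)) - u t‖ ≤ 24 * K ^ 2 *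
    ‖(t : UnitAddCircle)‖ ^ (-σ₂ - σ₁ - η) * (‖((-(x + t) : ℝ) : UnitAddCircle)‖ ^ (η - 1)
      + ‖((-(x + t) : ℝ) : UnitAddCircle) + (t : UnitAddCircle)‖ ^ (η - 1)) at hbb
  rw [en2, en, norm_neg, norm_neg, hu.even] at hbb
  have hb' : HasDerivAt (fun r : ℝ => v ((r : UnitAddCircle) + (t : UnitAddCircle))) (-b) x := by
    have h3 : HasDerivAt (fun r : ℝ => -(r + t)) (-1) x := ((hasDerivAt_id x).add_const t).neg
    have := hb.scomp x h3
    simp only [neg_smul, one_smul] at this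
    refine this.congr_of_eventuallyEq (Eventually.of_forall fun r => ?_)
    simp only [Function.comp_apply, AddCircle.coe_neg, AddCircle.coe_add]
    rw [hv.even]
  refine ⟨_, (ha.sub_const (u (t : UnitAddCircle))).mul (hb'.sub_const (v (t : UnitAddCircle))), ?_⟩
  refine (norm_add_le _ _).trans ?_
  rw [norm_mul, norm_mul, norm_neg, mul_comm ‖u _ - u _‖]
  have e : -σ₂ - σ₁ - η = -σ₁ - σ₂ - η := by ring
  rw [e] at hbb
  refine (add_le_add hab hbb).trans (le_of_eq ?_)
  change 24 * K ^ 2 * ‖(t : UnitAddCircle)‖ ^ (-σ₁ - σ₂ - η) * (‖(x : UnitAddCircle)‖ ^ (η - 1)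
      + ‖(x : UnitAddCircle) + (t : UnitAddCircle)‖ ^ (η - 1)) + _ = 48 * K ^ 2 *
      ‖(t : UnitAddCircle)‖ ^ (-σ₁ - σ₂ - η) * (‖(x : UnitAddCircle)‖ ^ (η - 1)
      + ‖(x : UnitAddCircle) + (t : UnitAddCircle)‖ ^ (η - 1))
  ring

/-- The difference of v vanishes to first order at 0, which beats ‖x‖^(-σ₁) because σ₁ < 1. -/
theorem continuousAt_pairKernel_of_coe_eq_zero {u v : UnitAddCircle → ℂ} {σ₁ σ₂ K : ℝ}
    (hu : IsPowerSingular u σ₁ K) (hv : IsPowerSingular v σ₂ K) (h2 : 0 ≤ σ₂)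
    (h1' : σ₁ < 1) (h2' : σ₂ ≤ 1) {θ : UnitAddCircle} (hθ : θ ≠ 0)
    {x : ℝ} (hx : (x : UnitAddCircle) = 0) :
    ContinuousAt (fun t : ℝ => pairKernel u v θ t) x := by
  have hK := hu.nonneg
  have hT : 0 < ‖θ‖ := norm_pos_iff.mpr hθ
  have h0 : pairKernel u v θ x = 0 := by simp [pairKernel, hx]
  have hcoe : Continuous (fun t : ℝ => (t : UnitAddCircle)) := AddCircle.continuous_mk' 1
  have hA : Continuous (fun t : ℝ => ‖(t : UnitAddCircle)‖) := hcoe.norm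
  have hB : Continuous (fun t : ℝ => ‖(t : UnitAddCircle) + θ‖) := (hcoe.add continuous_const).norm
  have hBx : ‖(x : UnitAddCircle) + θ‖ ≠ 0 := by rw [hx, zero_add]; exact hT.ne'
  let bnd : ℝ → ℝ := fun t => (K * ‖(t : UnitAddCircle)‖ ^ (1 - σ₁)
    + ‖u θ‖ * ‖(t : UnitAddCircle)‖) * (8 * K / ‖θ‖ * (‖θ‖ ^ (-σ₂) + ‖(t : UnitAddCircle) + θ‖ ^ (-σ₂)))
  have hbnd : ContinuousAt bnd x := by
    refine ContinuousAt.mul (ContinuousAt.add (ContinuousAt.mul continuousAt_const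
      (ContinuousAt.rpow_const hA.continuousAt (Or.inr (by linarith))))
      (continuousAt_const.mul hA.continuousAt)) (continuousAt_const.mul (continuousAt_const.add
      (ContinuousAt.rpow_const hB.continuousAt (Or.inl hBx))))
  have hbnd0 : bnd x = 0 := by
    simp [bnd, hx, Real.zero_rpow (by linarith : (1 : ℝ) - σ₁ ≠ 0)]
  rw [ContinuousAt, h0]
  refine squeeze_zero_norm' ?_ (hbnd0 ▸ hbnd.tendsto)
  have hev : ∀ᶠ t : ℝ in 𝓝 x, ‖(t : UnitAddCircle) + θ‖ ≠ 0 := hB.continuousAt.eventually_ne hBx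
  filter_upwards [hev] with t ht
  have htθ : (t : UnitAddCircle) + θ ≠ 0 := norm_ne_zero_iff.mp ht
  by_cases ht0 : (t : UnitAddCircle) = 0
  · have : pairKernel u v θ t = 0 := by simp [pairKernel, ht0]
    rw [this, norm_zero]
    positivity
  have hA0 : 0 < ‖(t : UnitAddCircle)‖ := norm_pos_iff.mpr ht0
  have hd := hv.norm_sub_le h2 h2' hθ htθ (p := 1) zero_le_one le_rfl
  rw [Real.rpow_one] at hd
  have hd1 : ‖u t - u θ‖ ≤ K * ‖(t : UnitAddCircle)‖ ^ (-σ₁) + ‖u θ‖ :=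
    (norm_sub_le _ _).trans (add_le_add (hu.bound _ ht0) le_rfl)
  unfold pairKernel
  rw [norm_mul]
  refine (mul_le_mul hd1 hd (norm_nonneg _) (by positivity)).trans (le_of_eq ?_)
  simp only [bnd]
  have e : ‖(t : UnitAddCircle)‖ ^ (1 - σ₁) = ‖(t : UnitAddCircle)‖ ^ (-σ₁) * ‖(t : UnitAddCircle)‖ := by
    rw [← Real.rpow_add_one hA0.ne']; congr 1; ring
  rw [e]
  field_simp

theorem continuous_pairKernel {u v : UnitAddCircle → ℂ} {σ₁ σ₂ K : ℝ}
    (hu : IsPowerSingular u σ₁ K) (hv : IsPowerSingular v σ₂ K) (h1 : 0 ≤ σ₁) (h2 : 0 ≤ σ₂)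
    (h1' : σ₁ < 1) (h2' : σ₂ < 1) {θ : UnitAddCircle} (hθ : θ ≠ 0) :
    Continuous (fun t : ℝ => pairKernel u v θ t) := by
  rw [continuous_iff_continuousAt]
  intro x
  by_cases hx : (x : UnitAddCircle) = 0
  · exact continuousAt_pairKernel_of_coe_eq_zero hu hv h2 h1' h2'.le hθ hx
  by_cases hxθ : (x : UnitAddCircle) + θ = 0
  · induction θ using QuotientAddGroup.induction_on with
    | H t =>
    have h3 : ((-x - t : ℝ) : UnitAddCircle) = 0 := by
      rw [AddCircle.coe_sub, AddCircle.coe_neg, ← neg_add', neg_eq_zero]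
      exact hxθ
    have h4 := continuousAt_pairKernel_of_coe_eq_zero hv hu h1 h2' h1'.le hθ h3
    have h5 : ContinuousAt (fun r : ℝ => -r - t) x := by fun_prop
    have h6 := ContinuousAt.comp (f := fun r : ℝ => -r - t) (x := x) h4 h5
    refine h6.congr (Eventually.of_forall fun r => ?_)
    simp only [Function.comp_apply, AddCircle.coe_neg, AddCircle.coe_sub]
    exact (pairKernel_swap hu.even hv.even _ _).symm
  · have hη : 0 < min (1 - σ₁) (1 - σ₂) := lt_min (by linarith) (by linarith)
    obtain ⟨d, hd, _⟩ := exists_deriv_pairKernel hu hv h1 h2 hη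
      (by linarith [min_le_left (1 - σ₁) (1 - σ₂)]) (by linarith [min_le_right (1 - σ₁) (1 - σ₂)])
      hθ hx hxθ
    exact hd.continuousAt

end DirichletMeanSquare

/-! ### The even Hurwitz zeta function as a power-singular function; the kernels. -/

namespace DirichletMeanSquare

open Complex HurwitzZeta Filter Topology MeasureTheory

theorem hasDerivAt_circle_shift {F : UnitAddCircle → ℂ} {x : ℝ} {n : ℤ} {d : ℂ}
    (h : HasDerivAt (fun t : ℝ => F t) d (x - n)) : HasDerivAt (fun t : ℝ => F t) d x := by
  have := h.comp_sub_const x (n : ℝ)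
  simpa only [coe_sub_int] using this

theorem hasDerivAt_abs_cpow_neg (s : ℂ) {x : ℝ} (hx : x ≠ 0) :
    ∃ d, HasDerivAt (fun t : ℝ => ((|t| : ℝ) : ℂ) ^ (-s)) d x ∧ ‖d‖ ≤ ‖s‖ * |x| ^ (-s.re - 1) := by
  have h1 := (hasDerivAt_ofReal_cpow_neg s (abs_pos.mpr hx)).scomp x (hasDerivAt_abs hx)
  refine ⟨_, h1, ?_⟩
  rw [norm_smul, norm_mul, norm_neg, norm_ofReal_cpow_neg_sub_one s (abs_pos.mpr hx)]
  refine mul_le_of_le_one_left (by positivity) ?_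
  rcases lt_or_gt_of_ne hx with h | h
  · simp [sign_neg h]
  · simp [sign_pos h]

theorem re_bounds {δ : ℝ} {s : ℂ} (hs : ‖s - 1 / 2‖ ≤ δ) :
    1 / 2 - δ ≤ s.re ∧ s.re ≤ 1 / 2 + δ := by
  have h := (abs_re_le_norm (s - 1 / 2)).trans hs
  have e : (s - 1 / 2).re = s.re - 1 / 2 := by simp
  rw [e, abs_le] at h
  constructor <;> linarith

theorem norm_le_half_add {δ : ℝ} {s : ℂ} (hs : ‖s - 1 / 2‖ ≤ δ) : ‖s‖ ≤ 1 / 2 + δ := by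
  have := norm_add_le (s - 1 / 2) (1 / 2)
  rw [sub_add_cancel] at this
  have h2 : ‖(1 / 2 : ℂ)‖ = 1 / 2 := by simp
  linarith

theorem ne_one_of_near_half {δ : ℝ} (hδ : δ < 1 / 2) {s : ℂ} (hs : ‖s - 1 / 2‖ ≤ δ) : s ≠ 1 := by
  rintro rfl
  have := (re_bounds hs).2
  simp at this
  linarith

theorem exists_norm_riemannZeta_le {δ : ℝ} (hδ : δ < 1 / 2) :
    ∃ M : ℝ, 0 ≤ M ∧ ∀ s : ℂ, ‖s - 1 / 2‖ ≤ δ → ‖riemannZeta s‖ ≤ M := by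
  have hc : ContinuousOn riemannZeta (Metric.closedBall (1 / 2 : ℂ) δ) := fun s hs =>
    (differentiableAt_riemannZeta (ne_one_of_near_half hδ
      (by simpa [dist_eq_norm] using hs))).continuousAt.continuousWithinAt
  obtain ⟨M, hM⟩ := (isCompact_closedBall (1 / 2 : ℂ) δ).exists_bound_of_continuousOn hc
  exact ⟨max M 0, le_max_right _ _, fun s hs =>
    (hM s (by simpa [dist_eq_norm] using hs)).trans (le_max_left _ _)⟩

/-- The expansion at the nearest integer gives both bounds: M bounds ζ on the disc, 1 covers the
power term, and κ covers the regular part and its derivative. One constant serves all s in the disc.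
-/
theorem exists_isPowerSingular_hurwitzZetaEven {δ : ℝ} (hδ : δ < 1 / 2) :
    ∃ K : ℝ, ∀ s : ℂ, ‖s - 1 / 2‖ ≤ δ → IsPowerSingular (fun x => hurwitzZetaEven x s) s.re K := by
  obtain ⟨M, hM0, hM⟩ := exists_norm_riemannZeta_le hδ
  set κ := ∑' n, regularMajorant (1 / 2 - δ) n
  have hσ : 0 < 1 / 2 - δ := by linarith
  have hκ : 0 ≤ κ := tsum_nonneg fun n => by unfold regularMajorant; positivity
  refine ⟨M + 1 + κ, fun s hs => ⟨fun x => hurwitzZetaEven_neg _ _, ?_, ?_⟩⟩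
  · intro x hx
    have hre := re_bounds hs
    have hns := norm_le_half_add hs
    induction x using QuotientAddGroup.induction_on with
    | H x =>
    change ‖hurwitzZetaEven (x : UnitAddCircle) s‖ ≤ (M + 1 + κ) * ‖(x : UnitAddCircle)‖ ^ (-s.re)
    obtain ⟨n, hn, hn2⟩ := exists_rep_norm x
    have hne : x - n ≠ 0 := by
      rw [← abs_pos, ← hn]; exact norm_pos_iff.mpr hx
    rw [hn, ← coe_sub_int x n]
    generalize x - n = y at *
    have hy : |y| < 3 / 4 := by linarith
    have hy0 : 0 < |y| := abs_pos.mpr hne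
    have h1 : 1 ≤ |y| ^ (-s.re) := Real.one_le_rpow_of_pos_of_le_one_of_nonpos hy0 (by linarith)
      (by linarith)
    rw [hurwitzZetaEven_expansion hne hy (by linarith) (by linarith)]
    have hp : ‖(((|y| : ℝ) : ℂ) ^ (-s)) / 2‖ ≤ |y| ^ (-s.re) := by
      rw [norm_div, norm_ofReal_cpow_neg s hy0, norm_ofNat]
      linarith
    have hr := norm_regularPart_le hσ hre.1 (by linarith : ‖s‖ ≤ 3) hy
    calc _ ≤ ‖riemannZeta s‖ + ‖(((|y| : ℝ) : ℂ) ^ (-s)) / 2‖ + ‖regularPart s y‖ := norm_add₃_le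
      _ ≤ M + |y| ^ (-s.re) + κ * |y| := by gcongr; exact hM s hs
      _ ≤ M * |y| ^ (-s.re) + |y| ^ (-s.re) + κ * |y| ^ (-s.re) := by
        gcongr
        · exact le_mul_of_one_le_right hM0 h1
        · linarith
      _ = _ := by ring
  · intro x hx
    have hre := re_bounds hs
    have hns := norm_le_half_add hs
    obtain ⟨n, hn, hn2⟩ := exists_rep_norm x
    have hne : x - n ≠ 0 := by
      rw [← abs_pos, ← hn]; exact norm_pos_iff.mpr hx
    rw [hn]
    suffices ∃ d, HasDerivAt (fun t : ℝ => hurwitzZetaEven (t : UnitAddCircle) s) d (x - n) ∧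
        ‖d‖ ≤ (M + 1 + κ) * |x - n| ^ (-s.re - 1) by
      obtain ⟨d, h1, h2⟩ := this
      exact ⟨d, hasDerivAt_circle_shift (F := fun x => hurwitzZetaEven x s) h1, h2⟩
    generalize x - n = y at *
    have hy : |y| < 3 / 4 := by linarith
    have hy0 : 0 < |y| := abs_pos.mpr hne
    obtain ⟨d, hd, hdb⟩ := hasDerivAt_abs_cpow_neg s hne
    have hr := hasDerivAt_regularPart hσ hre.1 (by linarith : ‖s‖ ≤ 3) hy
    have hrb := norm_regularPart_deriv_le hσ hre.1 (by linarith : ‖s‖ ≤ 3) hy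
    refine ⟨_, (((hd.div_const 2).const_add (riemannZeta s)).add hr).congr_of_eventuallyEq ?_, ?_⟩
    · have h1 : ∀ᶠ t : ℝ in 𝓝 y, t ≠ 0 := eventually_ne_nhds hne
      have h2 : ∀ᶠ t : ℝ in 𝓝 y, |t| < 3 / 4 := continuous_abs.continuousAt.eventually_lt_const hy
      filter_upwards [h1, h2] with t ht1 ht2
      exact hurwitzZetaEven_expansion ht1 ht2 (by linarith) (by linarith)
    · have h1 : 1 ≤ |y| ^ (-s.re - 1) := Real.one_le_rpow_of_pos_of_le_one_of_nonpos hy0 (by linarith)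
        (by linarith)
      refine (norm_add_le _ _).trans ?_
      rw [norm_div, norm_ofNat]
      have h3 : ‖s‖ * |y| ^ (-s.re - 1) ≤ 1 * |y| ^ (-s.re - 1) := by gcongr; linarith
      have h4 : κ * 1 ≤ κ * |y| ^ (-s.re - 1) := by gcongr
      have h5 : 0 ≤ M * |y| ^ (-s.re - 1) := by positivity
      nlinarith

/-! ### The kernel attached to two points of the circle -/

open Classical in
/-- `Z_s(x) Z_w(x + θ)` with its singularities removed, where `Z_s(x)` is the even Hurwitz zeta
function. -/
noncomputable def zetaKernel (s w : ℂ) (θ x : UnitAddCircle) : ℂ :=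
  hurwitzZetaEven x s * hurwitzZetaEven (x + θ) w - hurwitzZetaEven θ w * hurwitzZetaEven x s
    - hurwitzZetaEven θ s * hurwitzZetaEven (x + θ) w
    - if θ = 0 then hurwitzZetaEven x (s + w) / 2 else 0

theorem zetaKernel_of_ne_zero (s w : ℂ) {θ : UnitAddCircle} (hθ : θ ≠ 0) (x : UnitAddCircle) :
    zetaKernel s w θ x = pairKernel (fun x => hurwitzZetaEven x s) (fun x => hurwitzZetaEven x w) θ x
      - hurwitzZetaEven θ s * hurwitzZetaEven θ w := by
  simp only [zetaKernel, pairKernel, hθ, if_false]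
  ring

/-- The regularized diagonal kernel near `0`. -/
noncomputable def diagonalExpansion (s w : ℂ) (x : ℝ) : ℂ :=
  ((|x| : ℝ) : ℂ) ^ (-s) / 2 * regularPart w x + ((|x| : ℝ) : ℂ) ^ (-w) / 2 * regularPart s x
    + regularPart s x * regularPart w x - regularPart (s + w) x / 2

/-- At θ = 0 the two singularities collide and the product contains |x|^(-s - w)/4, which need not
be integrable as re(s + w) is close to 1. The correction Z_{s+w}(x)/2 in the kernel carries the same
term and cancels it. -/
theorem zetaKernel_zero_eq (s w : ℂ) {x : ℝ} (hx : |x| < 3 / 4) (hs : 0 < s.re) (hs3 : ‖s‖ < 3)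
    (hw : 0 < w.re) (hw3 : ‖w‖ < 3) (hz3 : ‖s + w‖ < 3) :
    zetaKernel s w 0 x = diagonalExpansion s w x - riemannZeta (s + w) / 2
      - riemannZeta s * riemannZeta w := by
  by_cases h0 : x = 0
  · subst h0
    simp [zetaKernel, diagonalExpansion, regularPart_zero, hurwitzZetaEven_zero_left]
    ring
  · have hz : 0 < (s + w).re := by rw [add_re]; linarith
    simp only [zetaKernel, if_true, add_zero, hurwitzZetaEven_zero_left]
    rw [hurwitzZetaEven_expansion h0 hx hs hs3, hurwitzZetaEven_expansion h0 hx hw hw3,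
      hurwitzZetaEven_expansion h0 hx hz hz3]
    have e : ((|x| : ℝ) : ℂ) ^ (-(s + w)) = ((|x| : ℝ) : ℂ) ^ (-s) * ((|x| : ℝ) : ℂ) ^ (-w) := by
      rw [neg_add, cpow_add]
      simpa using h0
    rw [e, diagonalExpansion]
    ring

theorem continuousAt_diagonalExpansion_zero {δ : ℝ} (hδ : δ < 1 / 2) {s w : ℂ}
    (hs : ‖s - 1 / 2‖ ≤ δ) (hw : ‖w - 1 / 2‖ ≤ δ) :
    ContinuousAt (diagonalExpansion s w) 0 := by
  have hσ : 0 < 1 / 2 - δ := by linarith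
  set κ := ∑' n, regularMajorant (1 / 2 - δ) n
  have hκ : 0 ≤ κ := tsum_nonneg fun n => by unfold regularMajorant; positivity
  have hrs := re_bounds hs
  have hrw := re_bounds hw
  have hns := norm_le_half_add hs
  have hnw := norm_le_half_add hw
  have hc : ∀ z : ℂ, 1 / 2 - δ ≤ z.re → ‖z‖ ≤ 3 → ContinuousAt (regularPart z) 0 := fun z h1 h2 =>
    (hasDerivAt_regularPart hσ h1 h2 (x := 0) (by norm_num)).continuousAt
  have hcs := hc s hrs.1 (by linarith)
  have hcw := hc w hrw.1 (by linarith)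
  have hcz := hc (s + w) (by rw [add_re]; linarith) ((norm_add_le _ _).trans (by linarith))
  -- The regular part is O(|x|), which compensates |x|^(-re z) as re z < 1.
  have key : ∀ z v : ℂ, 1 / 2 - δ ≤ v.re → ‖v‖ ≤ 3 → 0 < z.re → z.re < 1 →
      ContinuousAt (fun x : ℝ => ((|x| : ℝ) : ℂ) ^ (-z) / 2 * regularPart v x) 0 := by
    intro z v h1 h2 hz0 h3
    rw [ContinuousAt, regularPart_zero, mul_zero]
    have hb : ContinuousAt (fun x : ℝ => κ * |x| ^ (1 - z.re)) 0 :=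
      continuousAt_const.mul (continuous_abs.continuousAt.rpow_const (Or.inr (by linarith)))
    have hb0 : κ * |(0 : ℝ)| ^ (1 - z.re) = 0 := by
      rw [abs_zero, Real.zero_rpow (by linarith), mul_zero]
    refine squeeze_zero_norm' ?_ (hb0 ▸ hb.tendsto)
    have h4 : ∀ᶠ t : ℝ in 𝓝 0, |t| < 3 / 4 :=
      continuous_abs.continuousAt.eventually_lt_const (by norm_num)
    filter_upwards [h4] with t ht
    by_cases ht0 : t = 0
    · simp [ht0, regularPart_zero]; positivity
    · have ht1 : 0 < |t| := abs_pos.mpr ht0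
      have h5 := norm_regularPart_le hσ h1 h2 ht
      rw [norm_mul, norm_div, norm_ofReal_cpow_neg z ht1, norm_ofNat]
      have e : |t| ^ (1 - z.re) = |t| ^ (-z.re) * |t| := by
        rw [← Real.rpow_add_one ht1.ne']; congr 1; ring
      rw [e]
      have h6 : 0 ≤ |t| ^ (-z.re) := by positivity
      calc |t| ^ (-z.re) / 2 * ‖regularPart v t‖ ≤ |t| ^ (-z.re) * (κ * |t|) := by
            gcongr; linarith
        _ = _ := by ring
  exact ((((key s w hrw.1 (by linarith) (by linarith) (by linarith)).add
    (key w s hrs.1 (by linarith) (by linarith) (by linarith))).add (hcs.mul hcw)).sub (hcz.div_const 2))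

theorem exists_deriv_diagonalExpansion {δ η : ℝ} (hδ : δ < 1 / 2) (hη : η + δ ≤ 1 / 2) {s w : ℂ}
    (hs : ‖s - 1 / 2‖ ≤ δ) (hw : ‖w - 1 / 2‖ ≤ δ) {x : ℝ} (hx : |x| ≤ 1 / 2) (hx0 : x ≠ 0) :
    ∃ d, HasDerivAt (diagonalExpansion s w) d x ∧
      ‖d‖ ≤ (5 * (∑' n, regularMajorant (1 / 2 - δ) n) + (∑' n, regularMajorant (1 / 2 - δ) n) ^ 2)
        * |x| ^ (η - 1) := by
  have hσ : 0 < 1 / 2 - δ := by linarith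
  set κ := ∑' n, regularMajorant (1 / 2 - δ) n
  have hκ : 0 ≤ κ := tsum_nonneg fun n => by unfold regularMajorant; positivity
  have hrs := re_bounds hs
  have hrw := re_bounds hw
  have hns := norm_le_half_add hs
  have hnw := norm_le_half_add hw
  have hx' : |x| < 3 / 4 := by linarith
  have hA : 0 < |x| := abs_pos.mpr hx0
  have hnz : ‖s + w‖ ≤ 3 := (norm_add_le _ _).trans (by linarith)
  have hrz : 1 / 2 - δ ≤ (s + w).re := by rw [add_re]; linarith
  have es := hasDerivAt_regularPart hσ hrs.1 (by linarith : ‖s‖ ≤ 3) hx'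
  have ew := hasDerivAt_regularPart hσ hrw.1 (by linarith : ‖w‖ ≤ 3) hx'
  have ez := hasDerivAt_regularPart hσ hrz hnz hx'
  have es' := norm_regularPart_deriv_le hσ hrs.1 (by linarith : ‖s‖ ≤ 3) hx'
  have ew' := norm_regularPart_deriv_le hσ hrw.1 (by linarith : ‖w‖ ≤ 3) hx'
  have ez' := norm_regularPart_deriv_le hσ hrz hnz hx'
  have bs := norm_regularPart_le hσ hrs.1 (by linarith : ‖s‖ ≤ 3) hx'
  have bw := norm_regularPart_le hσ hrw.1 (by linarith : ‖w‖ ≤ 3) hx'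
  obtain ⟨ds, hds, hdsb⟩ := hasDerivAt_abs_cpow_neg s hx0
  obtain ⟨dw, hdw, hdwb⟩ := hasDerivAt_abs_cpow_neg w hx0
  refine ⟨_, (((hds.div_const 2).mul ew).add ((hdw.div_const 2).mul es)).add (es.mul ew) |>.sub
    (ez.div_const 2), ?_⟩
  -- This is where η + δ ≤ 1/2 enters: -σ ≥ -1/2 - δ ≥ η - 1, and |x| < 1.
  have hT : ∀ σ : ℝ, σ ≤ 1 / 2 + δ → |x| ^ (-σ) ≤ |x| ^ (η - 1) := fun σ h =>
    Real.rpow_le_rpow_of_exponent_ge hA (by linarith) (by linarith)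
  have hT1 : 1 ≤ |x| ^ (η - 1) := Real.one_le_rpow_of_pos_of_le_one_of_nonpos hA (by linarith)
    (by linarith)
  set T := |x| ^ (η - 1)
  have hone : ∀ (z : ℂ) (d r : ℂ), ‖z‖ ≤ 1 → z.re ≤ 1 / 2 + δ → ‖d‖ ≤ ‖z‖ * |x| ^ (-z.re - 1) →
      ‖r‖ ≤ κ * |x| → ‖d / 2 * r‖ ≤ κ * T := by
    intro z d r h1 h2 h3 h4
    have e : |x| ^ (-z.re) = |x| ^ (-z.re - 1) * |x| := by
      rw [← Real.rpow_add_one hA.ne']; congr 1; ring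
    have h5 : 0 ≤ |x| ^ (-z.re - 1) := by positivity
    rw [norm_mul, norm_div, norm_ofNat]
    calc ‖d‖ / 2 * ‖r‖ ≤ (1 * |x| ^ (-z.re - 1)) * (κ * |x|) := by
          refine mul_le_mul ?_ h4 (norm_nonneg _) (by positivity)
          have : ‖z‖ * |x| ^ (-z.re - 1) ≤ 1 * |x| ^ (-z.re - 1) := by gcongr
          linarith [norm_nonneg d]
      _ = κ * |x| ^ (-z.re) := by rw [e]; ring
      _ ≤ κ * T := by gcongr; exact hT _ h2
  have htwo : ∀ (z : ℂ) (r : ℂ), z.re ≤ 1 / 2 + δ → ‖r‖ ≤ κ →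
      ‖((|x| : ℝ) : ℂ) ^ (-z) / 2 * r‖ ≤ κ * T := by
    intro z r h1 h2
    rw [norm_mul, norm_div, norm_ofNat, norm_ofReal_cpow_neg z hA]
    have h3 : 0 ≤ |x| ^ (-z.re) := by positivity
    calc |x| ^ (-z.re) / 2 * ‖r‖ ≤ |x| ^ (-z.re) * κ := by gcongr; linarith
      _ ≤ T * κ := by gcongr; exact hT _ h1
      _ = _ := mul_comm _ _
  have a1 := hone s ds (regularPart w x) (by linarith) hrs.2 hdsb bw
  have a2 := htwo s _ hrs.2 ew'
  have a3 := hone w dw (regularPart s x) (by linarith) hrw.2 hdwb bs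
  have a4 := htwo w _ hrw.2 es'
  have hκx : κ * |x| ≤ κ / 2 := by
    calc κ * |x| ≤ κ * (1 / 2) := by gcongr
      _ = _ := by ring
  have hκ2 : κ ^ 2 ≤ κ ^ 2 * T := le_mul_of_one_le_right (by positivity) hT1
  have hκ1 : κ ≤ κ * T := le_mul_of_one_le_right (by positivity) hT1
  have a5 : ‖(∑' n, regularTermDeriv s n x) * regularPart w x‖ ≤ κ ^ 2 / 2 := by
    rw [norm_mul]
    calc _ ≤ κ * (κ / 2) := mul_le_mul es' (bw.trans hκx) (norm_nonneg _) hκ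
      _ = _ := by ring
  have a6 : ‖regularPart s x * (∑' n, regularTermDeriv w n x)‖ ≤ κ ^ 2 / 2 := by
    rw [norm_mul]
    calc _ ≤ (κ / 2) * κ := mul_le_mul (bs.trans hκx) ew' (norm_nonneg _) (by positivity)
      _ = _ := by ring
  have a7 : ‖(∑' n, regularTermDeriv (s + w) n x) / 2‖ ≤ κ := by
    rw [norm_div, norm_ofNat]; linarith [norm_nonneg (∑' n, regularTermDeriv (s + w) n x)]
  refine (norm_sub_le _ _).trans ((add_le_add ((norm_add₃_le).trans (add_le_add (add_le_add
    ((norm_add_le _ _).trans (add_le_add a1 a2)) ((norm_add_le _ _).trans (add_le_add a3 a4)))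
    ((norm_add_le _ _).trans (add_le_add a5 a6)))) a7).trans ?_)
  nlinarith

end DirichletMeanSquare

/-! ### Continuity and Riemann sums of the kernel. -/

namespace DirichletMeanSquare

open Complex HurwitzZeta Filter Topology MeasureTheory

theorem continuousAt_circle_shift {F : UnitAddCircle → ℂ} {x : ℝ} {n : ℤ}
    (h : ContinuousAt (fun t : ℝ => F t) (x - n)) : ContinuousAt (fun t : ℝ => F t) x := by
  have h1 : ContinuousAt (fun t : ℝ => t - (n : ℝ)) x := by fun_prop
  have := ContinuousAt.comp (f := fun t : ℝ => t - (n : ℝ)) (g := fun t : ℝ => F t) h h1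
  simpa only [Function.comp_def, coe_sub_int] using this

theorem zetaKernel_zero_eventuallyEq {δ : ℝ} (hδ : δ < 1 / 2) {s w : ℂ}
    (hs : ‖s - 1 / 2‖ ≤ δ) (hw : ‖w - 1 / 2‖ ≤ δ) {x : ℝ} (hx : |x| ≤ 1 / 2) :
    (fun t : ℝ => zetaKernel s w 0 t) =ᶠ[𝓝 x] fun t => diagonalExpansion s w t
      - riemannZeta (s + w) / 2 - riemannZeta s * riemannZeta w := by
  have hrs := re_bounds hs
  have hrw := re_bounds hw
  have hns := norm_le_half_add hs
  have hnw := norm_le_half_add hw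
  have h4 : ∀ᶠ t : ℝ in 𝓝 x, |t| < 3 / 4 :=
    continuous_abs.continuousAt.eventually_lt_const (by linarith)
  filter_upwards [h4] with t ht
  exact zetaKernel_zero_eq s w ht (by linarith) (by linarith) (by linarith) (by linarith)
    ((norm_add_le _ _).trans_lt (by linarith))

theorem continuous_zetaKernel {δ : ℝ} (hδ : δ < 1 / 2) {s w : ℂ}
    (hs : ‖s - 1 / 2‖ ≤ δ) (hw : ‖w - 1 / 2‖ ≤ δ) (θ : UnitAddCircle) :
    Continuous (fun x : ℝ => zetaKernel s w θ x) := by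
  have hrs := re_bounds hs
  have hrw := re_bounds hw
  by_cases hθ : θ = 0
  · subst hθ
    rw [continuous_iff_continuousAt]
    intro x
    refine continuousAt_circle_shift (n := round x) ?_
    have hx := abs_sub_round x
    rw [continuousAt_congr (zetaKernel_zero_eventuallyEq hδ hs hw hx)]
    refine (ContinuousAt.sub ?_ continuousAt_const).sub continuousAt_const
    by_cases h0 : x - round x = 0
    · rw [h0]
      exact continuousAt_diagonalExpansion_zero hδ hs hw
    · obtain ⟨d, hd, -⟩ := exists_deriv_diagonalExpansion hδ (η := 0) (by linarith) hs hw hx h0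
      exact hd.continuousAt
  · obtain ⟨K, hK⟩ := exists_isPowerSingular_hurwitzZetaEven hδ
    simp only [zetaKernel_of_ne_zero s w hθ]
    exact (continuous_pairKernel (hK s hs) (hK w hw) (by linarith) (by linarith) (by linarith)
      (by linarith) hθ).sub continuous_const

theorem integral_shift_of_periodic {E : Type*} [NormedAddCommGroup E] [NormedSpace ℝ E]
    (G : UnitAddCircle → E) (t : ℝ) :
    ∫ x in (0 : ℝ)..1, G ((x + t : ℝ) : UnitAddCircle) = ∫ x in (0 : ℝ)..1, G (x : UnitAddCircle) := by
  have hper : Function.Periodic (fun x : ℝ => G (x : UnitAddCircle)) 1 := fun x => by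
    simp only [AddCircle.coe_add_period]
  rw [intervalIntegral.integral_comp_add_right (fun x : ℝ => G (x : UnitAddCircle)) t]
  have := hper.intervalIntegral_add_eq t 0
  simpa [add_comm] using this

theorem countable_preimage_circle (a : UnitAddCircle) :
    {x : ℝ | (x : UnitAddCircle) + a = 0}.Countable := by
  induction a using QuotientAddGroup.induction_on with
  | H t =>
    refine (Set.countable_range (fun n : ℤ => (n : ℝ) - t)).mono ?_
    intro x hx
    have hx' : ((x + t : ℝ) : UnitAddCircle) = 0 := by simpa using hx
    rw [AddCircle.coe_eq_zero_iff] at hx'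
    obtain ⟨n, hn⟩ := hx'
    refine ⟨n, ?_⟩
    simp only [zsmul_eq_mul, mul_one] at hn
    simp only
    linarith

/-- `1` at the origin and `‖θ‖ ^ (-E)` elsewhere. -/
noncomputable def singularWeight (E : ℝ) (θ : UnitAddCircle) : ℝ :=
  if θ = 0 then 1 else ‖θ‖ ^ (-E)

/-- The total variation of the kernel, obtained by integrating the derivative bounds. Its explicit
dependence on θ matters, because θ later runs over all torsion points of a given order. -/
theorem exists_norm_riemannSum_zetaKernel_le {δ η : ℝ} (hδ : δ < 1 / 2) (hη0 : 0 < η)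
    (hη : η + δ ≤ 1 / 2) :
    ∃ C : ℝ, 0 ≤ C ∧ ∀ s w : ℂ, ‖s - 1 / 2‖ ≤ δ → ‖w - 1 / 2‖ ≤ δ → ∀ (θ : UnitAddCircle)
      (k : ℕ), k ≠ 0 → ∀ x₀ : UnitAddCircle,
      ‖circleSum k (fun y => zetaKernel s w θ (x₀ + y))
        - k * ∫ x in (0 : ℝ)..1, zetaKernel s w θ x‖ ≤
        C * singularWeight (s.re + w.re + η) θ := by
  obtain ⟨K, hK⟩ := exists_isPowerSingular_hurwitzZetaEven hδ
  set κ := ∑' n, regularMajorant (1 / 2 - δ) n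
  have hκ : 0 ≤ κ := tsum_nonneg fun n => by unfold regularMajorant; positivity
  set I := ∫ x in (0 : ℝ)..1, ‖(x : UnitAddCircle)‖ ^ (η - 1)
  have hI : 0 ≤ I := intervalIntegral.integral_nonneg zero_le_one fun x _ => by positivity
  have hii := intervalIntegrable_norm_rpow hη0
  refine ⟨(5 * κ + κ ^ 2) * I + 48 * K ^ 2 * (2 * I), by positivity, ?_⟩
  intro s w hs hw θ k hk x₀
  have hrs := re_bounds hs
  have hrw := re_bounds hw
  have hcont := continuous_zetaKernel hδ hs hw θ
  have hFper : Function.Periodic (fun x : ℝ => zetaKernel s w θ x) 1 := fun x => by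
    simp only [AddCircle.coe_add_period]
  induction x₀ using QuotientAddGroup.induction_on with
  | H x₀ =>
  have e : circleSum k (fun y => zetaKernel s w θ (((x₀ : ℝ) : UnitAddCircle) + y)) =
      ∑ j ∈ Finset.range k, (fun x : ℝ => zetaKernel s w θ x) (x₀ + (j : ℝ) / k) := by
    simp [circleSum]
  change ‖circleSum k (fun y => zetaKernel s w θ (((x₀ : ℝ) : UnitAddCircle) + y)) - _‖ ≤ _
  rw [e]
  by_cases hθ : θ = 0
  · subst hθ
    simp only [singularWeight, if_true, mul_one]
    refine (norm_riemannSum_sub_integral_le (S := {x : ℝ | (x : UnitAddCircle) + 0 = 0})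
      (G := fun x : ℝ => (5 * κ + κ ^ 2) * ‖(x : UnitAddCircle)‖ ^ (η - 1))
      (countable_preimage_circle 0) hcont hFper (fun x => by
        simp only [AddCircle.coe_add_period]) (hii.const_mul _) ?_ hk x₀).trans ?_
    · intro x hx
      simp only [add_zero, Set.mem_ofPred_eq] at hx
      have hxr := abs_sub_round x
      have hne : x - round x ≠ 0 := fun h => hx (by
        rw [← coe_sub_int x (round x), h]; simp)
      obtain ⟨d, hd, hdb⟩ := exists_deriv_diagonalExpansion hδ hη hs hw hxr hne
      refine ⟨d, hasDerivAt_circle_shift (F := zetaKernel s w 0) (n := round x) ?_, ?_⟩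
      · exact ((hd.sub_const _).sub_const _).congr_of_eventuallyEq
          (zetaKernel_zero_eventuallyEq hδ hs hw hxr)
      · rwa [UnitAddCircle.norm_eq]
    · rw [intervalIntegral.integral_const_mul]
      have : 0 ≤ 48 * K ^ 2 * (2 * I) := by positivity
      linarith
  · have hsw : -(s.re + w.re + η) = -s.re - w.re - η := by ring
    simp only [singularWeight, hθ, if_false, hsw]
    set T := ‖θ‖ ^ (-s.re - w.re - η)
    have hT : 0 ≤ T := by positivity
    have hshift : IntervalIntegrable (fun x : ℝ => ‖(x : UnitAddCircle) + θ‖ ^ (η - 1)) volume 0 1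
        ∧ ∫ x in (0 : ℝ)..1, ‖(x : UnitAddCircle) + θ‖ ^ (η - 1) = I := by
      induction θ using QuotientAddGroup.induction_on with
      | H t =>
      have e2 : (fun x : ℝ => ‖(x : UnitAddCircle) + ((t : ℝ) : UnitAddCircle)‖ ^ (η - 1)) =
          fun x : ℝ => ‖((x + t : ℝ) : UnitAddCircle)‖ ^ (η - 1) := by
        funext x; rw [AddCircle.coe_add]
      change IntervalIntegrable (fun x : ℝ => ‖(x : UnitAddCircle) +
          ((t : ℝ) : UnitAddCircle)‖ ^ (η - 1)) volume 0 1 ∧ ∫ x in (0 : ℝ)..1,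
          ‖(x : UnitAddCircle) + ((t : ℝ) : UnitAddCircle)‖ ^ (η - 1) = I
      rw [e2]
      refine ⟨?_, integral_shift_of_periodic (fun y => ‖y‖ ^ (η - 1)) t⟩
      have hp : Function.Periodic (fun x : ℝ => ‖(x : UnitAddCircle)‖ ^ (η - 1)) 1 := fun x => by
        simp only [AddCircle.coe_add_period]
      have := (hp.intervalIntegrable (t := 0) one_ne_zero (by simpa using hii) t
        (1 + t)).comp_add_right t
      simpa using this
    refine (norm_riemannSum_sub_integral_le (S := {x : ℝ | (x : UnitAddCircle) + 0 = 0} ∪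
        {x : ℝ | (x : UnitAddCircle) + θ = 0})
      (G := fun x : ℝ => 48 * K ^ 2 * T * (‖(x : UnitAddCircle)‖ ^ (η - 1) +
        ‖(x : UnitAddCircle) + θ‖ ^ (η - 1)))
      ((countable_preimage_circle 0).union (countable_preimage_circle θ)) hcont hFper (fun x => by
        simp only [AddCircle.coe_add_period]) ((hii.add hshift.1).const_mul _) ?_ hk x₀).trans ?_
    · intro x hx
      simp only [add_zero, Set.mem_union, Set.mem_ofPred_eq, not_or] at hx
      obtain ⟨d, hd, hdb⟩ := exists_deriv_pairKernel (hK s hs) (hK w hw) (by linarith) (by linarith)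
        hη0 (by linarith) (by linarith) hθ hx.1 hx.2
      refine ⟨d, ?_, hdb⟩
      simp only [zetaKernel_of_ne_zero s w hθ]
      exact hd.sub_const _
    · rw [intervalIntegral.integral_const_mul, intervalIntegral.integral_add hii hshift.1, hshift.2]
      have : 0 ≤ (5 * κ + κ ^ 2) * I * T := by positivity
      nlinarith

end DirichletMeanSquare

namespace DirichletMeanSquare

open Complex HurwitzZeta Filter Topology MeasureTheory

/-! ### Sums over the torsion points of the circle -/

/-- The `n`-torsion points of the circle. -/
noncomputable def circleTorsion (n : ℕ) : Finset UnitAddCircle :=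
  (Finset.range n).image fun j : ℕ => (((j : ℝ) / (n : ℝ) : ℝ) : UnitAddCircle)

theorem mem_circleTorsion {n : ℕ} (hn : n ≠ 0) {x : UnitAddCircle} :
    x ∈ circleTorsion n ↔ n • x = 0 := by
  rw [AddCircle.nsmul_eq_zero_iff (p := (1 : ℝ)) (Nat.pos_of_ne_zero hn)]
  simp [circleTorsion]

theorem circleSum_eq_sum_torsion {n : ℕ} (hn : n ≠ 0) (F : UnitAddCircle → ℂ) :
    circleSum n F = ∑ x ∈ circleTorsion n, F x := by
  have : NeZero n := ⟨hn⟩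
  rw [circleSum, circleTorsion, Finset.sum_image]
  intro i hi j hj hij
  simp only [← ZMod.toAddCircle_natCast] at hij
  have := ZMod.toAddCircle_injective n hij
  rw [ZMod.natCast_eq_natCast_iff'] at this
  simp only [Finset.coe_range, Set.mem_Iio] at hi hj
  rwa [Nat.mod_eq_of_lt hi, Nat.mod_eq_of_lt hj] at this

theorem circleSum_one (F : UnitAddCircle → ℂ) : circleSum 1 F = F 0 := by
  simp [circleSum]

theorem circleSum_mul_left (k : ℕ) (c : ℂ) (F : UnitAddCircle → ℂ) :
    circleSum k (fun y => c * F y) = c * circleSum k F := by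
  simp [circleSum, Finset.mul_sum]

theorem circleSum_congr {k : ℕ} (hk : k ≠ 0) {F G : UnitAddCircle → ℂ}
    (h : ∀ x, k • x = 0 → F x = G x) : circleSum k F = circleSum k G := by
  rw [circleSum_eq_sum_torsion hk, circleSum_eq_sum_torsion hk]
  exact Finset.sum_congr rfl fun x hx => h x ((mem_circleTorsion hk).mp hx)

/-- On points of order dividing `n`, multiplication by `u` prime to `n` is injective. -/
theorem eq_zero_of_coprime_nsmul {G : Type*} [AddGroup G] {m n : ℕ} (h : m.Coprime n) {x : G}
    (hm : m • x = 0) (hn : n • x = 0) : x = 0 := by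
  rw [← addOrderOf_dvd_iff_nsmul_eq_zero] at hm hn
  have := Nat.dvd_gcd hm hn
  rw [h, Nat.dvd_one, AddMonoid.addOrderOf_eq_one_iff] at this
  exact this

theorem circleSum_comp_nsmul {k u : ℕ} (hk : k ≠ 0) (hu : u.Coprime k) (F : UnitAddCircle → ℂ) :
    circleSum k (fun y => F (u • y)) = circleSum k F := by
  simp only [circleSum_eq_sum_torsion hk]
  have hmaps : ∀ x ∈ circleTorsion k, u • x ∈ circleTorsion k := fun x hx => by
    rw [mem_circleTorsion hk] at hx ⊢
    rw [nsmul_left_comm, hx, smul_zero]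
  have hinj : Set.InjOn (fun x : UnitAddCircle => u • x) (circleTorsion k) := by
    intro x hx y hy hxy
    rw [Finset.mem_coe, mem_circleTorsion hk] at hx hy
    refine sub_eq_zero.mp (eq_zero_of_coprime_nsmul hu ?_ ?_)
    · rw [smul_sub, sub_eq_zero]; exact hxy
    · rw [smul_sub, hx, hy, sub_zero]
  refine Finset.sum_bij (fun x _ => u • x) hmaps (fun x hx y hy h => hinj hx hy h) ?_
    fun _ _ => rfl
  intro x hx
  obtain ⟨y, hy, h⟩ := Finset.surjOn_of_injOn_of_card_le _ hmaps hinj le_rfl hx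
  exact ⟨y, hy, h⟩

theorem circleSum_neg {k : ℕ} (hk : k ≠ 0) (F : UnitAddCircle → ℂ) :
    circleSum k (fun y => F (-y)) = circleSum k F := by
  simp only [circleSum_eq_sum_torsion hk]
  refine Finset.sum_nbij' (fun x => -x) (fun x => -x) ?_ ?_ (by simp) (by simp) (by simp)
  all_goals
    intro x hx
    rw [mem_circleTorsion hk] at hx ⊢
    rw [smul_neg, hx, neg_zero]

theorem exists_nsmul_eq (g : ℕ) (hg : g ≠ 0) (x : UnitAddCircle) : ∃ y : UnitAddCircle, g • y = x := by
  induction x using QuotientAddGroup.induction_on with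
  | H t =>
    refine ⟨((t / g : ℝ) : UnitAddCircle), ?_⟩
    have : (g : ℝ) ≠ 0 := by exact_mod_cast hg
    rw [← AddCircle.coe_nsmul, nsmul_eq_mul, mul_div_cancel₀ _ this]

/-- Sum over the `gh`-torsion, fibred over multiplication by `g`. -/
theorem circleSum_mul_of_fiber {g h : ℕ} (hg : g ≠ 0) (hh : h ≠ 0) (F H : UnitAddCircle → ℂ)
    (hF : ∀ y : UnitAddCircle, (g * h) • y = 0 → circleSum g (fun t => F (y + t)) = H (g • y)) :
    circleSum (g * h) F = circleSum h H := by
  have hgh : g * h ≠ 0 := mul_ne_zero hg hh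
  rw [circleSum_eq_sum_torsion hgh, circleSum_eq_sum_torsion hh]
  rw [← Finset.sum_fiberwise_of_maps_to (g := fun y : UnitAddCircle => g • y) (t := circleTorsion h)]
  · refine Finset.sum_congr rfl fun x hx => ?_
    rw [mem_circleTorsion hh] at hx
    obtain ⟨y, rfl⟩ := exists_nsmul_eq g hg x
    have hy : (g * h) • y = 0 := by rw [mul_nsmul, hx]
    rw [← hF y hy, circleSum_eq_sum_torsion hg]
    symm
    refine Finset.sum_nbij' (fun t => y + t) (fun t => t - y) ?_ ?_ (by simp) (by simp) (by simp)
    · intro t ht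
      rw [mem_circleTorsion hg] at ht
      rw [Finset.mem_filter, mem_circleTorsion hgh]
      refine ⟨?_, by rw [smul_add, ht, add_zero]⟩
      rw [smul_add, hy, mul_nsmul, ht, smul_zero, add_zero]
    · intro t ht
      rw [Finset.mem_filter] at ht
      rw [mem_circleTorsion hg, smul_sub, ht.2, sub_self]
  · intro y hy
    rw [mem_circleTorsion hgh] at hy
    rw [mem_circleTorsion hh, ← mul_nsmul, hy]

theorem card_circleTorsion {n : ℕ} (hn : n ≠ 0) : (circleTorsion n).card = n := by
  have := circleSum_eq_sum_torsion hn fun _ => 1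
  simp only [circleSum, Finset.sum_const, Finset.card_range, nsmul_eq_mul, mul_one] at this
  exact_mod_cast this.symm

/-- The Chinese remainder theorem for torsion points. -/
theorem circleSum_mul_coprime {m n : ℕ} (hm : m ≠ 0) (hn : n ≠ 0) (hmn : m.Coprime n)
    (F : UnitAddCircle → ℂ) :
    circleSum (m * n) F = circleSum n (fun a => circleSum m (fun b => F (b + a))) := by
  have hmn0 := mul_ne_zero hm hn
  simp only [circleSum_eq_sum_torsion hmn0, circleSum_eq_sum_torsion hn,
    circleSum_eq_sum_torsion hm]
  rw [← Finset.sum_product']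
  symm
  have hmaps : ∀ p ∈ circleTorsion n ×ˢ circleTorsion m, p.2 + p.1 ∈ circleTorsion (m * n) := by
    intro p hp
    rw [Finset.mem_product, mem_circleTorsion hm, mem_circleTorsion hn] at hp
    rw [mem_circleTorsion hmn0, smul_add, mul_nsmul, hp.2, mul_nsmul', hp.1]
    simp
  have hinj : Set.InjOn (fun p : UnitAddCircle × UnitAddCircle => p.2 + p.1)
      (circleTorsion n ×ˢ circleTorsion m : Finset _) := by
    rintro ⟨a, b⟩ hp ⟨a', b'⟩ hp' h
    rw [Finset.mem_coe, Finset.mem_product, mem_circleTorsion hm, mem_circleTorsion hn] at hp hp'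
    simp only at h hp hp'
    have e : b - b' = a' - a := by rw [sub_eq_sub_iff_add_eq_add, h, add_comm]
    have h1 : b - b' = 0 := by
      refine eq_zero_of_coprime_nsmul hmn ?_ ?_
      · rw [smul_sub, hp.2, hp'.2, sub_zero]
      · rw [e, smul_sub, hp.1, hp'.1, sub_zero]
    rw [h1] at e
    rw [Prod.mk.injEq]
    exact ⟨(sub_eq_zero.mp e.symm).symm, sub_eq_zero.mp h1⟩
  refine Finset.sum_bij (fun p _ => p.2 + p.1) hmaps (fun x hx y hy h => hinj hx hy h) ?_
    fun _ _ => rfl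
  intro x hx
  obtain ⟨y, hy, h⟩ := Finset.surjOn_of_injOn_of_card_le _ hmaps hinj (by
    rw [Finset.card_product, card_circleTorsion hm, card_circleTorsion hn,
      card_circleTorsion hmn0, mul_comm]) hx
  exact ⟨y, hy, h⟩

/-- Multiplication by `A` prime to `k`, in the distribution relation. -/
theorem circleSum_hurwitz_comp {g A : ℕ} (hg : g ≠ 0) (hA : A.Coprime g) {s : ℂ} (hs : s ≠ 1)
    (y : UnitAddCircle) :
    circleSum g (fun t => hurwitzZetaEven (A • (y + t)) s) =
      (g : ℂ) ^ s * hurwitzZetaEven (A • (g • y)) s := by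
  simp only [smul_add]
  rw [circleSum_comp_nsmul hg hA (fun t => hurwitzZetaEven (A • y + t) s),
    hurwitzZetaEven_distribution g hg _ hs, nsmul_left_comm]

/-- Lowering the level of a correlation sum. -/
theorem circleSum_mul_level {g h A : ℕ} (hg : g ≠ 0) (hh : h ≠ 0) (hA : A.Coprime g) {s : ℂ}
    (hs : s ≠ 1) (Φ : UnitAddCircle → ℂ) :
    circleSum (g * h) (fun y => hurwitzZetaEven (A • y) s * Φ (g • y)) =
      (g : ℂ) ^ s * circleSum h (fun y => hurwitzZetaEven (A • y) s * Φ y) := by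
  rw [← circleSum_mul_left]
  refine circleSum_mul_of_fiber hg hh _ _ fun y _ => ?_
  have : circleSum g (fun t => hurwitzZetaEven (A • (y + t)) s * Φ (g • (y + t))) =
      circleSum g (fun t => Φ (g • y) * hurwitzZetaEven (A • (y + t)) s) :=
    circleSum_congr hg fun t ht => by rw [smul_add g, ht, add_zero, mul_comm]
  rw [this, circleSum_mul_left, circleSum_hurwitz_comp hg hA hs]
  ring

/-! ### Correlation sums of Hurwitz zeta values -/

/-- The correlation sum `∑_{y mod k} ζ(s, h₂ y) ζ(w, h₁ y)` of even Hurwitz zeta values. -/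
noncomputable def ded (s w : ℂ) (h₁ h₂ k : ℕ) : ℂ :=
  circleSum k fun y => hurwitzZetaEven (h₂ • y) s * hurwitzZetaEven (h₁ • y) w

theorem ded_swap (s w : ℂ) (h₁ h₂ k : ℕ) : ded s w h₁ h₂ k = ded w s h₂ h₁ k := by
  simp only [ded, mul_comm]

theorem ded_mul_left {k u : ℕ} (hk : k ≠ 0) (hu : u.Coprime k) (s w : ℂ) (h₁ h₂ : ℕ) :
    ded s w (u * h₁) (u * h₂) k = ded s w h₁ h₂ k := by
  unfold ded
  simp only [mul_nsmul]
  exact circleSum_comp_nsmul hk hu fun y => hurwitzZetaEven (h₂ • y) s * hurwitzZetaEven (h₁ • y) w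

/-- The level of a correlation sum can be lowered by a common factor of the level and of one of the
multipliers. -/
theorem ded_mul_level {g h A B : ℕ} (hg : g ≠ 0) (hh : h ≠ 0) (hA : A.Coprime g) {s : ℂ}
    (hs : s ≠ 1) (w : ℂ) : ded s w (g * B) A (g * h) = (g : ℂ) ^ s * ded s w B A h := by
  unfold ded
  simp only [mul_nsmul _ g B]
  exact circleSum_mul_level hg hh hA hs fun y => hurwitzZetaEven (B • y) w

theorem ded_mul_level' {g h A B : ℕ} (hg : g ≠ 0) (hh : h ≠ 0) (hA : A.Coprime g) (s : ℂ) {w : ℂ}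
    (hw : w ≠ 1) : ded s w A (g * B) (g * h) = (g : ℂ) ^ w * ded s w A B h := by
  rw [ded_swap, ded_mul_level hg hh hA hw, ded_swap]

/-! ### The mean of the kernels -/

/-- The mean of the diagonal kernel. -/
noncomputable def kernelMean (s w : ℂ) : ℂ := ∫ x in (0 : ℝ)..1, zetaKernel s w 0 x

/-- Summed over a and θ in the n-torsion, each piece of the kernel is evaluated by the distribution
relation and acquires the same factor n^(s + w). The result is the diagonal kernel at nx, so the
means for all θ reduce to the one at θ = 0. -/
theorem circleSum_circleSum_zetaKernel {n : ℕ} (hn : n ≠ 0) {s w : ℂ} (hs : s ≠ 1) (hw : w ≠ 1)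
    (hz : s + w ≠ 1) (x : UnitAddCircle) :
    circleSum n (fun a => circleSum n fun θ => zetaKernel s w θ (x + a)) =
      (n : ℂ) ^ (s + w) * zetaKernel s w 0 (n • x) := by
  have hn' : (n : ℂ) ≠ 0 := by exact_mod_cast hn
  have d : ∀ u : ℂ, u ≠ 1 → ∀ y : UnitAddCircle, ∑ t ∈ circleTorsion n, hurwitzZetaEven (y + t) u =
      (n : ℂ) ^ u * hurwitzZetaEven (n • y) u := fun u hu y => by
    rw [← circleSum_eq_sum_torsion hn (fun t => hurwitzZetaEven (y + t) u),
      hurwitzZetaEven_distribution n hn y hu]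
  have e0 : ∀ u, u ≠ 1 → ∑ t ∈ circleTorsion n, hurwitzZetaEven t u = (n : ℂ) ^ u * riemannZeta u :=
    fun u hu => by simpa [hurwitzZetaEven_zero_left] using d u hu 0
  have d2 : ∀ a ∈ circleTorsion n, ∑ t ∈ circleTorsion n, hurwitzZetaEven (x + a + t) w =
      (n : ℂ) ^ w * hurwitzZetaEven (n • x) w := fun a ha => by
    rw [d w hw, smul_add, (mem_circleTorsion hn).mp ha, add_zero]
  have d3 : ∀ a ∈ circleTorsion n, ∑ t ∈ circleTorsion n, hurwitzZetaEven (x + t + a) w =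
      (n : ℂ) ^ w * hurwitzZetaEven (n • x) w := fun a ha => by
    simp only [add_right_comm x _ a]
    exact d2 a ha
  have h0 : (0 : UnitAddCircle) ∈ circleTorsion n := by simp [mem_circleTorsion hn]
  simp only [circleSum_eq_sum_torsion hn, zetaKernel, Finset.sum_sub_distrib, ← Finset.mul_sum,
    ← Finset.sum_mul, if_true, add_zero, Finset.sum_ite_eq', h0, ← Finset.sum_div]
  rw [Finset.sum_comm (f := fun a t => hurwitzZetaEven t s * hurwitzZetaEven (x + a + t) w)]
  simp only [← Finset.mul_sum]
  rw [Finset.sum_congr rfl fun a ha => by rw [d2 a ha],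
    Finset.sum_congr (s₁ := circleTorsion n) (f := fun a => hurwitzZetaEven a s *
      ∑ i ∈ circleTorsion n, hurwitzZetaEven (x + i + a) w) rfl fun a ha => by rw [d3 a ha]]
  simp only [← Finset.sum_mul, d s hs, d _ hz, e0 s hs, e0 w hw, hurwitzZetaEven_zero_left]
  rw [cpow_add _ _ hn']
  ring

theorem integral_comp_nsmul_of_continuous {F : UnitAddCircle → ℂ}
    (hF : Continuous fun x : ℝ => F x) {n : ℕ} (hn : n ≠ 0) :
    ∫ x in (0 : ℝ)..1, F (n • (x : UnitAddCircle)) = ∫ x in (0 : ℝ)..1, F (x : UnitAddCircle) := by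
  have hn' : (n : ℝ) ≠ 0 := by exact_mod_cast hn
  have hper : Function.Periodic (fun x : ℝ => F (x : UnitAddCircle)) 1 := fun x => by
    simp only [AddCircle.coe_add_period]
  have e : ∀ x : ℝ, F (n • (x : UnitAddCircle)) = (fun x : ℝ => F (x : UnitAddCircle)) (n * x) := by
    intro x
    simp only [← nsmul_eq_mul, AddCircle.coe_nsmul]
  simp only [e]
  rw [intervalIntegral.integral_comp_mul_left (fun x : ℝ => F (x : UnitAddCircle)) hn']
  have h := hper.intervalIntegral_add_zsmul_eq n 0 (fun a b => hF.intervalIntegrable a b)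
  simp only [zsmul_eq_mul, Int.cast_natCast, mul_one, zero_add] at h
  rw [mul_zero, mul_one, h]
  simp [hn]

/-- Integrate the preceding identity over x: translation by a does not change a mean, so the sum
over a contributes a factor n, and multiplication by n preserves the integral. -/
theorem circleSum_integral_zetaKernel {δ : ℝ} (hδ : δ < 1 / 2) {s w : ℂ}
    (hs : ‖s - 1 / 2‖ ≤ δ) (hw : ‖w - 1 / 2‖ ≤ δ) (hz : s + w ≠ 1) {n : ℕ} (hn : n ≠ 0) :
    circleSum n (fun θ => ∫ x in (0 : ℝ)..1, zetaKernel s w θ x) =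
      (n : ℂ) ^ (s + w - 1) * kernelMean s w := by
  have hn' : (n : ℂ) ≠ 0 := by exact_mod_cast hn
  have hc : ∀ θ, Continuous (fun x : ℝ => zetaKernel s w θ x) := fun θ =>
    continuous_zetaKernel hδ hs hw θ
  have hca : ∀ (θ a : UnitAddCircle), Continuous (fun x : ℝ => zetaKernel s w θ (x + a)) := by
    intro θ a
    induction a using QuotientAddGroup.induction_on with
    | H t =>
      have := (hc θ).comp (continuous_add_const t)
      simpa only [Function.comp_def, AddCircle.coe_add] using! this
  have hshift : ∀ (θ a : UnitAddCircle), ∫ x in (0 : ℝ)..1, zetaKernel s w θ (x + a) =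
      ∫ x in (0 : ℝ)..1, zetaKernel s w θ x := by
    intro θ a
    induction a using QuotientAddGroup.induction_on with
    | H t =>
      have := integral_shift_of_periodic (zetaKernel s w θ) t
      simpa only [AddCircle.coe_add] using! this
  have key : ∫ x in (0 : ℝ)..1, circleSum n (fun a => circleSum n fun θ =>
      zetaKernel s w θ ((x : UnitAddCircle) + a)) =
      n * circleSum n (fun θ => ∫ x in (0 : ℝ)..1, zetaKernel s w θ x) := by
    simp only [circleSum_eq_sum_torsion hn]
    rw [intervalIntegral.integral_finsetSum fun a _ =>
      (continuous_finsetSum _ fun θ _ => hca θ a).intervalIntegrable _ _]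
    rw [Finset.sum_congr rfl fun a _ => intervalIntegral.integral_finsetSum fun θ _ =>
      (hca θ a).intervalIntegrable _ _]
    simp only [hshift, Finset.sum_const, card_circleTorsion hn, nsmul_eq_mul]
  simp only [circleSum_circleSum_zetaKernel hn (ne_one_of_near_half hδ hs)
    (ne_one_of_near_half hδ hw) hz] at key
  rw [intervalIntegral.integral_const_mul, integral_comp_nsmul_of_continuous (hc 0) hn] at key
  have e : (n : ℂ) ^ (s + w) = n * (n : ℂ) ^ (s + w - 1) := by
    rw [cpow_sub _ _ hn', cpow_one]; field_simp
  rw [e, mul_assoc] at key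
  exact (mul_left_cancel₀ hn' key).symm

/-! ### Sums of the singular weight -/

theorem singularWeight_nonneg (E : ℝ) (θ : UnitAddCircle) : 0 ≤ singularWeight E θ := by
  unfold singularWeight
  split_ifs <;> positivity

theorem singularWeight_mono {E E' : ℝ} (h : E ≤ E') (θ : UnitAddCircle) :
    singularWeight E θ ≤ singularWeight E' θ := by
  unfold singularWeight
  split_ifs with h0
  · exact le_rfl
  · exact Real.rpow_le_rpow_of_exponent_ge (norm_pos_iff.mpr h0)
      ((norm_le_half θ).trans (by norm_num)) (by linarith)

theorem singularWeight_div_le {E : ℝ} {j n : ℕ} (hj : 0 < j) (hjn : j < n) :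
    singularWeight E (((j : ℝ) / n : ℝ) : UnitAddCircle) ≤
      (n : ℝ) ^ E * (((j : ℝ)) ^ (-E) + ((n - j : ℕ) : ℝ) ^ (-E)) := by
  have hn : (0 : ℝ) < n := by exact_mod_cast hj.trans hjn
  have hj' : (0 : ℝ) < j := by exact_mod_cast hj
  have hnj : (0 : ℝ) < ((n - j : ℕ) : ℝ) := by exact_mod_cast Nat.sub_pos_of_lt hjn
  have hcast : ((n - j : ℕ) : ℝ) = n - j := Nat.cast_sub hjn.le
  have hx : 0 < (j : ℝ) / n := by positivity
  have main : ∀ i : ℝ, 0 < i → ‖(((j : ℝ) / n : ℝ) : UnitAddCircle)‖ = i / n →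
      singularWeight E (((j : ℝ) / n : ℝ) : UnitAddCircle) = (n : ℝ) ^ E * i ^ (-E) := by
    intro i hi h
    have h0 : (((j : ℝ) / n : ℝ) : UnitAddCircle) ≠ 0 := by
      rw [← norm_ne_zero_iff, h]; positivity
    rw [singularWeight, if_neg h0, h, Real.div_rpow hi.le hn.le, Real.rpow_neg hn.le,
      div_inv_eq_mul, mul_comm]
  rcases le_total ((j : ℝ) / n) (1 / 2) with h | h
  · rw [main j hj' (by rw [norm_coe_of_abs_le_half (by rwa [abs_of_pos hx]), abs_of_pos hx])]
    gcongr
    simp only [le_add_iff_nonneg_right]; positivity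
  · rw [main ((n - j : ℕ) : ℝ) hnj ?_]
    · gcongr
      simp only [le_add_iff_nonneg_left]; positivity
    · have hlt : (j : ℝ) / n < 1 := by rw [div_lt_one hn]; exact_mod_cast hjn
      have e := coe_sub_int ((j : ℝ) / n) 1
      rw [← e, norm_coe_of_abs_le_half, abs_of_neg]
      · push_cast [hcast]; field_simp; ring
      · push_cast; linarith
      · push_cast; rw [abs_le]; constructor <;> linarith

/-- The point j/n lies at distance min(j, n - j)/n from 0, so the sum is at most n^E times 1 + 2 ∑
j^(-1 - η). The convergent series makes the constant uniform in E ≥ 1 + η. -/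
theorem exists_sum_singularWeight_le {η : ℝ} (hη : 0 < η) :
    ∃ C : ℝ, 0 ≤ C ∧ ∀ E : ℝ, 1 + η ≤ E → ∀ n : ℕ, n ≠ 0 →
      ∑ θ ∈ circleTorsion n, singularWeight E θ ≤ C * (n : ℝ) ^ E := by
  have hsum : Summable (fun j : ℕ => (j : ℝ) ^ (-(1 + η))) :=
    Real.summable_nat_rpow.mpr (by linarith)
  set S := ∑' j : ℕ, (j : ℝ) ^ (-(1 + η))
  have hS : 0 ≤ S := tsum_nonneg fun j => by positivity
  refine ⟨1 + 2 * S, by positivity, fun E hE n hn => ?_⟩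
  have hn1 : (1 : ℝ) ≤ n := by exact_mod_cast Nat.one_le_iff_ne_zero.mpr hn
  have hle : ∀ j : ℕ, 0 < j → (j : ℝ) ^ (-E) ≤ (j : ℝ) ^ (-(1 + η)) := fun j hj =>
    Real.rpow_le_rpow_of_exponent_le (by exact_mod_cast hj) (by linarith)
  have hfin : ∑ j ∈ Finset.Ico 1 n, (j : ℝ) ^ (-E) ≤ S := by
    refine (Finset.sum_le_sum fun j hj => hle j (Finset.mem_Ico.mp hj).1).trans ?_
    exact hsum.sum_le_tsum _ fun j _ => by positivity
  have hfin2 : ∑ j ∈ Finset.Ico 1 n, ((n - j : ℕ) : ℝ) ^ (-E) ≤ S := by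
    have := Finset.sum_Ico_reflect (fun j : ℕ => (j : ℝ) ^ (-E)) 1 (m := n) (n := n) (by omega)
    rw [this]
    simpa using hfin
  unfold circleTorsion
  have h1 : ∑ θ ∈ (Finset.range n).image (fun j : ℕ => (((j : ℝ) / (n : ℝ) : ℝ) : UnitAddCircle)),
      singularWeight E θ ≤ ∑ j ∈ Finset.range n,
        singularWeight E (((j : ℝ) / (n : ℝ) : ℝ) : UnitAddCircle) :=
    Finset.sum_image_le_of_nonneg (fun _ _ => singularWeight_nonneg _ _)
  refine h1.trans ?_
  rw [Finset.range_eq_Ico, Finset.sum_eq_sum_Ico_succ_bot (Nat.pos_of_ne_zero hn)]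
  have h2 : ∑ j ∈ Finset.Ico 1 n, singularWeight E (((j : ℝ) / (n : ℝ) : ℝ) : UnitAddCircle) ≤
      (n : ℝ) ^ E * (2 * S) := by
    calc _ ≤ ∑ j ∈ Finset.Ico 1 n, (n : ℝ) ^ E * (((j : ℝ)) ^ (-E) + ((n - j : ℕ) : ℝ) ^ (-E)) :=
          Finset.sum_le_sum fun j hj => singularWeight_div_le (Finset.mem_Ico.mp hj).1
            (Finset.mem_Ico.mp hj).2
      _ ≤ _ := by
          rw [← Finset.mul_sum, Finset.sum_add_distrib]
          gcongr
          linarith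
  have h3 : (1 : ℝ) ≤ (n : ℝ) ^ E := Real.one_le_rpow hn1 (by linarith)
  have h4 : singularWeight E (((0 : ℕ) : ℝ) / (n : ℝ) : ℝ) = 1 := by simp [singularWeight]
  rw [h4]
  calc (1 : ℝ) + _ ≤ (n : ℝ) ^ E + (n : ℝ) ^ E * (2 * S) := add_le_add h3 h2
    _ = _ := by ring

end DirichletMeanSquare

namespace DirichletMeanSquare

open Complex HurwitzZeta Filter Topology MeasureTheory

/-! ### The reciprocity law -/

/-- Expand both Hurwitz factors over the h₂- and h₁-torsion and split the product with the kernel of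
θ = b - a. The parameter ρ bounds the excess of re(s + w) over 1, so that the error exponent stays
close to 1 when the shifts are small. -/
theorem exists_reciprocity {δ η : ℝ} (hδ : δ < 1 / 2) (hη0 : 0 < η) (hη : η + δ ≤ 1 / 2) :
    ∃ C : ℝ, 0 ≤ C ∧ ∀ s w : ℂ, ‖s - 1 / 2‖ ≤ δ → ‖w - 1 / 2‖ ≤ δ → s + w ≠ 1 →
      ∀ ρ : ℝ, 0 ≤ ρ → s.re + w.re ≤ 1 + 2 * ρ → ∀ h₁ h₂ k : ℕ, h₁ ≠ 0 → h₂ ≠ 0 → k ≠ 0 →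
      h₁.Coprime h₂ →
      ‖(h₂ : ℂ) ^ s * (h₁ : ℂ) ^ w * ded s w h₁ h₂ k
        - ((k : ℂ) ^ s * (h₁ : ℂ) ^ w * ded s w h₁ k h₂
          + (k : ℂ) ^ w * (h₂ : ℂ) ^ s * ded s w k h₂ h₁
          + (k : ℂ) ^ (s + w) * riemannZeta (s + w) / 2
          + k * ((h₁ * h₂ : ℕ) : ℂ) ^ (s + w - 1) * kernelMean s w)‖
        ≤ C * ((h₁ * h₂ : ℕ) : ℝ) ^ (1 + 2 * ρ + η) := by
  obtain ⟨C₁, hC₁, hker⟩ := exists_norm_riemannSum_zetaKernel_le hδ hη0 hη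
  obtain ⟨C₂, hC₂, hwt⟩ := exists_sum_singularWeight_le hη0
  refine ⟨C₁ * C₂, by positivity, ?_⟩
  intro s w hs hw hz ρ hρ hsw h₁ h₂ k hh₁ hh₂ hk hcop
  have hs1 := ne_one_of_near_half hδ hs
  have hw1 := ne_one_of_near_half hδ hw
  have hn : h₁ * h₂ ≠ 0 := mul_ne_zero hh₁ hh₂
  set A := circleTorsion h₂
  set B := circleTorsion h₁
  set X := circleTorsion k
  have dist : ∀ {m : ℕ}, m ≠ 0 → ∀ u : ℂ, u ≠ 1 → ∀ y : UnitAddCircle,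
      ∑ t ∈ circleTorsion m, hurwitzZetaEven (y + t) u = (m : ℂ) ^ u * hurwitzZetaEven (m • y) u :=
    fun {m} hm u hu y => by
      rw [← circleSum_eq_sum_torsion hm (fun t => hurwitzZetaEven (y + t) u),
        hurwitzZetaEven_distribution m hm y hu]
  -- the map `(a, b) ↦ b - a` identifies pairs with the `h₁ h₂`-torsion
  have crt : ∀ F : UnitAddCircle → ℂ, ∑ a ∈ A, ∑ b ∈ B, F (b - a) = circleSum (h₁ * h₂) F := by
    intro F
    rw [circleSum_mul_coprime hh₁ hh₂ hcop, ← circleSum_neg hh₂, circleSum_eq_sum_torsion hh₂]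
    refine Finset.sum_congr rfl fun a _ => ?_
    rw [circleSum_eq_sum_torsion hh₁]
    simp only [sub_eq_add_neg]
    rfl
  have crtR : ∑ a ∈ A, ∑ b ∈ B, singularWeight (1 + 2 * ρ + η) (b - a) =
      ∑ θ ∈ circleTorsion (h₁ * h₂), singularWeight (1 + 2 * ρ + η) θ := by
    have := crt fun θ => (singularWeight (1 + 2 * ρ + η) θ : ℂ)
    rw [circleSum_eq_sum_torsion hn] at this
    exact_mod_cast this
  have expand : (h₂ : ℂ) ^ s * (h₁ : ℂ) ^ w * ded s w h₁ h₂ k =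
      ∑ a ∈ A, ∑ b ∈ B, ∑ x ∈ X, hurwitzZetaEven (a + x) s * hurwitzZetaEven (b + x) w := by
    rw [ded, circleSum_eq_sum_torsion hk, Finset.mul_sum]
    have : ∀ x ∈ X, (h₂ : ℂ) ^ s * (h₁ : ℂ) ^ w * (hurwitzZetaEven (h₂ • x) s *
        hurwitzZetaEven (h₁ • x) w) = ∑ a ∈ A, ∑ b ∈ B, hurwitzZetaEven (a + x) s *
          hurwitzZetaEven (b + x) w := by
      intro x _
      simp only [add_comm _ x]
      rw [← Finset.sum_mul_sum, dist hh₂ s hs1, dist hh₁ w hw1]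
      ring
    rw [Finset.sum_congr rfl this, Finset.sum_comm]
    exact Finset.sum_congr rfl fun a _ => Finset.sum_comm
  have split : ∀ a b x : UnitAddCircle, hurwitzZetaEven (a + x) s * hurwitzZetaEven (b + x) w =
      zetaKernel s w (b - a) (a + x) + hurwitzZetaEven (b - a) w * hurwitzZetaEven (a + x) s
        + hurwitzZetaEven (b - a) s * hurwitzZetaEven (b + x) w
        + if b - a = 0 then hurwitzZetaEven (a + x) (s + w) / 2 else 0 := by
    intro a b x
    have e : a + x + (b - a) = b + x := by abel
    rw [zetaKernel, e]
    ring
  have dk : ∀ (u : ℂ), u ≠ 1 → ∀ y : UnitAddCircle, ∑ x ∈ X, hurwitzZetaEven (y + x) u =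
      (k : ℂ) ^ u * hurwitzZetaEven (k • y) u := fun u hu y => dist hk u hu y
  -- The factor Z_s(a + x) sums over x to k^s Z_s(ka), and Z_w(b - a) sums over b to h₁^w Z_w(h₁ a):
  -- a correlation sum of modulus h₂ remains. `T3` is the mirror image.
  have T2 : ∑ a ∈ A, ∑ b ∈ B, hurwitzZetaEven (b - a) w * ∑ x ∈ X, hurwitzZetaEven (a + x) s =
      (k : ℂ) ^ s * (h₁ : ℂ) ^ w * ded s w h₁ k h₂ := by
    rw [ded, circleSum_eq_sum_torsion hh₂, Finset.mul_sum]
    refine Finset.sum_congr rfl fun a _ => ?_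
    rw [← Finset.sum_mul, dk s hs1]
    have := dist hh₁ w hw1 (-a)
    rw [smul_neg, hurwitzZetaEven_neg] at this
    simp only [sub_eq_neg_add]
    rw [this]
    ring
  have T3 : ∑ a ∈ A, ∑ b ∈ B, hurwitzZetaEven (b - a) s * ∑ x ∈ X, hurwitzZetaEven (b + x) w =
      (k : ℂ) ^ w * (h₂ : ℂ) ^ s * ded s w k h₂ h₁ := by
    rw [Finset.sum_comm, ded, circleSum_eq_sum_torsion hh₁, Finset.mul_sum]
    refine Finset.sum_congr rfl fun b _ => ?_
    rw [← Finset.sum_mul, dk w hw1]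
    have := dist hh₂ s hs1 (-b)
    rw [smul_neg, hurwitzZetaEven_neg] at this
    have e : ∀ a, hurwitzZetaEven (b - a) s = hurwitzZetaEven (-b + a) s := fun a => by
      rw [← hurwitzZetaEven_neg, neg_sub, sub_eq_neg_add]
    simp only [e]
    rw [this]
    ring
  -- As h₁ and h₂ are coprime, b = a forces a = b = 0.
  have T4 : ∑ a ∈ A, ∑ b ∈ B, ∑ x ∈ X,
      (if b - a = 0 then hurwitzZetaEven (a + x) (s + w) / 2 else 0) =
      (k : ℂ) ^ (s + w) * riemannZeta (s + w) / 2 := by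
    have h0A : (0 : UnitAddCircle) ∈ A := by simp [A, mem_circleTorsion hh₂]
    have h0B : (0 : UnitAddCircle) ∈ B := by simp [B, mem_circleTorsion hh₁]
    rw [Finset.sum_eq_single_of_mem 0 h0A, Finset.sum_eq_single_of_mem 0 h0B]
    · simp only [sub_zero, if_true]
      rw [← Finset.sum_div, dk _ hz, smul_zero, hurwitzZetaEven_zero_left]
    · intro b _ hb
      simp [hb]
    · intro a ha' ha0
      refine Finset.sum_eq_zero fun b hb => Finset.sum_eq_zero fun x _ => ?_
      rw [if_neg]
      intro h
      rw [sub_eq_zero] at h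
      subst h
      exact ha0 (eq_zero_of_coprime_nsmul hcop ((mem_circleTorsion hh₁).mp hb)
        ((mem_circleTorsion hh₂).mp ha'))
  have T1 : k * ((h₁ * h₂ : ℕ) : ℂ) ^ (s + w - 1) * kernelMean s w =
      ∑ a ∈ A, ∑ b ∈ B, k * ∫ x in (0 : ℝ)..1, zetaKernel s w (b - a) x := by
    rw [mul_assoc, ← circleSum_integral_zetaKernel hδ hs hw hz hn, ← crt, Finset.mul_sum]
    simp only [Finset.mul_sum]
  rw [expand]
  simp only [split, Finset.sum_add_distrib, ← Finset.mul_sum]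
  rw [T2, T3, T4, T1]
  have e : ∀ p q r t u : ℂ, p + q + r + t - (q + r + t + u) = p - u := fun p q r t u => by ring
  rw [e, ← Finset.sum_sub_distrib]
  simp only [← Finset.sum_sub_distrib]
  calc ‖∑ a ∈ A, ∑ b ∈ B, (∑ x ∈ X, zetaKernel s w (b - a) (a + x) -
        k * ∫ x in (0 : ℝ)..1, zetaKernel s w (b - a) x)‖
      ≤ ∑ a' ∈ A, ∑ b ∈ B, C₁ * singularWeight (1 + 2 * ρ + η) (b - a') := by
        refine (norm_sum_le _ _).trans (Finset.sum_le_sum fun a' _ =>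
          (norm_sum_le _ _).trans (Finset.sum_le_sum fun b _ => ?_))
        have := hker s w hs hw (b - a') k hk a'
        rw [circleSum_eq_sum_torsion hk] at this
        refine this.trans ?_
        gcongr
        exact singularWeight_mono (by linarith) _
    _ = C₁ * ∑ θ ∈ circleTorsion (h₁ * h₂), singularWeight (1 + 2 * ρ + η) θ := by
        simp only [← Finset.mul_sum]
        rw [crtR]
    _ ≤ C₁ * (C₂ * ((h₁ * h₂ : ℕ) : ℝ) ^ (1 + 2 * ρ + η)) := by
        gcongr
        exact hwt _ (by linarith) _ hn
    _ = _ := by ring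

end DirichletMeanSquare

namespace DirichletMeanSquare

open Complex HurwitzZeta Filter Topology MeasureTheory

/-! ### The functional equation and the value of the mean -/

/-- The factor in `ζ(w) = gammaFactor w * ζ(1 - w)`. -/
noncomputable def gammaFactor (w : ℂ) : ℂ :=
  2 * (2 * Real.pi) ^ (w - 1) * Gamma (1 - w) * cos (Real.pi * (1 - w) / 2)

theorem one_sub_near_half {δ : ℝ} {s : ℂ} (hs : ‖s - 1 / 2‖ ≤ δ) : ‖(1 - s) - 1 / 2‖ ≤ δ := by
  have : (1 - s) - 1 / 2 = -(s - 1 / 2) := by ring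
  rwa [this, norm_neg]

theorem one_sub_ne_neg_nat {δ : ℝ} (hδ : δ < 1 / 2) {w : ℂ} (hw : ‖w - 1 / 2‖ ≤ δ) (n : ℕ) :
    1 - w ≠ -n := by
  intro h
  have h1 := (re_bounds (one_sub_near_half hw)).1
  rw [h] at h1
  simp only [neg_re, natCast_re] at h1
  linarith [n.cast_nonneg (α := ℝ)]

theorem riemannZeta_eq_gammaFactor_mul {δ : ℝ} (hδ : δ < 1 / 2) {w : ℂ} (hw : ‖w - 1 / 2‖ ≤ δ) :
    riemannZeta w = gammaFactor w * riemannZeta (1 - w) := by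
  have := riemannZeta_one_sub (one_sub_ne_neg_nat hδ hw)
    (ne_one_of_near_half hδ (one_sub_near_half hw))
  rw [sub_sub_cancel, neg_sub] at this
  exact this

/-- Hurwitz's formula relates Z_w(j/N) to the cosine zeta function at 1 - w; at a rational point the
latter is a finite Fourier transform of Hurwitz zeta values, obtained by sorting the series into
residue classes modulo N. -/
theorem hurwitzZetaEven_toAddCircle_eq {δ : ℝ} (hδ : δ < 1 / 2) {w : ℂ} (hw : ‖w - 1 / 2‖ ≤ δ)
    {N : ℕ} [NeZero N] (j : ZMod N) :
    hurwitzZetaEven (ZMod.toAddCircle j) w = gammaFactor w * (N : ℂ) ^ (w - 1) *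
      ∑ k : ZMod N, ZMod.stdAddChar (j * k) * hurwitzZetaEven (ZMod.toAddCircle k) (1 - w) := by
  have hne := ne_one_of_near_half hδ (one_sub_near_half hw)
  have h1 := hurwitzZetaEven_one_sub (ZMod.toAddCircle j) (one_sub_ne_neg_nat hδ hw) (Or.inr hne)
  rw [sub_sub_cancel, neg_sub] at h1
  have h2 : cosZeta (ZMod.toAddCircle j) (1 - w) = (N : ℂ) ^ (w - 1) *
      ∑ k : ZMod N, ZMod.stdAddChar (j * k) * hurwitzZetaEven (ZMod.toAddCircle k) (1 - w) := by
    rw [cosZeta_eq, ← map_neg, ← ZMod.LFunction_stdAddChar_eq_expZeta _ _ (Or.inr hne),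
      ← ZMod.LFunction_stdAddChar_eq_expZeta _ _ (Or.inr hne)]
    have h3 : (ZMod.LFunction (fun k => ZMod.stdAddChar (j * k)) (1 - w) +
        ZMod.LFunction (fun k => ZMod.stdAddChar (-j * k)) (1 - w)) =
        ZMod.LFunction (fun k => ZMod.stdAddChar (j * k) + ZMod.stdAddChar (-j * k)) (1 - w) := by
      simp only [ZMod.LFunction, ← mul_add, ← Finset.sum_add_distrib, ← add_mul]
    have heven : Function.Even
        (fun k : ZMod N => (ZMod.stdAddChar (j * k) + ZMod.stdAddChar (-j * k) : ℂ)) := by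
      intro k
      simp only [mul_neg, neg_mul, neg_neg]
      rw [add_comm]
    rw [h3, ZMod.LFunction_def_even heven, neg_sub, mul_div_assoc]
    congr 1
    simp only [add_mul, Finset.sum_add_distrib]
    have h4 : ∑ k : ZMod N, ZMod.stdAddChar (-j * k) * hurwitzZetaEven (ZMod.toAddCircle k) (1 - w) =
        ∑ k : ZMod N, ZMod.stdAddChar (j * k) * hurwitzZetaEven (ZMod.toAddCircle k) (1 - w) := by
      refine Fintype.sum_equiv (.neg _) _ _ fun k => ?_
      simp only [Equiv.neg_apply, map_neg, hurwitzZetaEven_neg, mul_neg, neg_mul]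
    rw [h4]
    ring
  rw [h1, h2, gammaFactor]
  ring

/-- Parseval's identity on ℤ/N for the preceding Fourier expansions; orthogonality leaves l = -k,
and evenness removes the sign. -/
theorem ded_one_one_eq {δ : ℝ} (hδ : δ < 1 / 2) {s w : ℂ} (hs : ‖s - 1 / 2‖ ≤ δ)
    (hw : ‖w - 1 / 2‖ ≤ δ) {N : ℕ} (hN : N ≠ 0) :
    ded s w 1 1 N = gammaFactor s * gammaFactor w * (N : ℂ) ^ (s + w - 1) *
      ded (1 - s) (1 - w) 1 1 N := by
  have : NeZero N := ⟨hN⟩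
  have hN' : (N : ℂ) ≠ 0 := by exact_mod_cast hN
  simp only [ded, one_smul, circleSum_eq_sum_zmod]
  have orth : ∀ k l : ZMod N, ∑ j : ZMod N, (ZMod.stdAddChar (j * k) * ZMod.stdAddChar (j * l) : ℂ) =
      if l = -k then (N : ℂ) else 0 := by
    intro k l
    simp only [← AddChar.map_add_eq_mul, ← mul_add]
    have := AddChar.sum_mulShift (k + l) (ZMod.isPrimitive_stdAddChar N)
    rw [this, ZMod.card]
    simp only [add_eq_zero_iff_neg_eq, eq_comm (a := l)]
    simp
  calc ∑ j : ZMod N, hurwitzZetaEven (ZMod.toAddCircle j) s * hurwitzZetaEven (ZMod.toAddCircle j) w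
      = gammaFactor s * gammaFactor w * ((N : ℂ) ^ (s - 1) * (N : ℂ) ^ (w - 1)) *
        ∑ j : ZMod N, ∑ k : ZMod N, ∑ l : ZMod N,
          (ZMod.stdAddChar (j * k) * ZMod.stdAddChar (j * l)) *
          (hurwitzZetaEven (ZMod.toAddCircle k) (1 - s) *
            hurwitzZetaEven (ZMod.toAddCircle l) (1 - w)) := by
        rw [Finset.mul_sum]
        refine Finset.sum_congr rfl fun j _ => ?_
        rw [hurwitzZetaEven_toAddCircle_eq hδ hs, hurwitzZetaEven_toAddCircle_eq hδ hw]
        have : ∑ k : ZMod N, ∑ l : ZMod N,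
          (ZMod.stdAddChar (j * k) * ZMod.stdAddChar (j * l)) *
          (hurwitzZetaEven (ZMod.toAddCircle k) (1 - s) *
            hurwitzZetaEven (ZMod.toAddCircle l) (1 - w)) =
          (∑ k : ZMod N, ZMod.stdAddChar (j * k) * hurwitzZetaEven (ZMod.toAddCircle k) (1 - s)) *
          ∑ l : ZMod N, ZMod.stdAddChar (j * l) * hurwitzZetaEven (ZMod.toAddCircle l) (1 - w) := by
          rw [Finset.sum_mul_sum]
          exact Finset.sum_congr rfl fun k _ => Finset.sum_congr rfl fun l _ => by ring
        rw [this]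
        ring
    _ = gammaFactor s * gammaFactor w * ((N : ℂ) ^ (s - 1) * (N : ℂ) ^ (w - 1)) *
        ∑ k : ZMod N, N * (hurwitzZetaEven (ZMod.toAddCircle k) (1 - s) *
            hurwitzZetaEven (ZMod.toAddCircle k) (1 - w)) := by
        congr 1
        rw [Finset.sum_comm]
        refine Finset.sum_congr rfl fun k _ => ?_
        rw [Finset.sum_comm]
        simp only [← Finset.sum_mul, orth, ite_mul, zero_mul, Finset.sum_ite_eq',
          Finset.mem_univ, if_true, map_neg, hurwitzZetaEven_neg]
    _ = _ := by
        rw [← Finset.mul_sum]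
        have : (N : ℂ) ^ (s + w - 1) = (N : ℂ) ^ (s - 1) * (N : ℂ) ^ (w - 1) * N := by
          rw [← cpow_add _ _ hN']
          nth_rw 3 [← cpow_one (N : ℂ)]
          rw [← cpow_add _ _ hN']
          congr 1
          ring
        rw [this]
        ring

/-- 2^(z - 1) = 1 would require |z - 1| log 2 to be a nonzero multiple of 2π, too large for |z - 1|
< 1. -/
theorem two_cpow_ne_two {z : ℂ} (hz : z ≠ 1) (h : ‖z - 1‖ < 1) : (2 : ℂ) ^ z ≠ 2 := by
  intro h2
  have h3 : (2 : ℂ) ^ (z - 1) = 1 := by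
    rw [cpow_sub _ _ two_ne_zero, h2, cpow_one, div_self two_ne_zero]
  rw [cpow_def_of_ne_zero two_ne_zero, exp_eq_one_iff] at h3
  obtain ⟨n, hn⟩ := h3
  have hl : Complex.log 2 = (Real.log 2 : ℝ) := by
    rw [ofReal_log (by norm_num)]; norm_num
  rw [hl] at hn
  have h4 := congrArg norm hn
  rw [norm_mul, norm_real, Real.norm_of_nonneg (Real.log_nonneg (by norm_num))] at h4
  have hlt : Real.log 2 * ‖z - 1‖ < 1 := by
    have := Real.log_two_lt_d9
    have h0 := Real.log_pos one_lt_two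
    nlinarith [norm_nonneg (z - 1)]
  have hn0 : n = 0 := by
    by_contra hne
    have h5 : (1 : ℝ) ≤ |(n : ℝ)| := by
      exact_mod_cast Int.one_le_abs hne
    have h6 : ‖(n : ℂ) * (2 * Real.pi * I)‖ = |(n : ℝ)| * (2 * Real.pi) := by
      simp [abs_of_pos Real.pi_pos]
    rw [h4, h6] at hlt
    nlinarith [Real.pi_gt_three]
  rw [hn0] at hn
  simp only [Int.cast_zero, zero_mul, mul_eq_zero, ofReal_eq_zero] at hn
  rcases hn with h5 | h5
  · exact absurd h5 (Real.log_pos one_lt_two).ne'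
  · exact hz (sub_eq_zero.mp h5)

/-- A linear combination of `k` and `k ^ z` that is of lower order has no term in `k`. -/
theorem eq_zero_of_norm_mul_add_mul_cpow_le {A B z : ℂ} {D e : ℝ} (hz : z ≠ 1) (h : ‖z - 1‖ < 1)
    (he : e < 1) (hb : ∀ k : ℕ, k ≠ 0 → ‖A * k + B * (k : ℂ) ^ z‖ ≤ D * (k : ℝ) ^ e) :
    A = 0 := by
  have h2 : (2 : ℂ) - 2 ^ z ≠ 0 := sub_ne_zero.mpr (two_cpow_ne_two hz h).symm
  have hD : 0 ≤ D := by
    have := (norm_nonneg _).trans (hb 1 one_ne_zero)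
    simpa using this
  have hbd : ∀ k : ℕ, k ≠ 0 → ‖A * (2 - 2 ^ z)‖ ≤ D * (2 + ‖(2 : ℂ) ^ z‖) * (k : ℝ) ^ (e - 1) := by
    intro k hk
    have hk0 : (0 : ℝ) < k := by exact_mod_cast Nat.pos_of_ne_zero hk
    -- Comparing the bounds at 2k and at k eliminates the k^z term; the nonzero factor 2 - 2^z
    -- survives on A.
    have e1 : A * (2 - 2 ^ z) * k = (A * ((2 * k : ℕ) : ℂ) + B * ((2 * k : ℕ) : ℂ) ^ z)
        - 2 ^ z * (A * k + B * (k : ℂ) ^ z) := by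
      push_cast
      have := natCast_mul_natCast_cpow 2 k z
      push_cast at this
      rw [this]
      ring
    have h3 := hb (2 * k) (by omega)
    have h4 := hb k hk
    have h5 : ((2 * k : ℕ) : ℝ) ^ e ≤ 2 * (k : ℝ) ^ e := by
      push_cast
      rw [Real.mul_rpow (by norm_num) hk0.le]
      gcongr
      calc (2 : ℝ) ^ e ≤ 2 ^ (1 : ℝ) := Real.rpow_le_rpow_of_exponent_le (by norm_num) he.le
        _ = 2 := Real.rpow_one 2
    have h6 : ‖A * (2 - 2 ^ z)‖ * k ≤ D * (2 + ‖(2 : ℂ) ^ z‖) * (k : ℝ) ^ e := by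
      have : ‖A * (2 - 2 ^ z)‖ * k = ‖A * (2 - 2 ^ z) * k‖ := by simp
      rw [this, e1]
      refine (norm_sub_le _ _).trans ?_
      rw [norm_mul ((2 : ℂ) ^ z)]
      calc _ ≤ D * (2 * (k : ℝ) ^ e) + ‖(2 : ℂ) ^ z‖ * (D * (k : ℝ) ^ e) := by
            gcongr
            exact h3.trans (by gcongr)
        _ = _ := by ring
    rw [Real.rpow_sub_one hk0.ne', ← mul_div_assoc, le_div_iff₀ hk0]
    exact h6
  have hlim : Tendsto (fun k : ℕ => D * (2 + ‖(2 : ℂ) ^ z‖) * (k : ℝ) ^ (e - 1)) atTop (𝓝 0) := by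
    have := (tendsto_rpow_neg_atTop (by linarith : 0 < 1 - e)).comp tendsto_natCast_atTop_atTop
    simp only [neg_sub] at this
    simpa using this.const_mul (D * (2 + ‖(2 : ℂ) ^ z‖))
  have h0 : ‖A * (2 - 2 ^ z)‖ ≤ 0 :=
    ge_of_tendsto hlim (eventually_atTop.mpr ⟨1, fun k hk => hbd k (by omega)⟩)
  have := norm_le_zero_iff.mp h0
  exact (mul_eq_zero.mp this).resolve_right h2

theorem ded_one_right {s w : ℂ} (h₁ h₂ : ℕ) : ded s w h₁ h₂ 1 = riemannZeta s * riemannZeta w := by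
  simp [ded, circleSum_one, hurwitzZetaEven_zero_left]

/-- Reciprocity with h₁ = h₂ = 1: both reciprocal sums have modulus 1 and equal ζ(s) ζ(w). -/
theorem exists_norm_ded_one_one_sub_le {δ : ℝ} (hδ0 : 0 ≤ δ) (hδ : δ < 1 / 2) :
    ∃ C : ℝ, 0 ≤ C ∧ ∀ s w : ℂ, ‖s - 1 / 2‖ ≤ δ → ‖w - 1 / 2‖ ≤ δ → s + w ≠ 1 →
      ∀ k : ℕ, k ≠ 0 → ‖ded s w 1 1 k - ((k : ℂ) ^ s * (riemannZeta s * riemannZeta w)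
        + (k : ℂ) ^ w * (riemannZeta s * riemannZeta w)
        + (k : ℂ) ^ (s + w) * riemannZeta (s + w) / 2 + k * kernelMean s w)‖ ≤ C := by
  obtain ⟨C, hC, h⟩ := exists_reciprocity (η := 1 / 2 - δ) hδ (by linarith) (by linarith)
  refine ⟨C, hC, fun s w hs hw hz k hk => ?_⟩
  have hrs := re_bounds hs
  have hrw := re_bounds hw
  have := h s w hs hw hz δ hδ0 (by linarith) 1 1 k one_ne_zero one_ne_zero hk
    (Nat.coprime_one_left 1)
  simpa [ded_one_right] using this

theorem norm_add_sub_one_le {δ : ℝ} {s w : ℂ} (hs : ‖s - 1 / 2‖ ≤ δ) (hw : ‖w - 1 / 2‖ ≤ δ) :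
    ‖s + w - 1‖ ≤ 2 * δ := by
  have : s + w - 1 = (s - 1 / 2) + (w - 1 / 2) := by ring
  rw [this]
  exact (norm_add_le _ _).trans (by linarith)

/-- The sum `ded s w 1 1 k` is expanded in k directly, and again after the functional equation (s,
w) ↦ (1 - s, 1 - w). The ζ(s) ζ(w) terms agree, and the coefficients of k in the two expansions must
coincide because the errors are O(k^(2δ)) with 2δ < 1. -/
theorem kernelMean_eq {δ : ℝ} (hδ0 : 0 ≤ δ) (hδ : δ < 1 / 2) {s w : ℂ} (hs : ‖s - 1 / 2‖ ≤ δ)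
    (hw : ‖w - 1 / 2‖ ≤ δ) (hz : s + w ≠ 1) :
    kernelMean s w = gammaFactor s * gammaFactor w * riemannZeta (2 - (s + w)) / 2 := by
  obtain ⟨C, hC, h⟩ := exists_norm_ded_one_one_sub_le hδ0 hδ
  have hs' := one_sub_near_half hs
  have hw' := one_sub_near_half hw
  have hz' : (1 - s) + (1 - w) ≠ 1 := fun h => hz (by linear_combination -h)
  have h1 := fun k hk => h s w hs hw hz k hk
  have h2 := fun k hk => h (1 - s) (1 - w) hs' hw' hz' k hk
  have hfs := riemannZeta_eq_gammaFactor_mul hδ hs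
  have hfw := riemannZeta_eq_gammaFactor_mul hδ hw
  have hrs := re_bounds hs
  have hrw := re_bounds hw
  have e2 : (1 - s) + (1 - w) = 2 - (s + w) := by ring
  rw [← sub_eq_zero]
  refine eq_zero_of_norm_mul_add_mul_cpow_le (z := s + w)
    (B := riemannZeta (s + w) / 2 - gammaFactor s * gammaFactor w * kernelMean (1 - s) (1 - w))
    (D := C + ‖gammaFactor s * gammaFactor w‖ * C) (e := 2 * δ) hz
    ((norm_add_sub_one_le hs hw).trans_lt (by linarith)) (by linarith) fun k hk => ?_
  have hk' : (k : ℂ) ≠ 0 := by exact_mod_cast hk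
  have hk1 : (1 : ℝ) ≤ k := by exact_mod_cast Nat.one_le_iff_ne_zero.mpr hk
  have hk0 : (0 : ℝ) < k := by linarith
  have h3 := h1 k hk
  have h4 := h2 k hk
  rw [ded_one_one_eq hδ hs hw hk] at h3
  set S := ded (1 - s) (1 - w) 1 1 k
  have p1 : (k : ℂ) ^ (s + w - 1) * (k : ℂ) ^ (1 - s) = (k : ℂ) ^ w := by
    rw [← cpow_add _ _ hk']; congr 1; ring
  have p2 : (k : ℂ) ^ (s + w - 1) * (k : ℂ) ^ (1 - w) = (k : ℂ) ^ s := by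
    rw [← cpow_add _ _ hk']; congr 1; ring
  have p3 : (k : ℂ) ^ (s + w - 1) * (k : ℂ) ^ (2 - (s + w)) = k := by
    rw [← cpow_add _ _ hk']
    have : s + w - 1 + (2 - (s + w)) = 1 := by ring
    rw [this, cpow_one]
  have p4 : (k : ℂ) ^ (s + w - 1) * k = (k : ℂ) ^ (s + w) := by
    rw [cpow_sub _ _ hk', cpow_one]; field_simp
  rw [e2] at h4
  have e : (kernelMean s w - gammaFactor s * gammaFactor w * riemannZeta (2 - (s + w)) / 2) * k +
      (riemannZeta (s + w) / 2 - gammaFactor s * gammaFactor w * kernelMean (1 - s) (1 - w)) *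
        (k : ℂ) ^ (s + w) =
      -(gammaFactor s * gammaFactor w * (k : ℂ) ^ (s + w - 1) * S -
        ((k : ℂ) ^ s * (riemannZeta s * riemannZeta w)
        + (k : ℂ) ^ w * (riemannZeta s * riemannZeta w)
        + (k : ℂ) ^ (s + w) * riemannZeta (s + w) / 2 + k * kernelMean s w)) +
      gammaFactor s * gammaFactor w * (k : ℂ) ^ (s + w - 1) * (S -
        ((k : ℂ) ^ (1 - s) * (riemannZeta (1 - s) * riemannZeta (1 - w))
        + (k : ℂ) ^ (1 - w) * (riemannZeta (1 - s) * riemannZeta (1 - w))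
        + (k : ℂ) ^ (2 - (s + w)) * riemannZeta (2 - (s + w)) / 2
        + k * kernelMean (1 - s) (1 - w))) := by
    rw [hfs, hfw]
    linear_combination (gammaFactor s * gammaFactor w * (riemannZeta (1 - s) * riemannZeta (1 - w)))
      * (p1 + p2) + gammaFactor s * gammaFactor w * riemannZeta (2 - (s + w)) / 2 * p3 +
      gammaFactor s * gammaFactor w * kernelMean (1 - s) (1 - w) * p4
  rw [e]
  refine (norm_add_le _ _).trans ?_
  rw [norm_neg, norm_mul, norm_mul (gammaFactor s * gammaFactor w)]
  have hexp : (1 : ℝ) ≤ (k : ℝ) ^ (2 * δ) := Real.one_le_rpow hk1 (by linarith)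
  have hn : ‖(k : ℂ) ^ (s + w - 1)‖ ≤ (k : ℝ) ^ (2 * δ) := by
    rw [norm_natCast_cpow_of_pos (Nat.pos_of_ne_zero hk)]
    refine Real.rpow_le_rpow_of_exponent_le hk1 ?_
    simp only [sub_re, add_re, one_re]
    linarith
  calc _ ≤ C + ‖gammaFactor s * gammaFactor w‖ * (k : ℝ) ^ (2 * δ) * C := by gcongr
    _ ≤ C * (k : ℝ) ^ (2 * δ) + ‖gammaFactor s * gammaFactor w‖ * (k : ℝ) ^ (2 * δ) * C := by
        gcongr
        exact le_mul_of_one_le_right hC hexp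
    _ = _ := by ring

/-- Reciprocity with h₁ = h₂ = k = 1 contains this combination as its only terms singular at s + w =
1, hence it is bounded uniformly up to the pole. The bound for the mean alone, with the pole
removed, then follows from the one for ζ. -/
theorem exists_norm_riemannZeta_add_kernelMean_le {δ : ℝ} (hδ0 : 0 ≤ δ) (hδ : δ < 1 / 2) :
    ∃ C : ℝ, 0 ≤ C ∧ ∀ s w : ℂ, ‖s - 1 / 2‖ ≤ δ → ‖w - 1 / 2‖ ≤ δ → s + w ≠ 1 →
      ‖riemannZeta (s + w) / 2 + kernelMean s w‖ ≤ C ∧ ‖(s + w - 1) * kernelMean s w‖ ≤ C := by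
  obtain ⟨C, hC, h⟩ := exists_norm_ded_one_one_sub_le hδ0 hδ
  obtain ⟨M, hM0, hM⟩ := exists_norm_riemannZeta_le hδ
  obtain ⟨R, hR⟩ := (isCompact_closedBall (1 : ℂ) (2 * δ)).exists_bound_of_continuousOn
    -- The residue 1 is inserted at z = 1 to make (z - 1) ζ(z) continuous there.
    (f := Function.update (fun z => (z - 1) * riemannZeta z) 1 1) (by
      intro z _
      refine ContinuousAt.continuousWithinAt ?_
      rcases eq_or_ne z 1 with rfl | hz
      · simpa only [continuousAt_update_same] using riemannZeta_residue_one
      · rw [continuousAt_update_of_ne hz]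
        exact (continuousAt_id.sub continuousAt_const).mul
          (differentiableAt_riemannZeta hz).continuousAt)
  refine ⟨C + M * M + (C + M * M) + R, ?_, ?_⟩
  · have := (norm_nonneg _).trans (hR 1 (Metric.mem_closedBall_self (by linarith)))
    positivity
  intro s w hs hw hz
  have h1 := h s w hs hw hz 1 one_ne_zero
  have hzn := norm_add_sub_one_le hs hw
  have hR' := hR (s + w) (by rwa [mem_closedBall_iff_norm])
  rw [Function.update_of_ne hz] at hR'
  simp only [ded_one_right, Nat.cast_one, one_cpow, one_mul] at h1
  have hζ : ‖riemannZeta s * riemannZeta w‖ ≤ M * M := by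
    rw [norm_mul]
    exact mul_le_mul (hM s hs) (hM w hw) (norm_nonneg _) hM0
  have hmain : ‖riemannZeta (s + w) / 2 + kernelMean s w‖ ≤ C + M * M := by
    have e : riemannZeta (s + w) / 2 + kernelMean s w = -(riemannZeta s * riemannZeta w
        - (riemannZeta s * riemannZeta w + riemannZeta s * riemannZeta w
        + riemannZeta (s + w) / 2 + kernelMean s w)) - riemannZeta s * riemannZeta w := by ring
    rw [e]
    refine (norm_sub_le _ _).trans ?_
    rw [norm_neg]
    exact add_le_add h1 hζ
  have hR0 := (norm_nonneg _).trans hR'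
  have hM2 : 0 ≤ M * M := by positivity
  refine ⟨by linarith, ?_⟩
  have e : (s + w - 1) * kernelMean s w = (s + w - 1) * (riemannZeta (s + w) / 2 + kernelMean s w)
      - (s + w - 1) * riemannZeta (s + w) / 2 := by ring
  rw [e]
  refine (norm_sub_le _ _).trans ?_
  rw [norm_mul, norm_div, norm_ofNat]
  have : ‖s + w - 1‖ * ‖riemannZeta (s + w) / 2 + kernelMean s w‖ ≤ 1 * (C + M * M) :=
    mul_le_mul (hzn.trans (by linarith)) hmain (norm_nonneg _) zero_le_one
  linarith

end DirichletMeanSquare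

/-! ### Reciprocity for multipliers with a common factor. -/

namespace DirichletMeanSquare

open Complex HurwitzZeta Filter Topology MeasureTheory

/-- With nᵢ = g hᵢ and g prime to k, the factor g is a permutation of the k-torsion, and in the
reciprocal sums it lowers the levels g h₂ and g h₁ to h₂ and h₁. The formula is thus the coprime one
multiplied by g^(s + w). -/
theorem exists_reciprocity_gcd {δ η : ℝ} (hδ : δ < 1 / 2) (hη0 : 0 < η) (hη : η + δ ≤ 1 / 2) :
    ∃ C : ℝ, 0 ≤ C ∧ ∀ s w : ℂ, ‖s - 1 / 2‖ ≤ δ → ‖w - 1 / 2‖ ≤ δ → s + w ≠ 1 →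
      ∀ ρ : ℝ, 0 ≤ ρ → s.re + w.re ≤ 1 + 2 * ρ → ∀ n₁ n₂ k : ℕ, n₁ ≠ 0 → n₂ ≠ 0 → k ≠ 0 →
      (n₁.gcd n₂).Coprime k →
      ‖(n₂ : ℂ) ^ s * (n₁ : ℂ) ^ w * ded s w n₁ n₂ k
        - ((k : ℂ) ^ s * (n₁ : ℂ) ^ w * ded s w n₁ k n₂
          + (k : ℂ) ^ w * (n₂ : ℂ) ^ s * ded s w k n₂ n₁
          + ((n₁.gcd n₂ : ℕ) : ℂ) ^ (s + w) * (k : ℂ) ^ (s + w) * riemannZeta (s + w) / 2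
          + k * (n₁.gcd n₂ : ℕ) * ((n₁.lcm n₂ : ℕ) : ℂ) ^ (s + w - 1) * kernelMean s w)‖
        ≤ C * ((n₁ * n₂ : ℕ) : ℝ) ^ (1 + 2 * ρ + η) := by
  obtain ⟨C, hC, h⟩ := exists_reciprocity hδ hη0 hη
  refine ⟨C, hC, fun s w hs hw hz ρ hρ hsw n₁ n₂ k hn₁ hn₂ hk hg => ?_⟩
  obtain ⟨h₁, h₂, hcop, e₁, e₂⟩ := Nat.exists_coprime n₁ n₂
  have hL : n₁.lcm n₂ = n₁.gcd n₂ * (h₁ * h₂) := by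
    have h3 := Nat.gcd_mul_lcm n₁ n₂
    have h0 : 0 < n₁.gcd n₂ := Nat.gcd_pos_of_pos_left _ (Nat.pos_of_ne_zero hn₁)
    refine Nat.eq_of_mul_eq_mul_left h0 (h3.trans ?_)
    calc n₁ * n₂ = (h₁ * n₁.gcd n₂) * (h₂ * n₁.gcd n₂) := by rw [← e₁, ← e₂]
      _ = _ := by ring
  rw [hL]
  have hg0 : n₁.gcd n₂ ≠ 0 := Nat.gcd_ne_zero_left hn₁
  set g := n₁.gcd n₂
  rw [mul_comm] at e₁ e₂
  have hh₁ : h₁ ≠ 0 := by rintro rfl; simp at e₁; exact hn₁ e₁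
  have hh₂ : h₂ ≠ 0 := by rintro rfl; simp at e₂; exact hn₂ e₂
  have hg0' : (g : ℂ) ≠ 0 := by exact_mod_cast hg0
  have hmain := h s w hs hw hz ρ hρ hsw h₁ h₂ k hh₁ hh₂ hk hcop
  rw [e₁, e₂, ded_mul_left hk hg, ded_mul_level hg0 hh₂ hg.symm (ne_one_of_near_half hδ hs),
    ded_mul_level' hg0 hh₁ hg.symm _ (ne_one_of_near_half hδ hw)]
  have p1 : ((g * h₁ : ℕ) : ℂ) ^ w = (g : ℂ) ^ w * (h₁ : ℂ) ^ w := by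
    push_cast; exact natCast_mul_natCast_cpow _ _ _
  have p2 : ((g * h₂ : ℕ) : ℂ) ^ s = (g : ℂ) ^ s * (h₂ : ℂ) ^ s := by
    push_cast; exact natCast_mul_natCast_cpow _ _ _
  have p3 : ((g * (h₁ * h₂) : ℕ) : ℂ) ^ (s + w - 1) =
      (g : ℂ) ^ (s + w - 1) * ((h₁ * h₂ : ℕ) : ℂ) ^ (s + w - 1) := by
    rw [Nat.cast_mul]; exact natCast_mul_natCast_cpow _ _ _
  have p4 : (g : ℂ) * (g : ℂ) ^ (s + w - 1) = (g : ℂ) ^ s * (g : ℂ) ^ w := by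
    rw [cpow_sub _ _ hg0', cpow_one, cpow_add _ _ hg0']; field_simp
  have p5 : (g : ℂ) ^ (s + w) = (g : ℂ) ^ s * (g : ℂ) ^ w := cpow_add _ _ hg0'
  rw [p1, p2, p3, p5]
  have e : (g : ℂ) ^ s * (h₂ : ℂ) ^ s * ((g : ℂ) ^ w * (h₁ : ℂ) ^ w) * ded s w h₁ h₂ k
        - ((k : ℂ) ^ s * ((g : ℂ) ^ w * (h₁ : ℂ) ^ w) * ((g : ℂ) ^ s * ded s w h₁ k h₂)
          + (k : ℂ) ^ w * ((g : ℂ) ^ s * (h₂ : ℂ) ^ s) * ((g : ℂ) ^ w * ded s w k h₂ h₁)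
          + (g : ℂ) ^ s * (g : ℂ) ^ w * (k : ℂ) ^ (s + w) * riemannZeta (s + w) / 2
          + k * g * ((g : ℂ) ^ (s + w - 1) * ((h₁ * h₂ : ℕ) : ℂ) ^ (s + w - 1)) * kernelMean s w) =
      (g : ℂ) ^ (s + w) * ((h₂ : ℂ) ^ s * (h₁ : ℂ) ^ w * ded s w h₁ h₂ k
        - ((k : ℂ) ^ s * (h₁ : ℂ) ^ w * ded s w h₁ k h₂
          + (k : ℂ) ^ w * (h₂ : ℂ) ^ s * ded s w k h₂ h₁
          + (k : ℂ) ^ (s + w) * riemannZeta (s + w) / 2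
          + k * ((h₁ * h₂ : ℕ) : ℂ) ^ (s + w - 1) * kernelMean s w)) := by
    rw [p5]
    linear_combination (-k * ((h₁ * h₂ : ℕ) : ℂ) ^ (s + w - 1) * kernelMean s w) * p4
  rw [e, norm_mul, norm_natCast_cpow_of_pos (Nat.pos_of_ne_zero hg0)]
  have hg1 : (1 : ℝ) ≤ g := by exact_mod_cast Nat.one_le_iff_ne_zero.mpr hg0
  have q1 : (g : ℝ) ^ (s + w).re ≤ ((g : ℝ) * g) ^ (1 + 2 * ρ + η) := by
    calc (g : ℝ) ^ (s + w).re ≤ (g : ℝ) ^ (1 + 2 * ρ + η) :=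
          Real.rpow_le_rpow_of_exponent_le hg1 (by rw [add_re]; linarith)
      _ ≤ _ := Real.rpow_le_rpow (by positivity) (by nlinarith) (by linarith)
  calc _ ≤ ((g : ℝ) * g) ^ (1 + 2 * ρ + η) * (C * ((h₁ * h₂ : ℕ) : ℝ) ^ (1 + 2 * ρ + η)) := by
        gcongr
    _ = C * (((g : ℝ) * g) ^ (1 + 2 * ρ + η) * ((h₁ * h₂ : ℕ) : ℝ) ^ (1 + 2 * ρ + η)) := by ring
    _ = _ := by
        rw [← Real.mul_rpow (by positivity) (by positivity)]
        congr 2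
        push_cast
        ring

/-! ### The trivial bound for correlation sums -/

theorem circleSum_comp_nsmul_mul {g n : ℕ} (hg : g ≠ 0) (hn : n ≠ 0) (F : UnitAddCircle → ℂ) :
    circleSum (g * n) (fun y => F (g • y)) = g * circleSum n F := by
  rw [← circleSum_mul_left]
  refine circleSum_mul_of_fiber hg hn _ _ fun y _ => ?_
  rw [circleSum_congr hg (G := fun _ => F (g • y)) fun t ht => by rw [smul_add, ht, add_zero]]
  simp [circleSum]

/-- Multiplication by c maps the N-torsion onto the torsion of order N / gcd(N, c), each point being
hit gcd(N, c) times. -/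
theorem sum_torsion_comp_nsmul {N c : ℕ} (hN : N ≠ 0) (f : UnitAddCircle → ℝ) :
    ∑ y ∈ circleTorsion N, f (c • y) =
      (N.gcd c : ℕ) * ∑ y ∈ circleTorsion (N / N.gcd c), f y := by
  have hg0 : N.gcd c ≠ 0 := Nat.gcd_ne_zero_left hN
  have hdvd := Nat.gcd_dvd_left N c
  have hN' : N / N.gcd c ≠ 0 := (Nat.div_pos (Nat.le_of_dvd (Nat.pos_of_ne_zero hN) hdvd)
    (Nat.pos_of_ne_zero hg0)).ne'
  have hcop : (c / N.gcd c).Coprime (N / N.gcd c) :=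
    (Nat.coprime_div_gcd_div_gcd (Nat.pos_of_ne_zero hg0)).symm
  have key := circleSum_comp_nsmul_mul hg0 hN' fun y => ((f ((c / N.gcd c) • y) : ℝ) : ℂ)
  rw [circleSum_comp_nsmul hN' hcop (fun y => ((f y : ℝ) : ℂ)), Nat.mul_div_cancel' hdvd] at key
  simp only [← mul_nsmul, Nat.mul_div_cancel' (Nat.gcd_dvd_right N c)] at key
  rw [circleSum_eq_sum_torsion hN, circleSum_eq_sum_torsion hN'] at key
  exact_mod_cast key

/-- Use |ZZ'| ≤ (|Z|² + |Z'|²)/2 and |Z_u(x)|² ≪ ‖x‖^(-2 re u). The squared weight has exponent at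
least 1 + η, so its torsion sum is dominated by the points nearest 0. -/
theorem exists_norm_ded_le {δ η : ℝ} (hδ : δ < 1 / 2) (hη0 : 0 < η) :
    ∃ C : ℝ, 0 ≤ C ∧ ∀ s w : ℂ, ‖s - 1 / 2‖ ≤ δ → ‖w - 1 / 2‖ ≤ δ →
      ∀ ρ : ℝ, 0 ≤ ρ → s.re ≤ 1 / 2 + ρ → w.re ≤ 1 / 2 + ρ → ∀ a b N : ℕ, N ≠ 0 →
      ‖ded s w a b N‖ ≤ C * (N : ℝ) ^ (1 + 2 * ρ + η) := by
  obtain ⟨K, hK⟩ := exists_isPowerSingular_hurwitzZetaEven hδ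
  obtain ⟨M, hM0, hM⟩ := exists_norm_riemannZeta_le hδ
  obtain ⟨C, hC, hwt⟩ := exists_sum_singularWeight_le hη0
  have hpt : ∀ (u : ℂ), ‖u - 1 / 2‖ ≤ δ → ∀ ρ : ℝ, u.re ≤ 1 / 2 + ρ → ∀ x : UnitAddCircle,
      ‖hurwitzZetaEven x u‖ ^ 2 ≤ (K ^ 2 + M ^ 2) * singularWeight (1 + 2 * ρ + η) x := by
    intro u hu ρ hρ x
    by_cases hx : x = 0
    · subst hx
      simp only [singularWeight, if_true, mul_one, hurwitzZetaEven_zero_left]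
      have := hM u hu
      nlinarith [norm_nonneg (riemannZeta u), sq_nonneg K]
    · have h1 := (hK u hu).bound x hx
      have hx0 : 0 < ‖x‖ := norm_pos_iff.mpr hx
      have h2 : (K * ‖x‖ ^ (-u.re)) ^ 2 ≤ K ^ 2 * singularWeight (1 + 2 * ρ + η) x := by
        rw [mul_pow, singularWeight, if_neg hx, ← Real.rpow_natCast (‖x‖ ^ (-u.re)) 2,
          ← Real.rpow_mul hx0.le]
        gcongr ?_ * ?_
        refine Real.rpow_le_rpow_of_exponent_ge hx0 ((norm_le_half x).trans (by norm_num)) ?_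
        push_cast
        linarith
      have h3 := pow_le_pow_left₀ (norm_nonneg _) h1 2
      have h4 := mul_nonneg (sq_nonneg M) (singularWeight_nonneg (1 + 2 * ρ + η) x)
      linarith
  refine ⟨(K ^ 2 + M ^ 2) * C, by positivity, fun s w hs hw ρ hρ hsρ hwρ a b N hN => ?_⟩
  have hsum : ∀ c : ℕ, ∑ y ∈ circleTorsion N, singularWeight (1 + 2 * ρ + η) (c • y) ≤
      C * (N : ℝ) ^ (1 + 2 * ρ + η) := by
    intro c
    have hg0 : N.gcd c ≠ 0 := Nat.gcd_ne_zero_left hN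
    have hdvd := Nat.gcd_dvd_left N c
    have hN' : N / N.gcd c ≠ 0 := (Nat.div_pos (Nat.le_of_dvd (Nat.pos_of_ne_zero hN) hdvd)
      (Nat.pos_of_ne_zero hg0)).ne'
    have hg1 : (1 : ℝ) ≤ (N.gcd c : ℕ) := by exact_mod_cast Nat.one_le_iff_ne_zero.mpr hg0
    rw [sum_torsion_comp_nsmul hN]
    calc _ ≤ ((N.gcd c : ℕ) : ℝ) * (C * ((N / N.gcd c : ℕ) : ℝ) ^ (1 + 2 * ρ + η)) := by
          gcongr
          exact hwt _ (by linarith) _ hN'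
      _ ≤ ((N.gcd c : ℕ) : ℝ) ^ (1 + 2 * ρ + η) *
          (C * ((N / N.gcd c : ℕ) : ℝ) ^ (1 + 2 * ρ + η)) := by
          gcongr
          calc ((N.gcd c : ℕ) : ℝ) = ((N.gcd c : ℕ) : ℝ) ^ (1 : ℝ) := (Real.rpow_one _).symm
            _ ≤ _ := Real.rpow_le_rpow_of_exponent_le hg1 (by linarith)
      _ = C * (((N.gcd c : ℕ) : ℝ) * ((N / N.gcd c : ℕ) : ℝ)) ^ (1 + 2 * ρ + η) := by
          rw [Real.mul_rpow (by positivity) (by positivity)]; ring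
      _ = _ := by
          rw [← Nat.cast_mul, Nat.mul_div_cancel' hdvd]
  rw [ded, circleSum_eq_sum_torsion hN]
  calc _ ≤ ∑ y ∈ circleTorsion N, ((K ^ 2 + M ^ 2) / 2 * singularWeight (1 + 2 * ρ + η) (b • y) +
        (K ^ 2 + M ^ 2) / 2 * singularWeight (1 + 2 * ρ + η) (a • y)) := by
        refine (norm_sum_le _ _).trans (Finset.sum_le_sum fun y _ => ?_)
        rw [norm_mul]
        have h1 := hpt s hs ρ hsρ (b • y)
        have h2 := hpt w hw ρ hwρ (a • y)
        nlinarith [two_mul_le_add_sq ‖hurwitzZetaEven (b • y) s‖ ‖hurwitzZetaEven (a • y) w‖]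
    _ ≤ _ := by
        rw [Finset.sum_add_distrib, ← Finset.mul_sum, ← Finset.mul_sum]
        have h1 := hsum a
        have h2 := hsum b
        have : 0 ≤ (K ^ 2 + M ^ 2) / 2 := by positivity
        calc _ ≤ (K ^ 2 + M ^ 2) / 2 * (C * (N : ℝ) ^ (1 + 2 * ρ + η)) +
              (K ^ 2 + M ^ 2) / 2 * (C * (N : ℝ) ^ (1 + 2 * ρ + η)) := by gcongr
          _ = _ := by ring

end DirichletMeanSquare

namespace DirichletMeanSquare

open Complex HurwitzZeta Filter Topology MeasureTheory
open scoped ArithmeticFunction.Moebius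

/-! ### Möbius inversion -/

theorem sum_divisors_moebius (n : ℕ) :
    ∑ d ∈ n.divisors, ((μ d : ℤ) : ℂ) = if n = 1 then 1 else 0 := by
  have h := congrArg (fun f : ArithmeticFunction ℤ => f n) ArithmeticFunction.moebius_mul_coe_zeta
  rw [ArithmeticFunction.coe_mul_zeta_apply, ArithmeticFunction.one_apply] at h
  have := congrArg (fun z : ℤ => (z : ℂ)) h
  push_cast at this
  simpa using this

/-- The coprimality indicator as a sum of Möbius values. -/
theorem sum_divisors_moebius_ite_dvd {q : ℕ} (hq : q ≠ 0) (a : ℕ) :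
    ∑ n ∈ q.divisors, (if n ∣ a then ((μ n : ℤ) : ℂ) else 0) = if a.Coprime q then 1 else 0 := by
  rw [← Finset.sum_filter]
  refine Eq.trans (Finset.sum_congr ?_ fun _ _ => rfl) (sum_divisors_moebius (a.gcd q))
  ext n
  simp only [Finset.mem_filter, Nat.mem_divisors, Nat.dvd_gcd_iff]
  have : a.gcd q ≠ 0 := Nat.gcd_ne_zero_right hq
  tauto

theorem sum_range_dvd_eq_circleSum {q n : ℕ} (hq : q ≠ 0) (hn : n ∣ q) (F : UnitAddCircle → ℂ) :
    ∑ a ∈ Finset.range q with n ∣ a, F (((a : ℝ) / q : ℝ) : UnitAddCircle) =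
      circleSum (q / n) F := by
  obtain ⟨m, rfl⟩ := hn
  have hn0 : n ≠ 0 := left_ne_zero_of_mul hq
  have hn' : (n : ℝ) ≠ 0 := by exact_mod_cast hn0
  rw [Nat.mul_div_cancel_left _ (Nat.pos_of_ne_zero hn0), circleSum]
  symm
  refine Finset.sum_bij (fun j _ => n * j) ?_ ?_ ?_ ?_
  · intro j hj
    simp only [Finset.mem_filter, Finset.mem_range] at hj ⊢
    exact ⟨Nat.mul_lt_mul_of_pos_left hj (Nat.pos_of_ne_zero hn0), Dvd.intro _ rfl⟩
  · intro i _ j _ h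
    exact Nat.eq_of_mul_eq_mul_left (Nat.pos_of_ne_zero hn0) h
  · intro a ha
    simp only [Finset.mem_filter, Finset.mem_range] at ha
    obtain ⟨ha, j, rfl⟩ := ha
    exact ⟨j, Finset.mem_range.mpr (lt_of_mul_lt_mul_left ha (Nat.zero_le n)), rfl⟩
  · intro j _
    push_cast
    rw [mul_div_mul_left _ _ hn']

/-- The sum over the primitive `q`-torsion points in terms of the sums over torsion points. -/
theorem sum_units_eq_sum_circleSum (q : ℕ) [NeZero q] (F : UnitAddCircle → ℂ) :
    ∑ a : (ZMod q)ˣ, F (ZMod.toAddCircle (a : ZMod q)) =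
      ∑ n ∈ q.divisors, ((μ n : ℤ) : ℂ) * circleSum (q / n) F := by
  have hq : q ≠ 0 := NeZero.ne q
  have h1 : ∀ n ∈ q.divisors, ((μ n : ℤ) : ℂ) * circleSum (q / n) F =
      ∑ a ∈ Finset.range q, (if n ∣ a then ((μ n : ℤ) : ℂ) else 0) *
        F (((a : ℝ) / q : ℝ) : UnitAddCircle) := by
    intro n hn
    rw [← sum_range_dvd_eq_circleSum hq (Nat.dvd_of_mem_divisors hn), Finset.mul_sum,
      Finset.sum_filter]
    exact Finset.sum_congr rfl fun a _ => by split_ifs <;> simp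
  rw [Finset.sum_congr rfl h1, Finset.sum_comm]
  simp only [← Finset.sum_mul, sum_divisors_moebius_ite_dvd hq]
  simp only [ite_mul, one_mul, zero_mul]
  rw [← Finset.sum_filter]
  refine Finset.sum_bij (fun a _ => (a : ZMod q).val) ?_ ?_ ?_ ?_
  · intro a _
    rw [Finset.mem_filter, Finset.mem_range]
    exact ⟨ZMod.val_lt _, ZMod.val_coe_unit_coprime a⟩
  · intro a _ b _ h
    exact Units.ext (ZMod.val_injective q h)
  · intro a ha
    rw [Finset.mem_filter, Finset.mem_range] at ha
    refine ⟨ZMod.unitOfCoprime a ha.2, Finset.mem_univ _, ?_⟩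
    rw [ZMod.coe_unitOfCoprime, ZMod.val_natCast_of_lt ha.1]
  · intro a _
    rw [ZMod.toAddCircle_apply]

/-! ### Sums over the units with a weight of smaller period -/

theorem toAddCircle_castHom {q m : ℕ} [NeZero q] [NeZero m] (h : m ∣ q) (a : ZMod q) :
    ZMod.toAddCircle (ZMod.castHom h (ZMod m) a) = (q / m) • ZMod.toAddCircle a := by
  obtain ⟨r, rfl⟩ := h
  have hm : m ≠ 0 := NeZero.ne m
  have hr : r ≠ 0 := right_ne_zero_of_mul (NeZero.ne (m * r))
  obtain ⟨j, rfl⟩ := ZMod.natCast_zmod_surjective a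
  rw [map_natCast, ZMod.toAddCircle_natCast, ZMod.toAddCircle_natCast,
    Nat.mul_div_cancel_left _ (Nat.pos_of_ne_zero hm), ← AddCircle.coe_nsmul, nsmul_eq_mul]
  congr 1
  have hm' : (m : ℝ) ≠ 0 := by exact_mod_cast hm
  have hr' : (r : ℝ) ≠ 0 := by exact_mod_cast hr
  push_cast
  field_simp

/-- Both sides come down to modulus m / gcd(n, m): the level q/n contains the factor q / lcm(n, m),
and the level m the factor gcd(n, m). -/
theorem circleSum_hurwitz_level {q m n : ℕ} (hq : q ≠ 0) (hm : m ∣ q) (hn : n ∣ q) {s : ℂ}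
    (hs : s ≠ 1) (Φ : UnitAddCircle → ℂ) :
    (q : ℂ) ^ (-s) * circleSum (q / n) (fun x => hurwitzZetaEven x s * Φ ((q / m) • x)) =
      (n : ℂ) ^ (-s) * (m : ℂ) ^ (-s) * circleSum m (fun x => hurwitzZetaEven x s * Φ (n • x)) := by
  have hn0 : n ≠ 0 := fun h => hq (by rw [h] at hn; exact Nat.eq_zero_of_zero_dvd hn)
  have hm0 : m ≠ 0 := fun h => hq (by rw [h] at hm; exact Nat.eq_zero_of_zero_dvd hm)
  have hg0 : n.gcd m ≠ 0 := Nat.gcd_ne_zero_left hn0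
  obtain ⟨n', m', -, en, em⟩ := Nat.exists_coprime n m
  set g := n.gcd m
  have hm'0 : m' ≠ 0 := by rintro rfl; simp at em; exact hm0 em
  have hn'0 : n' ≠ 0 := by rintro rfl; simp at en; exact hn0 en
  have hlcm : n' * m' * g ∣ q := by
    have h1 := Nat.lcm_dvd hn hm
    have h2 : n.lcm m = n' * m' * g := by
      have h3 := Nat.gcd_mul_lcm n m
      refine Nat.eq_of_mul_eq_mul_left (Nat.pos_of_ne_zero hg0) (h3.trans ?_)
      calc n * m = (n' * g) * (m' * g) := by rw [← en, ← em]
        _ = _ := by ring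
    rwa [h2] at h1
  obtain ⟨r, hr⟩ := hlcm
  have hr0 : r ≠ 0 := by rintro rfl; simp at hr; exact hq hr
  have e1 : q / n = r * m' := by
    rw [hr, en]
    refine Nat.div_eq_of_eq_mul_left (by positivity) ?_
    ring
  have e2 : q / m = r * n' := by
    rw [hr, em]
    refine Nat.div_eq_of_eq_mul_left (by positivity) ?_
    ring
  have key1 := circleSum_mul_level (g := r) (h := m') (A := 1) hr0 hm'0 (Nat.coprime_one_left r) hs
    (fun x => Φ (n' • x))
  have key2 := circleSum_mul_level (g := g) (h := m') (A := 1) hg0 hm'0 (Nat.coprime_one_left g) hs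
    (fun x => Φ (n' • x))
  simp only [one_smul, ← mul_nsmul] at key1 key2
  rw [e1, e2, key1]
  have e3 : circleSum m (fun x => hurwitzZetaEven x s * Φ (n • x)) =
      (g : ℂ) ^ s * circleSum m' (fun x => hurwitzZetaEven x s * Φ (n' • x)) := by
    rw [← key2, mul_comm g m', ← em, mul_comm g n', ← en]
  rw [e3]
  have c : ∀ a b : ℕ, ((a * b : ℕ) : ℂ) ^ (-s) = (a : ℂ) ^ (-s) * (b : ℂ) ^ (-s) := fun a b => by
    push_cast; exact natCast_mul_natCast_cpow _ _ _
  have i : ∀ a : ℕ, a ≠ 0 → (a : ℂ) ^ (-s) * (a : ℂ) ^ s = 1 := fun a ha => by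
    rw [← cpow_add _ _ (by exact_mod_cast ha)]; simp
  have hq' : (q : ℂ) ^ (-s) = (n' : ℂ) ^ (-s) * (m' : ℂ) ^ (-s) * (g : ℂ) ^ (-s) * (r : ℂ) ^ (-s) := by
    rw [hr, c, c, c]
  have hn' : (n : ℂ) ^ (-s) = (n' : ℂ) ^ (-s) * (g : ℂ) ^ (-s) := by rw [en, c]
  have hm' : (m : ℂ) ^ (-s) = (m' : ℂ) ^ (-s) * (g : ℂ) ^ (-s) := by rw [em, c]
  rw [hq', hn', hm']
  linear_combination ((n' : ℂ) ^ (-s) * (m' : ℂ) ^ (-s) * (g : ℂ) ^ (-s) *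
    circleSum m' (fun x => hurwitzZetaEven x s * Φ (n' • x))) * (i r hr0 - i g hg0)

/-- Möbius inversion for the condition (a, q) = 1 produces torsion sums of order q/n, which the
preceding relation brings to modulus m. The divisor n survives as an argument shift of φ and the
factor n^(-s), as expected when Euler factors are removed. -/
theorem sum_units_mul_hurwitz {q m : ℕ} [NeZero q] [NeZero m] (h : m ∣ q) {s : ℂ} (hs : s ≠ 1)
    (φ : ZMod m → ℂ) :
    (q : ℂ) ^ (-s) * ∑ a : (ZMod q)ˣ, φ (ZMod.castHom h (ZMod m) a) *
        hurwitzZetaEven (ZMod.toAddCircle (a : ZMod q)) s =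
      ∑ n ∈ q.divisors, ((μ n : ℤ) : ℂ) * (n : ℂ) ^ (-s) * ((m : ℂ) ^ (-s) *
        ∑ i : ZMod m, φ (n * i) * hurwitzZetaEven (ZMod.toAddCircle i) s) := by
  set Φ : UnitAddCircle → ℂ := Function.extend ZMod.toAddCircle φ 0
  have hΦ : ∀ i : ZMod m, Φ (ZMod.toAddCircle i) = φ i := fun i =>
    (ZMod.toAddCircle_injective m).extend_apply _ _ _
  have h1 : ∀ a : (ZMod q)ˣ, φ (ZMod.castHom h (ZMod m) a) *
      hurwitzZetaEven (ZMod.toAddCircle (a : ZMod q)) s =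
      (fun x => hurwitzZetaEven x s * Φ ((q / m) • x)) (ZMod.toAddCircle (a : ZMod q)) := by
    intro a
    simp only
    rw [← toAddCircle_castHom h, hΦ, mul_comm]
  rw [Fintype.sum_congr _ _ h1, sum_units_eq_sum_circleSum q
    (fun x => hurwitzZetaEven x s * Φ ((q / m) • x)), Finset.mul_sum]
  refine Finset.sum_congr rfl fun n hn => ?_
  have := circleSum_hurwitz_level (NeZero.ne q) h (Nat.dvd_of_mem_divisors hn) hs Φ
  rw [mul_left_comm, this, circleSum_eq_sum_zmod m]
  have h2 : ∀ i : ZMod m, hurwitzZetaEven (ZMod.toAddCircle i) s * Φ (n • ZMod.toAddCircle i) =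
      φ (n * i) * hurwitzZetaEven (ZMod.toAddCircle i) s := by
    intro i
    rw [← map_nsmul, hΦ, nsmul_eq_mul, mul_comm]
  simp only [h2]
  ring

/-! ### `L`-functions with Euler factors removed -/

/-- `∑_{(a, q) = 1} ψ(a) a^{-s}` over positive and negative `a`, halved: it is `L_q(s, ψ)` if `ψ` is
even and `0` otherwise. -/
noncomputable def evenL (q : ℕ) {m : ℕ} [NeZero m] (ψ : DirichletCharacter ℂ m) (s : ℂ) : ℂ :=
  ∑ n ∈ q.divisors, ((μ n : ℤ) : ℂ) * (n : ℂ) ^ (-s) * ((m : ℂ) ^ (-s) *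
    ∑ i : ZMod m, ψ (n * i) * hurwitzZetaEven (ZMod.toAddCircle i) s)

theorem sum_eq_sum_units_of_support {q : ℕ} [NeZero q] {f : ZMod q → ℂ}
    (hf : ∀ a, ¬ IsUnit a → f a = 0) : ∑ a : ZMod q, f a = ∑ a : (ZMod q)ˣ, f a := by
  classical
  rw [← Finset.sum_filter_add_sum_filter_not Finset.univ (fun a : ZMod q => IsUnit a),
    Finset.sum_eq_zero (s := Finset.univ.filter fun a : ZMod q => ¬ IsUnit a)
      (fun a ha => hf a (Finset.mem_filter.mp ha).2), add_zero]
  symm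
  refine Finset.sum_bij (fun a _ => (a : ZMod q)) ?_ (fun a _ b _ h => Units.ext h) ?_ fun _ _ => rfl
  · intro a _
    simp
  · intro a ha
    obtain ⟨u, rfl⟩ := (Finset.mem_filter.mp ha).2
    exact ⟨u, Finset.mem_univ _, rfl⟩

theorem even_changeLevel {q m : ℕ} (h : m ∣ q) (ψ : DirichletCharacter ℂ m) :
    (DirichletCharacter.changeLevel h ψ).Even ↔ ψ.Even := by
  have := DirichletCharacter.changeLevel_eq_cast_of_dvd ψ h (-1)
  rw [Units.val_neg, Units.val_one, ZMod.cast_neg h, ZMod.cast_one h] at this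
  rw [DirichletCharacter.Even, DirichletCharacter.Even, this]

theorem lCoprime_eq_evenL {q m : ℕ} [NeZero q] [NeZero m] (h : m ∣ q) {s : ℂ} (hs : s ≠ 1)
    {ψ : DirichletCharacter ℂ m} (hψ : ψ.Even) : lCoprime q ψ s = evenL q ψ s := by
  rw [lCoprime, ← DirichletCharacter.LFunction_changeLevel h ψ (Or.inr hs), evenL,
    ← sum_units_mul_hurwitz h hs]
  have heven : Function.Even (DirichletCharacter.changeLevel h ψ) :=
    ((even_changeLevel h ψ).mpr hψ).to_fun
  rw [DirichletCharacter.LFunction, ZMod.LFunction_def_even heven]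
  congr 1
  rw [sum_eq_sum_units_of_support fun a ha => by rw [MulChar.map_nonunit _ ha, zero_mul]]
  refine Fintype.sum_congr _ _ fun a => ?_
  rw [DirichletCharacter.changeLevel_eq_cast_of_dvd ψ h a, ZMod.castHom_apply]

theorem evenL_eq_zero_of_not_even (q : ℕ) {m : ℕ} [NeZero m] (s : ℂ)
    {ψ : DirichletCharacter ℂ m} (hψ : ¬ ψ.Even) : evenL q ψ s = 0 := by
  have hodd : ψ.Odd := ψ.even_or_odd.resolve_left hψ
  refine Finset.sum_eq_zero fun n _ => ?_
  have : ∑ i : ZMod m, ψ (n * i) * hurwitzZetaEven (ZMod.toAddCircle i) s =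
      -∑ i : ZMod m, ψ (n * i) * hurwitzZetaEven (ZMod.toAddCircle i) s := by
    rw [← Finset.sum_neg_distrib]
    refine Fintype.sum_equiv (.neg _) _ _ fun i => ?_
    rw [Equiv.neg_apply, mul_neg, hodd.eval_neg, map_neg, hurwitzZetaEven_neg]
    ring
  rw [self_eq_neg] at this
  rw [this, mul_zero, mul_zero]

/-! ### Orthogonality -/

theorem sum_char_mul_inv_char {m : ℕ} [NeZero m] (x y : ZMod m) [Decidable (IsUnit y ∧ y = x)] :
    ∑ χ : DirichletCharacter ℂ m, χ x * χ⁻¹ y =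
      if IsUnit y ∧ y = x then (m.totient : ℂ) else 0 := by
  by_cases hy : IsUnit y
  · have h := DirichletCharacter.sum_char_inv_mul_char_eq ℂ hy x
    have e : ∀ χ : DirichletCharacter ℂ m, χ x * χ⁻¹ y = χ y⁻¹ * χ x := fun χ => by
      rw [MulChar.inv_apply, mul_comm]
      congr 2
      obtain ⟨u, rfl⟩ := hy
      rw [Ring.inverse_unit, ZMod.inv_coe_unit]
    simp only [e, h, hy, true_and]
  · rw [if_neg (fun h => hy h.1)]
    exact Finset.sum_eq_zero fun χ _ => by rw [MulChar.map_nonunit _ hy, mul_zero]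

/-- For units a and b, the unit solutions of bj = ai are i = bt, j = at with t a unit. -/
theorem sum_sum_ite_eq_sum_units {m : ℕ} [NeZero m] (a b : ZMod m) (f : ZMod m → ZMod m → ℂ)
    [∀ i j : ZMod m, Decidable (IsUnit (b * j) ∧ b * j = a * i)] (c : ℂ) :
    ∑ i : ZMod m, ∑ j : ZMod m, (if IsUnit (b * j) ∧ b * j = a * i then c else 0) * f i j =
      open Classical in if IsUnit a ∧ IsUnit b then c * ∑ t : (ZMod m)ˣ, f (b * t) (a * t) else 0 := by
  classical
  split_ifs with h
  · obtain ⟨⟨a, rfl⟩, ⟨b, rfl⟩⟩ := h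
    rw [Finset.mul_sum]
    simp only [ite_mul, zero_mul]
    rw [← Finset.sum_product', ← Finset.sum_filter]
    symm
    refine Finset.sum_bij (fun t _ => ((b : ZMod m) * (t : ZMod m), (a : ZMod m) * (t : ZMod m)))
      ?_ ?_ ?_ ?_
    · intro t _
      simp only [Finset.mem_filter, Finset.mem_product, Finset.mem_univ, true_and]
      exact ⟨(b * (a * t)).isUnit, by ring⟩
    · intro t _ t' _ h
      have := (Prod.mk.inj h).1
      exact Units.ext (b.isUnit.mul_left_cancel this)
    · rintro ⟨i, j⟩ hp
      simp only [Finset.mem_filter, Finset.mem_product, Finset.mem_univ, true_and] at hp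
      obtain ⟨hu, he⟩ := hp
      have hi : IsUnit i := by
        rw [he] at hu
        exact isUnit_of_mul_isUnit_right hu
      obtain ⟨i, rfl⟩ := hi
      refine ⟨b⁻¹ * i, Finset.mem_univ _, ?_⟩
      rw [Prod.mk.injEq]
      constructor
      · rw [← Units.val_mul, mul_inv_cancel_left]
      · refine b.isUnit.mul_left_cancel ?_
        rw [he, Units.val_mul]
        calc (b : ZMod m) * (a * (((b⁻¹ : (ZMod m)ˣ) : ZMod m) * i)) =
            (b * ((b⁻¹ : (ZMod m)ˣ) : ZMod m)) * (a * i) := by ring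
          _ = _ := by rw [Units.mul_inv, one_mul]
    · intro t _
      rfl
  · refine Finset.sum_eq_zero fun i _ => Finset.sum_eq_zero fun j _ => ?_
    rw [if_neg, zero_mul]
    rintro ⟨hu, he⟩
    refine h ⟨?_, isUnit_of_mul_isUnit_left hu⟩
    rw [he] at hu
    exact isUnit_of_mul_isUnit_left hu

/-- The sum runs over all characters, since `evenL` vanishes at odd ones; full orthogonality applies
and pairs the residues as n₂ t and n₁ t. -/
theorem sum_evenL_mul_evenL_inv {m : ℕ} [NeZero m] (q : ℕ) (s w : ℂ) :
    ∑ χ : DirichletCharacter ℂ m, evenL q χ s * evenL q χ⁻¹ w =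
      m.totient * (m : ℂ) ^ (-(s + w)) *
        ∑ n₁ ∈ q.divisors with n₁.Coprime m, ∑ n₂ ∈ q.divisors with n₂.Coprime m,
          ((μ n₁ : ℤ) : ℂ) * ((μ n₂ : ℤ) : ℂ) * (n₁ : ℂ) ^ (-s) * (n₂ : ℂ) ^ (-w) *
          ∑ e ∈ m.divisors, ((μ e : ℤ) : ℂ) * ded s w n₁ n₂ (m / e) := by
  classical
  have hm' : (m : ℂ) ≠ 0 := by exact_mod_cast NeZero.ne m
  have h1 : ∀ n₁ n₂ : ℕ, ∑ χ : DirichletCharacter ℂ m,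
      (∑ i : ZMod m, χ (n₁ * i) * hurwitzZetaEven (ZMod.toAddCircle i) s) *
      (∑ j : ZMod m, χ⁻¹ (n₂ * j) * hurwitzZetaEven (ZMod.toAddCircle j) w) =
      if n₁.Coprime m ∧ n₂.Coprime m then (m.totient : ℂ) *
        ∑ e ∈ m.divisors, ((μ e : ℤ) : ℂ) * ded s w n₁ n₂ (m / e) else 0 := by
    intro n₁ n₂
    have e1 : ∑ e ∈ m.divisors, ((μ e : ℤ) : ℂ) * ded s w n₁ n₂ (m / e) =
        ∑ t : (ZMod m)ˣ, hurwitzZetaEven (ZMod.toAddCircle ((n₂ : ZMod m) * (t : ZMod m))) s *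
          hurwitzZetaEven (ZMod.toAddCircle ((n₁ : ZMod m) * (t : ZMod m))) w := by
      simp only [ded]
      rw [← sum_units_eq_sum_circleSum m fun y =>
        hurwitzZetaEven (n₂ • y) s * hurwitzZetaEven (n₁ • y) w]
      simp only [← map_nsmul, nsmul_eq_mul]
    have e2 := sum_sum_ite_eq_sum_units (n₁ : ZMod m) (n₂ : ZMod m) (fun i j =>
      hurwitzZetaEven (ZMod.toAddCircle i) s * hurwitzZetaEven (ZMod.toAddCircle j) w) m.totient
    simp only [ZMod.isUnit_iff_coprime] at e2 ⊢
    rw [e1, ← e2]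
    simp only [Finset.sum_mul_sum]
    rw [Finset.sum_comm]
    refine Finset.sum_congr rfl fun i _ => ?_
    rw [Finset.sum_comm]
    refine Finset.sum_congr rfl fun j _ => ?_
    rw [← sum_char_mul_inv_char, Finset.sum_mul]
    exact Finset.sum_congr rfl fun χ _ => by ring
  simp only [evenL, Finset.sum_mul_sum]
  rw [Finset.sum_comm, Finset.sum_filter, Finset.mul_sum]
  refine Finset.sum_congr rfl fun n₁ _ => ?_
  rw [Finset.sum_comm, mul_ite, mul_zero]
  have e3 : ∀ n₂ : ℕ, ∑ χ : DirichletCharacter ℂ m, ((μ n₁ : ℤ) : ℂ) * (n₁ : ℂ) ^ (-s) *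
      ((m : ℂ) ^ (-s) * ∑ i : ZMod m, χ (n₁ * i) * hurwitzZetaEven (ZMod.toAddCircle i) s) *
      (((μ n₂ : ℤ) : ℂ) * (n₂ : ℂ) ^ (-w) *
      ((m : ℂ) ^ (-w) * ∑ j : ZMod m, χ⁻¹ (n₂ * j) * hurwitzZetaEven (ZMod.toAddCircle j) w)) =
      if n₁.Coprime m ∧ n₂.Coprime m then (m.totient : ℂ) * (m : ℂ) ^ (-(s + w)) * (
          ((μ n₁ : ℤ) : ℂ) * ((μ n₂ : ℤ) : ℂ) * (n₁ : ℂ) ^ (-s) * (n₂ : ℂ) ^ (-w) *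
          ∑ e ∈ m.divisors, ((μ e : ℤ) : ℂ) * ded s w n₁ n₂ (m / e)) else 0 := by
    intro n₂
    have e4 := congrArg (fun z : ℂ => (((μ n₁ : ℤ) : ℂ) * ((μ n₂ : ℤ) : ℂ) * (n₁ : ℂ) ^ (-s) *
      (n₂ : ℂ) ^ (-w) * (m : ℂ) ^ (-(s + w))) * z) (h1 n₁ n₂)
    rw [Finset.mul_sum] at e4
    have e5 : (m : ℂ) ^ (-(s + w)) = (m : ℂ) ^ (-s) * (m : ℂ) ^ (-w) := by
      rw [neg_add, cpow_add _ _ hm']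
    calc _ = _ := Finset.sum_congr rfl fun χ _ => by rw [e5]; ring
      _ = _ := e4
      _ = _ := by
          split_ifs
          · ring
          · rw [mul_zero]
  rw [Finset.sum_congr rfl fun n₂ _ => e3 n₂]
  by_cases hc : n₁.Coprime m
  · rw [if_pos hc, Finset.mul_sum, Finset.sum_filter]
    exact Finset.sum_congr rfl fun n₂ _ => if_congr (and_iff_right hc) rfl rfl
  · rw [if_neg hc]
    exact Finset.sum_eq_zero fun n₂ _ => if_neg fun h => hc h.1

end DirichletMeanSquare

namespace DirichletMeanSquare

open Complex HurwitzZeta Filter Topology MeasureTheory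
open scoped ArithmeticFunction.Moebius

/-! ### Sums over primitive characters -/

theorem sum_divisors_moebius_div_ite {q c : ℕ} (hq : q ≠ 0) (hc : c ∣ q) :
    ∑ m ∈ q.divisors, (if c ∣ m then ((μ (q / m) : ℤ) : ℂ) else 0) = if c = q then 1 else 0 := by
  have hc0 : 0 < c := Nat.pos_of_dvd_of_pos hc (Nat.pos_of_ne_zero hq)
  rw [← Nat.sum_div_divisors q]
  have h1 : ∀ n ∈ q.divisors, (if c ∣ q / n then ((μ (q / (q / n)) : ℤ) : ℂ) else 0) =
      if n ∣ q / c then ((μ n : ℤ) : ℂ) else 0 := by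
    intro n hn
    have hnq := Nat.dvd_of_mem_divisors hn
    rw [Nat.div_div_self hnq hq]
    refine if_congr ?_ rfl rfl
    rw [Nat.dvd_div_iff_mul_dvd hnq, Nat.dvd_div_iff_mul_dvd hc, mul_comm]
  rw [Finset.sum_congr rfl h1, sum_divisors_moebius_ite_dvd hq]
  refine if_congr ?_ rfl rfl
  obtain ⟨r, rfl⟩ := hc
  rw [Nat.mul_div_cancel_left _ hc0, Nat.coprime_mul_iff_right, Nat.coprime_self]
  constructor
  · rintro ⟨-, rfl⟩; simp
  · intro h
    have : r = 1 := by
      have := Nat.eq_of_mul_eq_mul_left hc0 ((mul_one c).trans h)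
      exact this.symm
    simp [this]

theorem sum_conductor_dvd {q m : ℕ} [NeZero q] [NeZero m] (h : m ∣ q)
    (f : DirichletCharacter ℂ q → ℂ) :
    ∑ χ : DirichletCharacter ℂ q with χ.conductor ∣ m, f χ =
      ∑ χ : DirichletCharacter ℂ m, f (DirichletCharacter.changeLevel h χ) := by
  symm
  refine Finset.sum_bij (fun χ _ => DirichletCharacter.changeLevel h χ) ?_
    (fun χ _ χ' _ e => DirichletCharacter.changeLevel_injective h e) ?_ fun _ _ => rfl
  · intro χ _
    rw [Finset.mem_filter]
    exact ⟨Finset.mem_univ _, ((DirichletCharacter.changeLevel h χ).mem_conductorSet_iff_conductor_dvd h).mp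
      (DirichletCharacter.changeLevel_factorsThrough χ h)⟩
  · intro χ hχ
    rw [Finset.mem_filter] at hχ
    obtain ⟨_, χ₀, e⟩ := (χ.mem_conductorSet_iff_conductor_dvd h).mpr hχ.2
    exact ⟨χ₀, Finset.mem_univ _, e.symm⟩

-- Primitivity means conductor q; the indicator of this is a Möbius sum over the divisors m of q
-- that are multiples of the conductor.
open Classical in
theorem sum_isPrimitive {q : ℕ} [NeZero q] (f : DirichletCharacter ℂ q → ℂ) :
    ∑ χ : DirichletCharacter ℂ q with χ.IsPrimitive, f χ =
      ∑ m ∈ q.divisors, ((μ (q / m) : ℤ) : ℂ) *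
        ∑ χ : DirichletCharacter ℂ q with χ.conductor ∣ m, f χ := by
  simp only [Finset.sum_filter, Finset.mul_sum]
  rw [Finset.sum_comm]
  refine Finset.sum_congr rfl fun χ _ => ?_
  have h := sum_divisors_moebius_div_ite (NeZero.ne q) χ.conductor_dvd_level
  rw [DirichletCharacter.isPrimitive_def]
  have h1 : ∀ m, ((μ (q / m) : ℤ) : ℂ) * (if χ.conductor ∣ m then f χ else 0) =
      (if χ.conductor ∣ m then ((μ (q / m) : ℤ) : ℂ) else 0) * f χ := fun m => by
    split_ifs <;> simp
  simp only [h1]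
  rw [← Finset.sum_mul, h]
  split_ifs <;> simp

theorem phiStar_eq (q : ℕ) [NeZero q] :
    (phiStar q : ℂ) = ∑ m ∈ q.divisors, ((μ (q / m) : ℤ) : ℂ) * (m.totient : ℂ) := by
  classical
  have h := sum_isPrimitive (q := q) fun _ => 1
  rw [phiStar]
  rw [Finset.sum_const, nsmul_eq_mul, mul_one] at h
  rw [h]
  refine Finset.sum_congr rfl fun m hm => ?_
  have hm0 : NeZero m := ⟨(Nat.pos_of_mem_divisors hm).ne'⟩
  rw [sum_conductor_dvd (Nat.dvd_of_mem_divisors hm), Finset.sum_const, nsmul_eq_mul, mul_one,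
    Finset.card_univ, ← Nat.card_eq_fintype_card,
    DirichletCharacter.card_eq_totient_of_hasEnoughRootsOfUnity]

/-- The sum of `L_q(s, χ) L_q(w, χ̄)` over the even characters modulo `m`, as a combination of
correlation sums. -/
noncomputable def levelSum (q : ℕ) (s w : ℂ) (m : ℕ) : ℂ :=
  m.totient * (m : ℂ) ^ (-(s + w)) *
    ∑ n₁ ∈ q.divisors with n₁.Coprime m, ∑ n₂ ∈ q.divisors with n₂.Coprime m,
      ((μ n₁ : ℤ) : ℂ) * ((μ n₂ : ℤ) : ℂ) * (n₁ : ℂ) ^ (-s) * (n₂ : ℂ) ^ (-w) *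
      ∑ e ∈ m.divisors, ((μ e : ℤ) : ℂ) * ded s w n₁ n₂ (m / e)

/-- The summand makes sense for every even character modulo q. One induced from modulus m has the
L-function of its inducing character with the Euler factors at p ∣ q removed, whence `levelSum`. -/
theorem evenMeanSquare_eq {q : ℕ} [NeZero q] {α β : ℂ} (hα : 1 / 2 + α ≠ 1) (hβ : 1 / 2 + β ≠ 1) :
    evenMeanSquare q α β = ∑ m ∈ q.divisors, ((μ (q / m) : ℤ) : ℂ) *
      levelSum q (1 / 2 + α) (1 / 2 + β) m := by
  classical
  have h := sum_isPrimitive (q := q) fun χ =>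
    if χ.Even then χ.LFunction (1 / 2 + α) * χ⁻¹.LFunction (1 / 2 + β) else 0
  rw [← Finset.sum_filter, Finset.filter_filter] at h
  rw [evenMeanSquare]
  refine Eq.trans ?_ (h.trans ?_)
  · exact Finset.sum_congr (by congr) fun _ _ => rfl
  refine Finset.sum_congr rfl fun m hm => ?_
  have hm0 : NeZero m := ⟨(Nat.pos_of_mem_divisors hm).ne'⟩
  have hmq := Nat.dvd_of_mem_divisors hm
  rw [sum_conductor_dvd hmq, levelSum, ← sum_evenL_mul_evenL_inv]
  congr 1
  refine Finset.sum_congr rfl fun χ _ => ?_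
  by_cases hχ : χ.Even
  · have hχi : χ⁻¹.Even := by
      rw [DirichletCharacter.Even] at hχ ⊢
      rw [MulChar.inv_apply_eq_inv', hχ, inv_one]
    rw [if_pos ((even_changeLevel hmq χ).mpr hχ), ← map_inv,
      ← lCoprime_eq_evenL hmq hα hχ, ← lCoprime_eq_evenL hmq hβ hχi, lCoprime, lCoprime,
      DirichletCharacter.LFunction_changeLevel hmq _ (Or.inr hα),
      DirichletCharacter.LFunction_changeLevel hmq _ (Or.inr hβ)]
  · rw [if_neg (fun h => hχ ((even_changeLevel hmq χ).mp h)), evenL_eq_zero_of_not_even q _ hχ,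
      zero_mul]

/-! ### The secondary term -/

theorem evenL_eq_sum_units {q m : ℕ} [NeZero q] [NeZero m] (h : m ∣ q) {s : ℂ} (hs : s ≠ 1)
    (ψ : DirichletCharacter ℂ m) : evenL q ψ s = (q : ℂ) ^ (-s) * ∑ a : (ZMod q)ˣ,
      ψ (ZMod.castHom h (ZMod m) a) * hurwitzZetaEven (ZMod.toAddCircle (a : ZMod q)) s := by
  rw [evenL, ← sum_units_mul_hurwitz h hs]

theorem sum_tau_inv_mul_char {m : ℕ} [NeZero m] {M x : (ZMod m)ˣ} :
    ∑ ψ : DirichletCharacter ℂ m, tau ψ⁻¹ * ψ⁻¹ (M : ZMod m) * ψ (x : ZMod m) =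
      m.totient * ZMod.stdAddChar ((x : ZMod m) * ((M⁻¹ : (ZMod m)ˣ) : ZMod m)) := by
  classical
  have h1 : ∀ ψ : DirichletCharacter ℂ m, tau ψ⁻¹ * ψ⁻¹ (M : ZMod m) * ψ (x : ZMod m) =
      ∑ y : ZMod m, (ψ x * ψ⁻¹ (y * M)) * ZMod.stdAddChar y := by
    intro ψ
    rw [tau, gaussSum, Finset.sum_mul, Finset.sum_mul]
    exact Finset.sum_congr rfl fun y _ => by rw [map_mul]; ring
  simp only [h1]
  rw [Finset.sum_comm]
  simp only [← Finset.sum_mul, sum_char_mul_inv_char]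
  rw [Finset.sum_eq_single_of_mem ((x : ZMod m) * ((M⁻¹ : (ZMod m)ˣ) : ZMod m)) (Finset.mem_univ _)]
  · have e : (x : ZMod m) * ((M⁻¹ : (ZMod m)ˣ) : ZMod m) * M = x := by
      rw [mul_assoc, Units.inv_mul, mul_one]
    rw [e, if_pos ⟨x.isUnit, rfl⟩]
  · intro y _ hy
    rw [if_neg, zero_mul]
    rintro ⟨-, he⟩
    refine hy ?_
    rw [← he, mul_assoc, Units.mul_inv, mul_one]

/-- The correlation sums that make up one half of the secondary term. -/
noncomputable def dualSum (q : ℕ) (s w : ℂ) (c d : ℕ) : ℂ :=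
  ∑ n ∈ q.divisors, ∑ n₁ ∈ q.divisors, ((μ n : ℤ) : ℂ) * ((μ n₁ : ℤ) : ℂ) * (n : ℂ) ^ (w - 1) *
    (n₁ : ℂ) ^ (-s) * (c : ℂ) ^ (-s) * ded s w (n * n₁) d c

/-- Summing over ψ turns the Gauss sum into the additive character e(ab M⁻¹ / m). The sum over b is
then a Fourier transform of values at 1 - w, which Hurwitz's formula converts into values of Z_w;
the substitution a ↦ Ma finally puts M next to Z_s. -/
theorem sum_tau_mul_evenL_mul_evenL {δ : ℝ} (hδ : δ < 1 / 2) {s w : ℂ} (hs : ‖s - 1 / 2‖ ≤ δ)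
    (hw : ‖w - 1 / 2‖ ≤ δ) {q m M : ℕ} [NeZero q] [NeZero m] (h : m ∣ q) (hM : M.Coprime m) :
    gammaFactor w * ∑ ψ : DirichletCharacter ℂ m, tau ψ⁻¹ * ψ⁻¹ (M : ZMod m) *
        (evenL q ψ s * evenL q ψ (1 - w)) = m.totient * dualSum q s w m M := by
  have hs1 := ne_one_of_near_half hδ hs
  have hw1 := ne_one_of_near_half hδ (one_sub_near_half hw)
  set u := ZMod.unitOfCoprime M hM
  have hu : ((u : (ZMod m)ˣ) : ZMod m) = (M : ZMod m) := ZMod.coe_unitOfCoprime M hM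
  set v : ZMod m := ((u⁻¹ : (ZMod m)ˣ) : ZMod m)
  set Z := fun (z : ℂ) (x : ZMod m) => hurwitzZetaEven (ZMod.toAddCircle x) z
  set Zq := fun (z : ℂ) (x : ZMod q) => hurwitzZetaEven (ZMod.toAddCircle x) z
  set κ := ZMod.castHom h (ZMod m)
  have e1 : ∑ ψ : DirichletCharacter ℂ m, tau ψ⁻¹ * ψ⁻¹ (M : ZMod m) *
        (evenL q ψ s * evenL q ψ (1 - w)) = m.totient * ((q : ℂ) ^ (-s) * ∑ a : (ZMod q)ˣ,
        ((q : ℂ) ^ (-(1 - w)) * ∑ b : (ZMod q)ˣ, ZMod.stdAddChar (κ a * v * κ b) * Zq (1 - w) b) *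
          Zq s a) := by
    have e2 : ∀ ψ : DirichletCharacter ℂ m, tau ψ⁻¹ * ψ⁻¹ (M : ZMod m) *
        (evenL q ψ s * evenL q ψ (1 - w)) = ∑ a : (ZMod q)ˣ, ∑ b : (ZMod q)ˣ,
          (tau ψ⁻¹ * ψ⁻¹ (M : ZMod m) * ψ (κ a * κ b)) *
            ((q : ℂ) ^ (-s) * (q : ℂ) ^ (-(1 - w)) * Zq s a * Zq (1 - w) b) := by
      intro ψ
      rw [evenL_eq_sum_units h hs1, evenL_eq_sum_units h hw1, mul_mul_mul_comm ((q : ℂ) ^ (-s)), Finset.sum_mul_sum,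
        Finset.mul_sum, Finset.mul_sum]
      refine Finset.sum_congr rfl fun a _ => ?_
      rw [Finset.mul_sum, Finset.mul_sum]
      refine Finset.sum_congr rfl fun b _ => ?_
      rw [map_mul ψ]
      ring
    simp only [e2]
    rw [Finset.sum_comm, Finset.mul_sum, Finset.mul_sum]
    refine Finset.sum_congr rfl fun a _ => ?_
    rw [Finset.sum_comm, Finset.mul_sum, Finset.sum_mul, Finset.mul_sum, Finset.mul_sum]
    refine Finset.sum_congr rfl fun b _ => ?_
    have e3 := sum_tau_inv_mul_char (m := m) (M := u)
      (x := Units.map κ.toMonoidHom a * Units.map κ.toMonoidHom b)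
    rw [hu] at e3
    rw [← Finset.sum_mul]
    have e4 : ((Units.map κ.toMonoidHom a * Units.map κ.toMonoidHom b : (ZMod m)ˣ) : ZMod m) =
      κ a * κ b := rfl
    rw [e4] at e3
    rw [e3, mul_right_comm (κ a) (κ b)]
    ring
  have e5 : ∀ x : ZMod m, gammaFactor w * ((q : ℂ) ^ (-(1 - w)) * ∑ b : (ZMod q)ˣ,
      ZMod.stdAddChar (x * v * κ b) * Zq (1 - w) b) =
      ∑ n ∈ q.divisors, ((μ n : ℤ) : ℂ) * (n : ℂ) ^ (w - 1) * Z w (x * (v * (n : ZMod m))) := by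
    intro x
    rw [sum_units_mul_hurwitz h hw1 (fun y => ZMod.stdAddChar (x * v * y)), Finset.mul_sum]
    refine Finset.sum_congr rfl fun n _ => ?_
    have e6 := hurwitzZetaEven_toAddCircle_eq hδ hw (x * (v * (n : ZMod m)))
    simp only [Z]
    rw [e6, neg_sub]
    simp only [← mul_assoc]
    ring
  have e7 : ∀ n : ℕ, (q : ℂ) ^ (-s) * ∑ a : (ZMod q)ˣ, Z w (κ a * (v * (n : ZMod m))) * Zq s a =
      ∑ n₁ ∈ q.divisors, ((μ n₁ : ℤ) : ℂ) * (n₁ : ℂ) ^ (-s) * ((m : ℂ) ^ (-s) *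
        ded s w (n * n₁) M m) := by
    intro n
    rw [sum_units_mul_hurwitz h hs1 (fun y => Z w (y * (v * (n : ZMod m))))]
    refine Finset.sum_congr rfl fun n₁ _ => ?_
    congr 2
    rw [ded, circleSum_eq_sum_zmod]
    symm
    refine Fintype.sum_equiv (Units.mulLeft u) _ _ fun t => ?_
    rw [← map_nsmul, ← map_nsmul, nsmul_eq_mul, nsmul_eq_mul, Units.mulLeft_apply, hu, mul_comm]
    simp only [Z]
    congr 3
    rw [← hu]
    calc ((n * n₁ : ℕ) : ZMod m) * t = (n₁ * n * t) * ((u : ZMod m) * v) := by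
          rw [Units.mul_inv]; push_cast; ring
      _ = _ := by ring
  calc _ = m.totient * ((q : ℂ) ^ (-s) * ∑ a : (ZMod q)ˣ, (gammaFactor w *
        ((q : ℂ) ^ (-(1 - w)) * ∑ b : (ZMod q)ˣ, ZMod.stdAddChar (κ a * v * κ b) * Zq (1 - w) b)) *
          Zq s a) := by
        rw [e1]
        simp only [mul_assoc, ← Finset.mul_sum]
        ring
    _ = m.totient * ∑ n ∈ q.divisors, ((μ n : ℤ) : ℂ) * (n : ℂ) ^ (w - 1) *
        ((q : ℂ) ^ (-s) * ∑ a : (ZMod q)ˣ, Z w (κ a * (v * (n : ZMod m))) * Zq s a) := by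
        simp only [e5]
        simp only [Finset.sum_mul, Finset.mul_sum]
        rw [Finset.sum_comm]
        refine Finset.sum_congr rfl fun n _ => Finset.sum_congr rfl fun a _ => by ring
    _ = _ := by
        congr 1
        rw [dualSum]
        refine Finset.sum_congr rfl fun n _ => ?_
        rw [e7, Finset.mul_sum]
        refine Finset.sum_congr rfl fun n₁ _ => by ring

/-- Matches the archimedean factor of the statement with the one in ζ(w) = `gammaFactor w` · ζ(1 -
w), at w = 1/2 + β. -/
theorem gammaCos_mul_cpow {q : ℕ} (hq : q ≠ 0) (β : ℂ) :
    2 / (q : ℂ) * (gammaCos β * ((q : ℂ) / (2 * (Real.pi : ℂ))) ^ (1 / 2 - β)) =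
      (q : ℂ) ^ (-(1 / 2 + β)) * gammaFactor (1 / 2 + β) := by
  have hq' : (q : ℂ) ≠ 0 := by exact_mod_cast hq
  have h1 : (1 : ℂ) / 2 - β = 1 - (1 / 2 + β) := by ring
  have h2 : ((q : ℂ) / (2 * (Real.pi : ℂ))) ^ (1 - (1 / 2 + β)) =
      (q : ℂ) * (q : ℂ) ^ (-(1 / 2 + β)) * (2 * (Real.pi : ℂ)) ^ ((1 / 2 + β) - 1) := by
    have h3 : (q : ℂ) / (2 * (Real.pi : ℂ)) = ((q : ℝ) : ℂ) * (((2 * Real.pi)⁻¹ : ℝ) : ℂ) := by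
      push_cast; rw [div_eq_mul_inv]
    rw [h3, mul_cpow_ofReal_nonneg (by positivity) (by positivity), sub_eq_add_neg 1,
      ofReal_natCast, cpow_add _ _ hq', cpow_one]
    congr 1
    rw [ofReal_inv, inv_cpow _ _ (by
      rw [arg_ofReal_of_nonneg (by positivity)]; exact Real.pi_pos.ne), ← cpow_neg]
    push_cast
    congr 1
    ring
  have h4 : (Real.pi : ℂ) / 2 * (1 - (1 / 2 + β)) = Real.pi * (1 - (1 / 2 + β)) / 2 := by ring
  rw [gammaCos, gammaFactor, h1, h2, h4]
  field_simp

theorem evenGaussSum_eq {δ : ℝ} (hδ : δ < 1 / 2) {α β : ℂ} (hα : ‖α‖ ≤ δ)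
    (hβ : ‖β‖ ≤ δ) {q m M : ℕ} [NeZero q] [NeZero m] (h : m ∣ q) (hM : M.Coprime m) :
    2 / (q : ℂ) * evenGaussSum q m M α β = m.totient *
      ((q : ℂ) ^ (-(1 / 2 + β)) * dualSum q (1 / 2 + α) (1 / 2 + β) m M +
        (q : ℂ) ^ (-(1 / 2 + α)) * dualSum q (1 / 2 + β) (1 / 2 + α) m M) := by
  classical
  have hs : ‖(1 / 2 + α) - 1 / 2‖ ≤ δ := by simpa using hα
  have hw : ‖(1 / 2 + β) - 1 / 2‖ ≤ δ := by simpa using hβ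
  have h1 := sum_tau_mul_evenL_mul_evenL hδ hs hw h hM
  have h2 := sum_tau_mul_evenL_mul_evenL hδ hw hs h hM
  have eβ := gammaCos_mul_cpow (NeZero.ne q) β
  have eα := gammaCos_mul_cpow (NeZero.ne q) α
  have n1 : ∀ γ : ℂ, (1 : ℂ) / 2 - γ = 1 - (1 / 2 + γ) := fun γ => by ring
  have key : evenGaussSum q m M α β = ∑ ψ : DirichletCharacter ℂ m, tau ψ⁻¹ * ψ⁻¹ (M : ZMod m) *
      (gammaCos β * ((q : ℂ) / (2 * (Real.pi : ℂ))) ^ (1 / 2 - β) *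
          evenL q ψ (1 / 2 + α) * evenL q ψ (1 - (1 / 2 + β)) +
        gammaCos α * ((q : ℂ) / (2 * (Real.pi : ℂ))) ^ (1 / 2 - α) *
          evenL q ψ (1 - (1 / 2 + α)) * evenL q ψ (1 / 2 + β)) := by
    rw [evenGaussSum, Finset.sum_filter]
    refine Finset.sum_congr rfl fun ψ _ => ?_
    by_cases hψ : ψ.Even
    · rw [if_pos hψ, lCoprime_eq_evenL h (ne_one_of_near_half hδ hs) hψ,
        lCoprime_eq_evenL h (ne_one_of_near_half hδ hw) hψ,
        lCoprime_eq_evenL h (n1 β ▸ ne_one_of_near_half hδ (one_sub_near_half hw)) hψ,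
        lCoprime_eq_evenL h (n1 α ▸ ne_one_of_near_half hδ (one_sub_near_half hs)) hψ,
        n1 α, n1 β]
    · rw [if_neg hψ]
      simp [evenL_eq_zero_of_not_even q _ hψ]
  have split : evenGaussSum q m M α β =
      gammaCos β * ((q : ℂ) / (2 * (Real.pi : ℂ))) ^ (1 / 2 - β) *
        (∑ ψ : DirichletCharacter ℂ m, tau ψ⁻¹ * ψ⁻¹ (M : ZMod m) *
          (evenL q ψ (1 / 2 + α) * evenL q ψ (1 - (1 / 2 + β)))) +
      gammaCos α * ((q : ℂ) / (2 * (Real.pi : ℂ))) ^ (1 / 2 - α) *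
        (∑ ψ : DirichletCharacter ℂ m, tau ψ⁻¹ * ψ⁻¹ (M : ZMod m) *
          (evenL q ψ (1 / 2 + β) * evenL q ψ (1 - (1 / 2 + α)))) := by
    rw [key, Finset.mul_sum, Finset.mul_sum, ← Finset.sum_add_distrib]
    exact Finset.sum_congr rfl fun ψ _ => by ring
  rw [split]
  linear_combination (∑ ψ : DirichletCharacter ℂ m, tau ψ⁻¹ * ψ⁻¹ (M : ZMod m) *
          (evenL q ψ (1 / 2 + α) * evenL q ψ (1 - (1 / 2 + β)))) * eβ +
    (∑ ψ : DirichletCharacter ℂ m, tau ψ⁻¹ * ψ⁻¹ (M : ZMod m) *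
          (evenL q ψ (1 / 2 + β) * evenL q ψ (1 - (1 / 2 + α)))) * eα +
    (q : ℂ) ^ (-(1 / 2 + β)) * h1 + (q : ℂ) ^ (-(1 / 2 + α)) * h2

/-- The φ(m) from orthogonality cancels 1/φ(m), and φ(q)/φ(c) = φ(d). -/
theorem secondaryTerm_eq {δ : ℝ} (hδ : δ < 1 / 2) {α β : ℂ} (hα : ‖α‖ ≤ δ)
    (hβ : ‖β‖ ≤ δ) {q : ℕ} [NeZero q] :
    secondaryTerm q α β = ∑ p ∈ q.divisorsAntidiagonal with p.1.Coprime p.2,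
      ((μ p.1 : ℤ) : ℂ) ^ 2 * (p.2.totient : ℂ) *
      ((q : ℂ) ^ (-(1 / 2 + β)) *
          dualSum q (1 / 2 + α) (1 / 2 + β) (min p.1 p.2) (max p.1 p.2) +
        (q : ℂ) ^ (-(1 / 2 + α)) *
          dualSum q (1 / 2 + β) (1 / 2 + α) (min p.1 p.2) (max p.1 p.2)) := by
  rw [secondaryTerm, Finset.sum_filter, Finset.mul_sum,
    ← Finset.sum_coe_sort q.divisorsAntidiagonal]
  refine Finset.sum_congr rfl fun p _ => ?_
  have hp := Nat.mem_divisorsAntidiagonal.mp p.2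
  by_cases hc : Nat.Coprime p.1.1 p.1.2
  · rw [if_pos hc, if_pos hc]
    have : NeZero (min p.1.1 p.1.2) := min_neZero p
    have hmM : min p.1.1 p.1.2 * max p.1.1 p.1.2 = q := by rw [min_mul_max, hp.1]
    have hMm : (max p.1.1 p.1.2).Coprime (min p.1.1 p.1.2) := by
      rcases le_total p.1.1 p.1.2 with hle | hle
      · rw [max_eq_right hle, min_eq_left hle]; exact hc.symm
      · rw [max_eq_left hle, min_eq_right hle]; exact hc
    have key := evenGaussSum_eq hδ hα hβ (Dvd.intro _ hmM) hMm
    have ht : (q.totient : ℂ) = p.1.1.totient * p.1.2.totient := by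
      have h := Nat.totient_mul hc
      rw [hp.1] at h
      exact_mod_cast h
    have h1 : (p.1.1.totient : ℂ) ≠ 0 := by
      have : 0 < p.1.1 := Nat.pos_of_ne_zero (left_ne_zero_of_mul (hp.1 ▸ hp.2))
      exact_mod_cast (Nat.totient_pos.mpr this).ne'
    have h2 : ((min p.1.1 p.1.2).totient : ℂ) ≠ 0 := by
      exact_mod_cast (Nat.totient_pos.mpr (Nat.pos_of_ne_zero (NeZero.ne (min p.1.1 p.1.2)))).ne'
    have e : ∀ X E : ℂ, 2 / (q : ℂ) * E = ((min p.1.1 p.1.2).totient : ℂ) * X →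
        2 * ((q.totient : ℂ) / q) * (((μ p.1.1 : ℤ) : ℂ) ^ 2 / (p.1.1.totient : ℂ) *
          (1 / ((min p.1.1 p.1.2).totient : ℂ)) * E) =
          ((μ p.1.1 : ℤ) : ℂ) ^ 2 * (p.1.2.totient : ℂ) * X := by
      intro X E hE
      have hq' : (q : ℂ) ≠ 0 := by exact_mod_cast NeZero.ne q
      rw [ht]
      field_simp
      field_simp at hE
      linear_combination (((μ p.1.1 : ℤ) : ℂ) ^ 2 * (p.1.2.totient : ℂ)) * hE
    exact e _ _ key
  · rw [if_neg hc, if_neg hc, mul_zero]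

end DirichletMeanSquare

namespace DirichletMeanSquare

open Complex
open scoped ArithmeticFunction.Moebius

/-! ### Euler products of Möbius sums -/

/-- Only squarefree n count; they correspond to sets of primes dividing q, and the sum is the
expanded product. -/
theorem sum_moebius_mul_prod_ite {q : ℕ} (hq : q ≠ 0) (a b : ℕ → ℂ) :
    ∑ n ∈ q.divisors, ((μ n : ℤ) : ℂ) * ∏ p ∈ q.primeFactors, (if p ∣ n then b p else a p) =
      ∏ p ∈ q.primeFactors, (a p - b p) := by
  classical
  have h1 : ∏ p ∈ q.primeFactors, (a p - b p) = ∏ p ∈ q.primeFactors, (-b p + a p) :=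
    Finset.prod_congr rfl fun p _ => by ring
  rw [h1, Finset.prod_add]
  have h2 : ∑ n ∈ q.divisors, ((μ n : ℤ) : ℂ) * ∏ p ∈ q.primeFactors, (if p ∣ n then b p else a p) =
      ∑ n ∈ q.divisors with Squarefree n,
        ((μ n : ℤ) : ℂ) * ∏ p ∈ q.primeFactors, (if p ∣ n then b p else a p) := by
    rw [Finset.sum_filter]
    refine Finset.sum_congr rfl fun n _ => ?_
    split_ifs with h
    · rfl
    · rw [ArithmeticFunction.moebius_eq_zero_of_not_squarefree h]; simp
  rw [h2]
  have hprime : ∀ t ⊆ q.primeFactors, ∀ p ∈ t, p.Prime := fun t ht p hp =>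
    Nat.prime_of_mem_primeFactors (ht hp)
  symm
  refine Finset.sum_bij' (fun t _ => ∏ p ∈ t, p) (fun n _ => n.primeFactors) ?_ ?_ ?_ ?_ ?_
  · intro t ht
    rw [Finset.mem_powerset] at ht
    rw [Finset.mem_filter, Nat.mem_divisors]
    refine ⟨⟨(Finset.prod_dvd_prod_of_subset _ _ _ ht).trans (Nat.prod_primeFactors_dvd q), hq⟩, ?_⟩
    refine Finset.squarefree_prod_of_pairwise_isCoprime (fun p hp p' hp' hne => ?_)
      fun p hp => (hprime t ht p hp).prime.squarefree
    rw [Function.onFun, ← Nat.coprime_iff_isRelPrime]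
    exact (Nat.coprime_primes (hprime t ht p hp) (hprime t ht p' hp')).mpr hne
  · intro n hn
    rw [Finset.mem_filter, Nat.mem_divisors] at hn
    exact Finset.mem_powerset.mpr (Nat.primeFactors_mono hn.1.1 hq)
  · intro t ht
    rw [Finset.mem_powerset] at ht
    exact Nat.primeFactors_prod (hprime t ht)
  · intro n hn
    rw [Finset.mem_filter] at hn
    exact Nat.prod_primeFactors_of_squarefree hn.2
  · intro t ht
    rw [Finset.mem_powerset] at ht
    have hdvd : ∀ p ∈ q.primeFactors, (p ∣ ∏ p ∈ t, p ↔ p ∈ t) := by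
      intro p hp
      have hp' := Nat.prime_of_mem_primeFactors hp
      rw [← Nat.primeFactors_prod (hprime t ht), Nat.mem_primeFactors,
        Nat.primeFactors_prod (hprime t ht)]
      have h0 : ∏ p ∈ t, p ≠ 0 := Finset.prod_ne_zero_iff.mpr fun p hp => (hprime t ht p hp).ne_zero
      tauto
    have h3 : ∏ p ∈ q.primeFactors, (if p ∣ ∏ p ∈ t, p then b p else a p) =
        (∏ p ∈ t, b p) * ∏ p ∈ q.primeFactors \ t, a p := by
      rw [← Finset.prod_sdiff ht, mul_comm]
      congr 1
      · exact Finset.prod_congr rfl fun p hp => if_pos ((hdvd p (ht hp)).mpr hp)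
      · refine Finset.prod_congr rfl fun p hp => if_neg ?_
        rw [Finset.mem_sdiff] at hp
        exact fun h => hp.2 ((hdvd p hp.1).mp h)
    rw [h3, ArithmeticFunction.isMultiplicative_moebius.map_prod_of_subset_primeFactors q t ht]
    have h4 : ((∏ p ∈ t, μ p : ℤ) : ℂ) = ∏ p ∈ t, (-1 : ℂ) := by
      push_cast
      refine Finset.prod_congr rfl fun p hp => ?_
      rw [ArithmeticFunction.moebius_apply_prime (hprime t ht p hp)]
      simp
    rw [h4, ← mul_assoc, ← Finset.prod_mul_distrib]
    congr 1
    exact Finset.prod_congr rfl fun p _ => by ring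

theorem sum_coprime_moebius_mul_prod_ite {q : ℕ} (hq : q ≠ 0) (m : ℕ) (a b : ℕ → ℂ) :
    ∑ n ∈ q.divisors with n.Coprime m,
        ((μ n : ℤ) : ℂ) * ∏ p ∈ q.primeFactors, (if p ∣ n then b p else a p) =
      ∏ p ∈ q.primeFactors, (a p - if p ∣ m then 0 else b p) := by
  rw [← sum_moebius_mul_prod_ite hq, Finset.sum_filter]
  refine Finset.sum_congr rfl fun n hn => ?_
  split_ifs with h
  · congr 1
    refine Finset.prod_congr rfl fun p hp => ?_
    by_cases hpn : p ∣ n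
    · rw [if_pos hpn, if_pos hpn, if_neg]
      exact fun hpm => (Nat.prime_of_mem_primeFactors hp).one_lt.ne'
        (Nat.eq_one_of_dvd_coprimes h hpn hpm)
    · rw [if_neg hpn, if_neg hpn]
  · obtain ⟨p, hp, hpn, hpm⟩ := Nat.Prime.not_coprime_iff_dvd.mp h
    have hpq : p ∈ q.primeFactors :=
      Nat.mem_primeFactors.mpr ⟨hp, hpn.trans (Nat.dvd_of_mem_divisors hn), hq⟩
    rw [Finset.prod_eq_zero hpq (by rw [if_pos hpn, if_pos hpm]), mul_zero]

theorem prod_primeFactors_eq_prod_ite {q n : ℕ} (hq : q ≠ 0) (hn : n ∣ q) (f : ℕ → ℂ) :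
    ∏ p ∈ n.primeFactors, f p = ∏ p ∈ q.primeFactors, if p ∣ n then f p else 1 := by
  classical
  rw [← Finset.prod_filter]
  refine Finset.prod_congr ?_ fun _ _ => rfl
  ext p
  have hn0 : n ≠ 0 := fun h => hq (Nat.eq_zero_of_zero_dvd (h ▸ hn))
  simp only [Finset.mem_filter, Nat.mem_primeFactors]
  constructor
  · rintro ⟨h1, h2, -⟩
    exact ⟨⟨h1, h2.trans hn, hq⟩, h2⟩
  · rintro ⟨⟨h1, -, -⟩, h2⟩
    exact ⟨h1, h2, hn0⟩

theorem natCast_cpow_eq_prod {n : ℕ} (hn : Squarefree n) (u : ℂ) :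
    (n : ℂ) ^ u = ∏ p ∈ n.primeFactors, (p : ℂ) ^ u := by
  classical
  have h : ∀ t : Finset ℕ, ((∏ p ∈ t, p : ℕ) : ℂ) ^ u = ∏ p ∈ t, (p : ℂ) ^ u := by
    intro t
    induction t using Finset.induction_on with
    | empty => simp
    | insert p t hp ih =>
      rw [Finset.prod_insert hp, Finset.prod_insert hp, Nat.cast_mul, natCast_mul_natCast_cpow, ih]
  conv_lhs => rw [← Nat.prod_primeFactors_of_squarefree hn]
  exact h _

/-- At p not dividing m, summing over n₂ and then over n₁ gives the local factor (1 - y) - y(1 -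
yx). -/
theorem sum_sum_moebius_mul_prod {q : ℕ} (hq : q ≠ 0) (m : ℕ) (x y : ℕ → ℂ) :
    ∑ n₁ ∈ q.divisors with n₁.Coprime m, ∑ n₂ ∈ q.divisors with n₂.Coprime m,
      ((μ n₁ : ℤ) : ℂ) * ((μ n₂ : ℤ) : ℂ) * ((∏ p ∈ n₁.primeFactors, y p) *
        (∏ p ∈ n₂.primeFactors, y p) * ∏ p ∈ (n₁.gcd n₂).primeFactors, x p) =
      ∏ p ∈ q.primeFactors, if p ∣ m then 1 else 1 - 2 * y p + y p ^ 2 * x p := by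
  have h1 : ∀ n₁ ∈ q.divisors, ∑ n₂ ∈ q.divisors with n₂.Coprime m,
      ((μ n₁ : ℤ) : ℂ) * ((μ n₂ : ℤ) : ℂ) * ((∏ p ∈ n₁.primeFactors, y p) *
        (∏ p ∈ n₂.primeFactors, y p) * ∏ p ∈ (n₁.gcd n₂).primeFactors, x p) =
      ((μ n₁ : ℤ) : ℂ) * ∏ p ∈ q.primeFactors, (if p ∣ n₁ then
        y p * (1 - if p ∣ m then 0 else y p * x p) else 1 - if p ∣ m then 0 else y p) := by
    intro n₁ hn₁
    have hd₁ := Nat.dvd_of_mem_divisors hn₁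
    have h2 := sum_coprime_moebius_mul_prod_ite hq m (fun _ => 1)
      (fun p => y p * if p ∣ n₁ then x p else 1)
    have h3 : ∏ p ∈ q.primeFactors, (if p ∣ n₁ then
        y p * (1 - if p ∣ m then 0 else y p * x p) else 1 - if p ∣ m then 0 else y p) =
        (∏ p ∈ q.primeFactors, if p ∣ n₁ then y p else 1) *
        ∏ p ∈ q.primeFactors, (1 - if p ∣ m then 0 else y p * if p ∣ n₁ then x p else 1) := by
      rw [← Finset.prod_mul_distrib]
      refine Finset.prod_congr rfl fun p _ => ?_
      split_ifs <;> ring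
    rw [h3, ← h2, ← mul_assoc, Finset.mul_sum]
    refine Finset.sum_congr rfl fun n₂ hn₂ => ?_
    have hd₂ := Nat.dvd_of_mem_divisors (Finset.mem_filter.mp hn₂).1
    rw [prod_primeFactors_eq_prod_ite hq hd₁, prod_primeFactors_eq_prod_ite hq hd₂,
      prod_primeFactors_eq_prod_ite hq ((Nat.gcd_dvd_left _ _).trans hd₁)]
    have h4 : (∏ p ∈ q.primeFactors, if p ∣ n₂ then y p else 1) *
        (∏ p ∈ q.primeFactors, if p ∣ n₁.gcd n₂ then x p else 1) =
        ∏ p ∈ q.primeFactors, if p ∣ n₂ then y p * (if p ∣ n₁ then x p else 1) else 1 := by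
      rw [← Finset.prod_mul_distrib]
      refine Finset.prod_congr rfl fun p _ => ?_
      simp only [Nat.dvd_gcd_iff]
      by_cases h5 : p ∣ n₁ <;> by_cases h6 : p ∣ n₂ <;> simp [h5, h6]
    rw [← h4]
    ring
  rw [Finset.sum_congr rfl fun n₁ hn₁ => h1 n₁ (Finset.mem_filter.mp hn₁).1,
    sum_coprime_moebius_mul_prod_ite hq]
  refine Finset.prod_congr rfl fun p _ => ?_
  split_ifs <;> ring

theorem moebius_mul_congr {n : ℕ} {a b : ℂ} (h : Squarefree n → a = b) :
    ((μ n : ℤ) : ℂ) * a = ((μ n : ℤ) : ℂ) * b := by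
  by_cases hn : Squarefree n
  · rw [h hn]
  · rw [ArithmeticFunction.moebius_eq_zero_of_not_squarefree hn]; simp

theorem sum_sum_moebius_mul_gcd_lcm {q : ℕ} (hq : q ≠ 0) (m : ℕ) (u v : ℂ) :
    ∑ n₁ ∈ q.divisors with n₁.Coprime m, ∑ n₂ ∈ q.divisors with n₂.Coprime m,
      ((μ n₁ : ℤ) : ℂ) * ((μ n₂ : ℤ) : ℂ) *
        (((n₁.gcd n₂ : ℕ) : ℂ) ^ u * ((n₁.lcm n₂ : ℕ) : ℂ) ^ v) =
      ∏ p ∈ q.primeFactors, if p ∣ m then 1 else 1 - 2 * (p : ℂ) ^ v + (p : ℂ) ^ (u + v) := by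
  have h := sum_sum_moebius_mul_prod hq m (fun p => (p : ℂ) ^ (u - v)) (fun p => (p : ℂ) ^ v)
  have hR : ∏ p ∈ q.primeFactors, (if p ∣ m then 1 else
      1 - 2 * (p : ℂ) ^ v + ((p : ℂ) ^ v) ^ 2 * (p : ℂ) ^ (u - v)) =
      ∏ p ∈ q.primeFactors, if p ∣ m then 1 else 1 - 2 * (p : ℂ) ^ v + (p : ℂ) ^ (u + v) := by
    refine Finset.prod_congr rfl fun p hp => ?_
    have hp0 : (p : ℂ) ≠ 0 := by exact_mod_cast (Nat.prime_of_mem_primeFactors hp).ne_zero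
    have : ((p : ℂ) ^ v) ^ 2 * (p : ℂ) ^ (u - v) = (p : ℂ) ^ (u + v) := by
      rw [sq, ← cpow_add _ _ hp0, ← cpow_add _ _ hp0]; congr 1; ring
    rw [this]
  rw [← hR, ← h]
  refine Finset.sum_congr rfl fun n₁ hn₁ => Finset.sum_congr rfl fun n₂ hn₂ => ?_
  rw [mul_assoc, mul_assoc]
  refine moebius_mul_congr fun hs₁ => moebius_mul_congr fun hs₂ => ?_
  have hg := hs₁.squarefree_of_dvd (Nat.gcd_dvd_left n₁ n₂)
  rw [← natCast_cpow_eq_prod hs₁, ← natCast_cpow_eq_prod hs₂, ← natCast_cpow_eq_prod hg,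
    ← natCast_mul_natCast_cpow, ← Nat.cast_mul, ← Nat.gcd_mul_lcm, Nat.cast_mul,
    natCast_mul_natCast_cpow]
  have hg0 : ((n₁.gcd n₂ : ℕ) : ℂ) ≠ 0 := by exact_mod_cast hg.ne_zero
  have : ((n₁.gcd n₂ : ℕ) : ℂ) ^ u = ((n₁.gcd n₂ : ℕ) : ℂ) ^ v * ((n₁.gcd n₂ : ℕ) : ℂ) ^ (u - v) := by
    rw [← cpow_add _ _ hg0]; congr 1; ring
  rw [this]
  ring

theorem sum_moebius_mul_cpow {m : ℕ} (hm : m ≠ 0) (z : ℂ) :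
    ∑ e ∈ m.divisors, ((μ e : ℤ) : ℂ) * (e : ℂ) ^ (-z) = ∏ p ∈ m.primeFactors, (1 - (p : ℂ) ^ (-z)) := by
  rw [← sum_moebius_mul_prod_ite hm]
  refine Finset.sum_congr rfl fun e he => moebius_mul_congr fun hs => ?_
  rw [natCast_cpow_eq_prod hs, prod_primeFactors_eq_prod_ite hm (Nat.dvd_of_mem_divisors he)]

theorem sum_moebius_mul_div {m : ℕ} (hm : m ≠ 0) :
    ∑ e ∈ m.divisors, ((μ e : ℤ) : ℂ) * ((m / e : ℕ) : ℂ) = m.totient := by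
  have : NeZero m := ⟨hm⟩
  have h := sum_units_eq_sum_circleSum m fun _ => 1
  simp only [circleSum, Finset.sum_const, nsmul_eq_mul, mul_one, Finset.card_range] at h
  rw [← h, Finset.card_univ, ZMod.card_units_eq_totient]

/-! ### The totient of a complementary divisor -/

theorem mem_primeFactors_div {q n p : ℕ} (hq : q ≠ 0) (hn : n ∣ q) (hs : Squarefree n) :
    p ∈ (q / n).primeFactors ↔ p ∈ q.primeFactors ∧ (p ∣ n → p ^ 2 ∣ q) := by
  obtain ⟨m, rfl⟩ := hn
  have hn0 : n ≠ 0 := left_ne_zero_of_mul hq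
  have hm0 : m ≠ 0 := right_ne_zero_of_mul hq
  rw [Nat.mul_div_cancel_left _ (Nat.pos_of_ne_zero hn0), Nat.mem_primeFactors, Nat.mem_primeFactors]
  constructor
  · rintro ⟨hp, hpm, -⟩
    exact ⟨⟨hp, hpm.mul_left n, hq⟩, fun hpn => by rw [sq]; exact mul_dvd_mul hpn hpm⟩
  · rintro ⟨⟨hp, hpq, -⟩, h⟩
    refine ⟨hp, ?_, hm0⟩
    by_contra hpm
    have hpn : p ∣ n := ((hp.dvd_mul).mp hpq).resolve_right hpm
    have h2 := h hpn
    have hcop : (p ^ 2).Coprime m := Nat.Coprime.pow_left 2 ((hp.coprime_iff_not_dvd).mpr hpm)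
    have h3 : p * p ∣ n := by rw [← sq]; exact hcop.dvd_of_dvd_mul_right h2
    exact hp.one_lt.ne' (Nat.isUnit_iff.mp (hs p h3))

/-- The factor by which the totient changes on removing one prime. -/
noncomputable def totientRatio (q p : ℕ) : ℂ :=
  if p ^ 2 ∣ q then (p : ℂ)⁻¹ else ((p : ℂ) - 1)⁻¹

theorem totient_div_eq {q n : ℕ} (hq : q ≠ 0) (hn : n ∣ q) (hs : Squarefree n) :
    ((q / n).totient : ℂ) = q.totient * ∏ p ∈ n.primeFactors, totientRatio q p := by
  have key : ∀ k : ℕ, (k.totient : ℂ) = k * ∏ p ∈ k.primeFactors, (1 - (p : ℂ)⁻¹) := fun k => by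
    have := Nat.totient_eq_mul_prod_factors k
    have := congrArg (fun r : ℚ => (r : ℂ)) this
    push_cast at this
    exact this
  have hn0 : n ≠ 0 := fun h => hq (Nat.eq_zero_of_zero_dvd (h ▸ hn))
  have h1 : ((q / n : ℕ) : ℂ) = q * ∏ p ∈ q.primeFactors, if p ∣ n then (p : ℂ)⁻¹ else 1 := by
    rw [← prod_primeFactors_eq_prod_ite hq hn, Nat.cast_div hn (by exact_mod_cast hn0),
      div_eq_mul_inv, Finset.prod_inv_distrib]
    congr 2
    conv_lhs => rw [← Nat.prod_primeFactors_of_squarefree hs]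
    push_cast
    rfl
  have h2 : ∏ p ∈ (q / n).primeFactors, (1 - (p : ℂ)⁻¹) =
      ∏ p ∈ q.primeFactors, if p ∣ n → p ^ 2 ∣ q then 1 - (p : ℂ)⁻¹ else 1 := by
    classical
    rw [← Finset.prod_filter]
    refine Finset.prod_congr ?_ fun _ _ => rfl
    ext p
    rw [mem_primeFactors_div hq hn hs, Finset.mem_filter]
  rw [key, key q, h1, h2, prod_primeFactors_eq_prod_ite hq hn, mul_assoc, mul_assoc,
    ← Finset.prod_mul_distrib, ← Finset.prod_mul_distrib]
  congr 1
  refine Finset.prod_congr rfl fun p hp => ?_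
  have hp1 := (Nat.prime_of_mem_primeFactors hp).one_lt
  have hp0 : (p : ℂ) ≠ 0 := by exact_mod_cast (by omega : p ≠ 0)
  have hp2 : (p : ℂ) - 1 ≠ 0 := sub_ne_zero.mpr (by exact_mod_cast (by omega : p ≠ 1))
  rw [totientRatio]
  by_cases h3 : p ∣ n <;> by_cases h4 : p ^ 2 ∣ q <;> simp [h3, h4]
  · ring
  · field_simp

end DirichletMeanSquare

namespace DirichletMeanSquare

open Complex HurwitzZeta Filter Topology MeasureTheory
open scoped ArithmeticFunction.Moebius

/-! ### Averages over levels -/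

/-- The average over the divisors `m` of `q` of a function of two divisors `n₁`, `n₂` of `q`
coprime to `m` and of a divisor of `m`, as it occurs in the mean square. -/
noncomputable def levelAvg (q : ℕ) (z : ℂ) (F : ℕ → ℕ → ℕ → ℂ) : ℂ :=
  ∑ m ∈ q.divisors, ((μ (q / m) : ℤ) : ℂ) * ((m.totient : ℂ) * (m : ℂ) ^ (-z) *
    ∑ n₁ ∈ q.divisors with n₁.Coprime m, ∑ n₂ ∈ q.divisors with n₂.Coprime m,
      ((μ n₁ : ℤ) : ℂ) * ((μ n₂ : ℤ) : ℂ) * ∑ e ∈ m.divisors, ((μ e : ℤ) : ℂ) * F n₁ n₂ (m / e))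

theorem levelAvg_add (q : ℕ) (z : ℂ) (F G : ℕ → ℕ → ℕ → ℂ) :
    levelAvg q z (fun n₁ n₂ k => F n₁ n₂ k + G n₁ n₂ k) = levelAvg q z F + levelAvg q z G := by
  simp only [levelAvg, mul_add, Finset.sum_add_distrib]

theorem levelAvg_const_mul (q : ℕ) (z c : ℂ) (F : ℕ → ℕ → ℕ → ℂ) :
    levelAvg q z (fun n₁ n₂ k => c * F n₁ n₂ k) = c * levelAvg q z F := by
  simp only [levelAvg, Finset.mul_sum]
  refine Finset.sum_congr rfl fun _ _ => Finset.sum_congr rfl fun _ _ =>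
    Finset.sum_congr rfl fun _ _ => Finset.sum_congr rfl fun _ _ => ?_
  ring

theorem levelAvg_swap (q : ℕ) (z : ℂ) (F : ℕ → ℕ → ℕ → ℂ) :
    levelAvg q z (fun n₁ n₂ k => F n₂ n₁ k) = levelAvg q z F := by
  simp only [levelAvg]
  refine Finset.sum_congr rfl fun m _ => ?_
  congr 2
  rw [Finset.sum_comm]
  refine Finset.sum_congr rfl fun _ _ => Finset.sum_congr rfl fun _ _ => ?_
  ring

theorem levelAvg_congr {q : ℕ} (z : ℂ) {F G : ℕ → ℕ → ℕ → ℂ}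
    (h : ∀ n₁ n₂ k, n₁ ∣ q → n₂ ∣ q → k ∣ q → n₁.Coprime k → n₂.Coprime k →
      F n₁ n₂ k = G n₁ n₂ k) :
    levelAvg q z F = levelAvg q z G := by
  simp only [levelAvg]
  refine Finset.sum_congr rfl fun m hm => ?_
  congr 2
  refine Finset.sum_congr rfl fun n₁ hn₁ => Finset.sum_congr rfl fun n₂ hn₂ => ?_
  congr 1
  refine Finset.sum_congr rfl fun e he => ?_
  rw [Finset.mem_filter] at hn₁ hn₂
  have hd : m / e ∣ m := Nat.div_dvd_of_dvd (Nat.dvd_of_mem_divisors he)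
  rw [h n₁ n₂ (m / e) (Nat.dvd_of_mem_divisors hn₁.1) (Nat.dvd_of_mem_divisors hn₂.1)
    (hd.trans (Nat.dvd_of_mem_divisors hm)) (hn₁.2.coprime_dvd_right hd)
    (hn₂.2.coprime_dvd_right hd)]

theorem norm_moebius_le_one (n : ℕ) : ‖((μ n : ℤ) : ℂ)‖ ≤ 1 := by
  rw [Complex.norm_intCast]
  exact_mod_cast ArithmeticFunction.abs_moebius_le_one

theorem norm_levelAvg_le {q : ℕ} (hq : q ≠ 0) {z : ℂ} {A B : ℝ} (hA : 0 ≤ A) (hB : 0 ≤ B)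
    {F : ℕ → ℕ → ℕ → ℂ} (hz : ∀ m, m ∣ q → ‖(m.totient : ℂ) * (m : ℂ) ^ (-z)‖ ≤ A)
    (h : ∀ n₁ n₂ k, n₁ ∣ q → n₂ ∣ q → k ∣ q → n₁.Coprime k → n₂.Coprime k → ‖F n₁ n₂ k‖ ≤ B) :
    ‖levelAvg q z F‖ ≤ (q.divisors.card : ℝ) ^ 4 * (A * B) := by
  set T : ℝ := (q.divisors.card : ℝ)
  have hT : 0 ≤ T := Nat.cast_nonneg _
  have key : ∀ {s : Finset ℕ} {f : ℕ → ℂ} {b : ℝ}, 0 ≤ b → s.card ≤ q.divisors.card →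
      (∀ x ∈ s, ‖f x‖ ≤ b) → ‖∑ x ∈ s, f x‖ ≤ T * b := by
    intro s f b hb hs hf
    refine (norm_sum_le_of_le s hf).trans ?_
    rw [Finset.sum_const, nsmul_eq_mul]
    exact mul_le_mul_of_nonneg_right (Nat.cast_le.mpr hs) hb
  have e : T ^ 4 * (A * B) = T * (1 * (A * (T * (T * (1 * 1 * (T * (1 * B))))))) := by ring
  rw [levelAvg, e]
  refine key (by positivity) le_rfl fun m hm => ?_
  have hmq := Nat.dvd_of_mem_divisors hm
  rw [norm_mul, norm_mul]
  refine mul_le_mul (norm_moebius_le_one _) (mul_le_mul (hz m hmq) ?_ (norm_nonneg _) hA)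
    (by positivity) zero_le_one
  refine key (by positivity) (Finset.card_filter_le _ _) fun n₁ hn₁ => ?_
  refine key (by positivity) (Finset.card_filter_le _ _) fun n₂ hn₂ => ?_
  rw [norm_mul, norm_mul]
  refine mul_le_mul (mul_le_mul (norm_moebius_le_one _) (norm_moebius_le_one _) (norm_nonneg _)
    zero_le_one) ?_ (norm_nonneg _) (by norm_num)
  refine key (by positivity) (Finset.card_le_card (Nat.divisors_subset_of_dvd hq hmq)) fun d hd => ?_
  rw [norm_mul]
  rw [Finset.mem_filter] at hn₁ hn₂
  have hd' : m / d ∣ m := Nat.div_dvd_of_dvd (Nat.dvd_of_mem_divisors hd)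
  exact mul_le_mul (norm_moebius_le_one _) (h n₁ n₂ (m / d) (Nat.dvd_of_mem_divisors hn₁.1)
    (Nat.dvd_of_mem_divisors hn₂.1) (hd'.trans hmq) (hn₁.2.coprime_dvd_right hd')
    (hn₂.2.coprime_dvd_right hd')) (norm_nonneg _) zero_le_one

theorem evenMeanSquare_eq_levelAvg {q : ℕ} [NeZero q] {α β : ℂ} (hα : 1 / 2 + α ≠ 1)
    (hβ : 1 / 2 + β ≠ 1) :
    evenMeanSquare q α β = levelAvg q (1 / 2 + α + (1 / 2 + β)) fun n₁ n₂ k =>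
      (n₁ : ℂ) ^ (-(1 / 2 + α)) * (n₂ : ℂ) ^ (-(1 / 2 + β)) *
        ded (1 / 2 + α) (1 / 2 + β) n₁ n₂ k := by
  rw [evenMeanSquare_eq hα hβ, levelAvg]
  refine Finset.sum_congr rfl fun m _ => ?_
  rw [levelSum]
  congr 2
  refine Finset.sum_congr rfl fun _ _ => Finset.sum_congr rfl fun _ _ => ?_
  rw [Finset.mul_sum, Finset.mul_sum]
  refine Finset.sum_congr rfl fun _ _ => ?_
  ring

theorem levelAvg_mul (q : ℕ) (z : ℂ) (A : ℕ → ℕ → ℂ) (B : ℕ → ℂ) :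
    levelAvg q z (fun n₁ n₂ k => A n₁ n₂ * B k) =
      ∑ m ∈ q.divisors, ((μ (q / m) : ℤ) : ℂ) * ((m.totient : ℂ) * (m : ℂ) ^ (-z) *
        ((∑ n₁ ∈ q.divisors with n₁.Coprime m, ∑ n₂ ∈ q.divisors with n₂.Coprime m,
          ((μ n₁ : ℤ) : ℂ) * ((μ n₂ : ℤ) : ℂ) * A n₁ n₂) *
          ∑ e ∈ m.divisors, ((μ e : ℤ) : ℂ) * B (m / e))) := by
  refine Finset.sum_congr rfl fun m _ => ?_
  congr 2
  rw [Finset.sum_mul]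
  refine Finset.sum_congr rfl fun n₁ _ => ?_
  rw [Finset.sum_mul]
  refine Finset.sum_congr rfl fun n₂ _ => ?_
  rw [mul_assoc, Finset.mul_sum, Finset.mul_sum, Finset.mul_sum]
  refine Finset.sum_congr rfl fun e _ => ?_
  ring

theorem natCast_div_cpow {m e : ℕ} (he : e ∣ m) (he0 : e ≠ 0) (u : ℂ) :
    ((m / e : ℕ) : ℂ) ^ u = (m : ℂ) ^ u * (e : ℂ) ^ (-u) := by
  obtain ⟨k, rfl⟩ := he
  have h : ((e : ℕ) : ℂ) ≠ 0 := by exact_mod_cast he0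
  rw [Nat.mul_div_cancel_left _ (Nat.pos_of_ne_zero he0), Nat.cast_mul, natCast_mul_natCast_cpow,
    mul_right_comm, ← cpow_add _ _ h]
  simp

/-- The average of the diagonal terms of the reciprocity formula. -/
theorem levelAvg_diag (q : ℕ) [NeZero q] (z : ℂ) :
    levelAvg q z (fun n₁ n₂ k => ((n₁.lcm n₂ : ℕ) : ℂ) ^ (-z) * (k : ℂ) ^ z) =
      phiStar q * ∏ p ∈ q.primeFactors, (1 - (p : ℂ) ^ (-z)) := by
  have hq := NeZero.ne q
  rw [levelAvg_mul, phiStar_eq, Finset.sum_mul]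
  refine Finset.sum_congr rfl fun m hm => ?_
  have hmq := Nat.dvd_of_mem_divisors hm
  have hm0 : m ≠ 0 := fun h => hq (Nat.eq_zero_of_zero_dvd (h ▸ hmq))
  have h1 := sum_sum_moebius_mul_gcd_lcm hq m 0 (-z)
  simp only [cpow_zero, one_mul] at h1
  have h2 : ∑ e ∈ m.divisors, ((μ e : ℤ) : ℂ) * ((m / e : ℕ) : ℂ) ^ z =
      (m : ℂ) ^ z * ∏ p ∈ q.primeFactors, if p ∣ m then 1 - (p : ℂ) ^ (-z) else 1 := by
    rw [← prod_primeFactors_eq_prod_ite hq hmq, ← sum_moebius_mul_cpow hm0, Finset.mul_sum]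
    refine Finset.sum_congr rfl fun e he => ?_
    rw [natCast_div_cpow (Nat.dvd_of_mem_divisors he) (Nat.pos_of_mem_divisors he).ne']
    ring
  -- Primes dividing m get 1 - p^(-z) from the sum over e, the others from the sums over n₁, n₂. The
  -- product is therefore independent of m, and the outer sum over m is left to form `phiStar`.
  have h3 : (∏ p ∈ q.primeFactors, if p ∣ m then 1 else
      1 - 2 * (p : ℂ) ^ (-z) + (p : ℂ) ^ (0 + -z)) *
      (∏ p ∈ q.primeFactors, if p ∣ m then 1 - (p : ℂ) ^ (-z) else 1) =
      ∏ p ∈ q.primeFactors, (1 - (p : ℂ) ^ (-z)) := by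
    rw [← Finset.prod_mul_distrib]
    refine Finset.prod_congr rfl fun p _ => ?_
    split_ifs <;> ring_nf
  have h4 : (m : ℂ) ^ (-z) * (m : ℂ) ^ z = 1 := by
    rw [← cpow_add _ _ (by exact_mod_cast hm0)]; simp
  rw [h1, h2, mul_left_comm _ ((m : ℂ) ^ z), h3]
  linear_combination (((μ (q / m) : ℤ) : ℂ) * m.totient * ∏ p ∈ q.primeFactors, (1 - (p : ℂ) ^ (-z))) * h4

theorem phiStar_eq_prod (q : ℕ) [NeZero q] :
    (phiStar q : ℂ) = q.totient * ∏ p ∈ q.primeFactors, (1 - totientRatio q p) := by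
  have hq := NeZero.ne q
  rw [phiStar_eq, ← Nat.sum_div_divisors q, ← sum_moebius_mul_prod_ite hq, Finset.mul_sum]
  refine Finset.sum_congr rfl fun n hn => ?_
  have hnq := Nat.dvd_of_mem_divisors hn
  rw [Nat.div_div_self hnq hq, mul_left_comm]
  refine moebius_mul_congr fun hs => ?_
  rw [totient_div_eq hq hnq hs, prod_primeFactors_eq_prod_ite hq hnq]

/-- The average of the integral terms of the reciprocity formula. -/
theorem levelAvg_int (q : ℕ) [NeZero q] (z : ℂ) :
    levelAvg q z (fun n₁ n₂ k =>
        ((n₁.gcd n₂ : ℕ) : ℂ) ^ (1 - z) * ((n₁.lcm n₂ : ℕ) : ℂ) ^ (-1 : ℂ) * (k : ℂ)) =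
      phiStar q * ((q : ℂ) ^ (1 - z) * ∏ p ∈ q.primeFactors, (1 - (p : ℂ) ^ (z - 2))) := by
  have hq := NeZero.ne q
  have hqc : (q : ℂ) ≠ 0 := by exact_mod_cast hq
  have hprime : ∀ {p}, p ∈ q.primeFactors → p.Prime := Nat.prime_of_mem_primeFactors
  rw [levelAvg_mul, ← Nat.sum_div_divisors q]
  have h1 : ∀ n ∈ q.divisors, ((μ (q / (q / n)) : ℤ) : ℂ) * (((q / n).totient : ℂ) *
      ((q / n : ℕ) : ℂ) ^ (-z) *
        ((∑ n₁ ∈ q.divisors with n₁.Coprime (q / n), ∑ n₂ ∈ q.divisors with n₂.Coprime (q / n),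
          ((μ n₁ : ℤ) : ℂ) * ((μ n₂ : ℤ) : ℂ) *
            (((n₁.gcd n₂ : ℕ) : ℂ) ^ (1 - z) * ((n₁.lcm n₂ : ℕ) : ℂ) ^ (-1 : ℂ))) *
          ∑ e ∈ (q / n).divisors, ((μ e : ℤ) : ℂ) * ((q / n / e : ℕ) : ℂ))) =
      (q.totient : ℂ) ^ 2 * (q : ℂ) ^ (-z) * (((μ n : ℤ) : ℂ) * ∏ p ∈ q.primeFactors, if p ∣ n then
        totientRatio q p ^ 2 * (p : ℂ) ^ z * (if p ^ 2 ∣ q then 1 else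
          1 - 2 * (p : ℂ) ^ (-1 : ℂ) + (p : ℂ) ^ (-z)) else 1) := by
    intro n hn
    have hnq := Nat.dvd_of_mem_divisors hn
    have hn0 := (Nat.pos_of_mem_divisors hn).ne'
    have hd0 : q / n ≠ 0 := (Nat.div_pos (Nat.le_of_dvd (Nat.pos_of_ne_zero hq) hnq)
      (Nat.pos_of_ne_zero hn0)).ne'
    rw [Nat.div_div_self hnq hq, mul_left_comm _ (((μ n : ℤ) : ℂ))]
    refine moebius_mul_congr fun hs => ?_
    rw [sum_sum_moebius_mul_gcd_lcm hq, sum_moebius_mul_div hd0, totient_div_eq hq hnq hs,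
      natCast_div_cpow hnq hn0, neg_neg, natCast_cpow_eq_prod hs,
      prod_primeFactors_eq_prod_ite hq hnq, prod_primeFactors_eq_prod_ite hq hnq]
    have h2 : (∏ p ∈ q.primeFactors, if p ∣ n then
        totientRatio q p ^ 2 * (p : ℂ) ^ z * (if p ^ 2 ∣ q then 1 else
          1 - 2 * (p : ℂ) ^ (-1 : ℂ) + (p : ℂ) ^ (-z)) else 1) =
        (∏ p ∈ q.primeFactors, if p ∣ n then totientRatio q p else 1) *
        (∏ p ∈ q.primeFactors, if p ∣ n then totientRatio q p else 1) *
        (∏ p ∈ q.primeFactors, if p ∣ n then (p : ℂ) ^ z else 1) *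
        ∏ p ∈ q.primeFactors, if p ∣ q / n then 1 else
          1 - 2 * (p : ℂ) ^ (-1 : ℂ) + (p : ℂ) ^ (1 - z + -1) := by
      rw [← Finset.prod_mul_distrib, ← Finset.prod_mul_distrib, ← Finset.prod_mul_distrib]
      refine Finset.prod_congr rfl fun p hp => ?_
      have h3 : p ∣ q / n ↔ (p ∣ n → p ^ 2 ∣ q) := by
        have := mem_primeFactors_div (p := p) hq hnq hs
        rw [Nat.mem_primeFactors] at this
        have hp' := hprime hp
        tauto
      have e : (1 - z + -1 : ℂ) = -z := by ring
      simp only [h3, e]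
      by_cases h5 : p ∣ n <;> simp [h5, sq]
    rw [h2]
    ring
  rw [Finset.sum_congr rfl h1, ← Finset.mul_sum, sum_moebius_mul_prod_ite hq, phiStar_eq_prod]
  have h7 : (q.totient : ℂ) = q * ∏ p ∈ q.primeFactors, (1 - (p : ℂ)⁻¹) := by
    have := congrArg (fun r : ℚ => (r : ℂ)) (Nat.totient_eq_mul_prod_factors q)
    push_cast at this
    exact this
  -- A local identity in two cases. If p² ∣ q, removing p leaves p in m and both sides match at
  -- once; if p divides q exactly once, both equal (p - 2)/(p - 1) · (1 - p^(z - 2)).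
  have h8 : (∏ p ∈ q.primeFactors, (1 - (p : ℂ)⁻¹)) * (∏ p ∈ q.primeFactors, (1 -
        totientRatio q p ^ 2 * (p : ℂ) ^ z * (if p ^ 2 ∣ q then 1 else
          1 - 2 * (p : ℂ) ^ (-1 : ℂ) + (p : ℂ) ^ (-z)))) =
      (∏ p ∈ q.primeFactors, (1 - totientRatio q p)) *
        ∏ p ∈ q.primeFactors, (1 - (p : ℂ) ^ (z - 2)) := by
    rw [← Finset.prod_mul_distrib, ← Finset.prod_mul_distrib]
    refine Finset.prod_congr rfl fun p hp => ?_
    have hp1 := (hprime hp).one_lt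
    have hp0 : (p : ℂ) ≠ 0 := by exact_mod_cast (by omega : p ≠ 0)
    have hp2 : (p : ℂ) - 1 ≠ 0 := sub_ne_zero.mpr (by exact_mod_cast (by omega : p ≠ 1))
    have e1 : (p : ℂ) ^ (z - 2) = (p : ℂ) ^ z / (p : ℂ) ^ 2 := by
      rw [cpow_sub _ _ hp0]; norm_num
    have e2 : (p : ℂ) ^ (-z) = ((p : ℂ) ^ z)⁻¹ := cpow_neg _ _
    have e3 : (p : ℂ) ^ z ≠ 0 := by simp [cpow_eq_zero_iff, hp0]
    rw [totientRatio, e1, e2, cpow_neg_one]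
    split_ifs
    · field_simp
    · field_simp
      ring
  have h9 : (q : ℂ) ^ (1 - z) = q * (q : ℂ) ^ (-z) := by
    rw [sub_eq_add_neg, cpow_add _ _ hqc, cpow_one]
  rw [h9]
  linear_combination (q.totient : ℂ) * (q : ℂ) ^ (-z) * (∏ p ∈ q.primeFactors, (1 -
        totientRatio q p ^ 2 * (p : ℂ) ^ z * (if p ^ 2 ∣ q then 1 else
          1 - 2 * (p : ℂ) ^ (-1 : ℂ) + (p : ℂ) ^ (-z)))) * h7 + q.totient * (q : ℂ) ^ (-z) * q * h8

theorem xPlus_eq {q : ℕ} (hq : q ≠ 0) (α β : ℂ) :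
    xPlus q α β = (q : ℂ) ^ (-(α + β)) * gammaFactor (1 / 2 + α) * gammaFactor (1 / 2 + β) := by
  have hqc : (q : ℂ) ≠ 0 := by exact_mod_cast hq
  have hx : ((q : ℂ) / (2 * (Real.pi : ℂ))) ≠ 0 :=
    div_ne_zero hqc (mul_ne_zero two_ne_zero (by exact_mod_cast Real.pi_ne_zero))
  have h1 := gammaCos_mul_cpow hq α
  have h2 := gammaCos_mul_cpow hq β
  have e1 : ((q : ℂ) / (2 * (Real.pi : ℂ))) ^ (1 - α - β) =
      ((q : ℂ) / (2 * (Real.pi : ℂ))) ^ (1 / 2 - α) * ((q : ℂ) / (2 * (Real.pi : ℂ))) ^ (1 / 2 - β) := by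
    rw [← cpow_add _ _ hx]; congr 1; ring
  have e2 : (q : ℂ) ^ (-(α + β)) = q * ((q : ℂ) ^ (-(1 / 2 + α)) * (q : ℂ) ^ (-(1 / 2 + β))) := by
    rw [← cpow_add _ _ hqc]
    nth_rewrite 2 [← cpow_one (q : ℂ)]
    rw [← cpow_add _ _ hqc]; congr 1; ring
  have h3 : (q : ℂ) ^ (-(α + β)) * gammaFactor (1 / 2 + α) * gammaFactor (1 / 2 + β) =
      q * ((q : ℂ) ^ (-(1 / 2 + α)) * gammaFactor (1 / 2 + α)) *
        ((q : ℂ) ^ (-(1 / 2 + β)) * gammaFactor (1 / 2 + β)) := by rw [e2]; ring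
  rw [h3, ← h1, ← h2, xPlus, e1]
  field_simp
  ring

/-- The diagonal and the integral terms together make up the main term. -/
theorem mainTerm_eq {q : ℕ} [NeZero q] {δ : ℝ} (hδ0 : 0 ≤ δ) (hδ : δ < 1 / 2) {α β : ℂ}
    (hα : ‖α‖ ≤ δ) (hβ : ‖β‖ ≤ δ) (hne : α + β ≠ 0) :
    mainTerm q α β = levelAvg q (1 / 2 + α + (1 / 2 + β)) (fun n₁ n₂ k =>
        riemannZeta (1 / 2 + α + (1 / 2 + β)) / 2 *
          (((n₁.lcm n₂ : ℕ) : ℂ) ^ (-(1 / 2 + α + (1 / 2 + β))) *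
            (k : ℂ) ^ (1 / 2 + α + (1 / 2 + β))) +
        kernelMean (1 / 2 + α) (1 / 2 + β) *
          (((n₁.gcd n₂ : ℕ) : ℂ) ^ (1 - (1 / 2 + α + (1 / 2 + β))) *
            ((n₁.lcm n₂ : ℕ) : ℂ) ^ (-1 : ℂ) * (k : ℂ))) := by
  have hz : (1 / 2 + α + (1 / 2 + β)) ≠ 1 := fun h => hne (by linear_combination h)
  rw [levelAvg_add, levelAvg_const_mul, levelAvg_const_mul, levelAvg_diag, levelAvg_int,
    kernelMean_eq hδ0 hδ (by simpa using hα) (by simpa using hβ) hz, mainTerm, zetaCoprime,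
    zetaCoprime, xPlus_eq (NeZero.ne q)]
  have e1 : (1 / 2 + α + (1 / 2 + β)) = 1 + α + β := by ring
  have e2 : 1 - (1 + α + β) = -(α + β) := by ring
  have e3 : 2 - (1 + α + β) = 1 - α - β := by ring
  have e4 : 1 + α + β - 2 = -(1 - α - β) := by ring
  rw [e1, e2, e3, e4]
  ring

end DirichletMeanSquare

namespace DirichletMeanSquare

open Complex HurwitzZeta Filter Topology MeasureTheory
open scoped ArithmeticFunction.Moebius

/-! ### The reciprocal terms and the dual sums -/

theorem moebius_mul_cast {a b : ℕ} (h : a.Coprime b) :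
    ((μ (a * b) : ℤ) : ℂ) = ((μ a : ℤ) : ℂ) * ((μ b : ℤ) : ℂ) := by
  rw [ArithmeticFunction.isMultiplicative_moebius.map_mul_of_coprime h]
  push_cast
  rfl

/-- A squarefree divisor n of q factors uniquely as gcd(n, m) times a part prime to m. Products en
that are not squarefree contribute 0 because μ(e) μ(n) = μ(en). -/
theorem sum_moebius_split {q m : ℕ} (hq : q ≠ 0) (hm : m ∣ q) (G : ℕ → ℂ) :
    ∑ n ∈ q.divisors with n.Coprime m, ∑ e ∈ m.divisors,
      ((μ n : ℤ) : ℂ) * ((μ e : ℤ) : ℂ) * G (e * n) = ∑ n ∈ q.divisors, ((μ n : ℤ) : ℂ) * G n := by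
  have hm0 : m ≠ 0 := fun h => hq (Nat.eq_zero_of_zero_dvd (h ▸ hm))
  have h1 : ∑ n ∈ q.divisors, ((μ n : ℤ) : ℂ) * G n =
      ∑ n ∈ q.divisors with Squarefree n, ((μ n : ℤ) : ℂ) * G n := by
    symm
    refine Finset.sum_filter_of_ne fun n _ h => ?_
    by_contra hs
    rw [ArithmeticFunction.moebius_eq_zero_of_not_squarefree hs] at h
    simp at h
  have h2 : ∑ n ∈ q.divisors with n.Coprime m, ∑ e ∈ m.divisors,
      ((μ n : ℤ) : ℂ) * ((μ e : ℤ) : ℂ) * G (e * n) =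
      ∑ x ∈ (q.divisors.filter fun n => n.Coprime m) ×ˢ m.divisors with Squarefree (x.2 * x.1),
        ((μ x.1 : ℤ) : ℂ) * ((μ x.2 : ℤ) : ℂ) * G (x.2 * x.1) := by
    rw [← Finset.sum_product']
    symm
    refine Finset.sum_filter_of_ne fun x hx h => ?_
    rw [Finset.mem_product, Finset.mem_filter] at hx
    have hc : x.2.Coprime x.1 :=
      (hx.1.2.coprime_dvd_right (Nat.dvd_of_mem_divisors hx.2)).symm
    by_contra hs
    have h0 := moebius_mul_cast hc
    rw [ArithmeticFunction.moebius_eq_zero_of_not_squarefree hs, Int.cast_zero, mul_comm] at h0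
    rw [← h0] at h
    simp at h
  rw [h1, h2]
  refine Finset.sum_bij' (fun x _ => x.2 * x.1) (fun n _ => (n / n.gcd m, n.gcd m)) ?_ ?_ ?_ ?_ ?_
  · rintro ⟨n, e⟩ hx
    simp only [Finset.mem_filter, Finset.mem_product, Nat.mem_divisors] at hx ⊢
    obtain ⟨⟨⟨⟨hn, -⟩, hc⟩, he, -⟩, hs⟩ := hx
    exact ⟨⟨(hc.coprime_dvd_right he).symm.mul_dvd_of_dvd_of_dvd (he.trans hm) hn, hq⟩, hs⟩
  · intro n hn
    simp only [Finset.mem_filter, Finset.mem_product, Nat.mem_divisors] at hn ⊢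
    obtain ⟨⟨hn, -⟩, hs⟩ := hn
    have hg := Nat.gcd_dvd_left n m
    refine ⟨⟨⟨⟨(Nat.div_dvd_of_dvd hg).trans hn, hq⟩, ?_⟩, Nat.gcd_dvd_right n m, hm0⟩, ?_⟩
    · exact Nat.coprime_div_gcd_of_squarefree hs hm0
    · rwa [Nat.mul_div_cancel' hg]
  · rintro ⟨n, e⟩ hx
    simp only [Finset.mem_filter, Finset.mem_product, Nat.mem_divisors] at hx
    obtain ⟨⟨⟨⟨hn, -⟩, hc⟩, he, -⟩, hs⟩ := hx
    have he0 : 0 < e := Nat.pos_of_dvd_of_pos he (Nat.pos_of_ne_zero hm0)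
    have hg : (e * n).gcd m = e := by
      rw [Nat.Coprime.gcd_mul_right_cancel e hc, Nat.gcd_eq_left he]
    simp only [hg, Nat.mul_div_cancel_left _ he0]
  · intro n hn
    exact Nat.mul_div_cancel' (Nat.gcd_dvd_left n m)
  · rintro ⟨n, e⟩ hx
    simp only [Finset.mem_filter, Finset.mem_product, Nat.mem_divisors] at hx
    rw [moebius_mul_cast (hx.1.1.2.coprime_dvd_right hx.1.2.1).symm, mul_comm ((μ e : ℤ) : ℂ)]

theorem sum_moebius_mul_divisors {c d : ℕ} (hc : c ≠ 0) (hd : d ≠ 0) (h : c.Coprime d) (G : ℕ → ℂ) :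
    ∑ n ∈ (c * d).divisors, ((μ n : ℤ) : ℂ) * G n =
      ∑ t ∈ c.divisors, ∑ f ∈ d.divisors, ((μ t : ℤ) : ℂ) * ((μ f : ℤ) : ℂ) * G (f * t) := by
  rw [← sum_moebius_split (mul_ne_zero hc hd) (dvd_mul_left d c)]
  refine Finset.sum_congr ?_ fun _ _ => rfl
  ext n
  rw [Finset.mem_filter, Nat.mem_divisors, Nat.mem_divisors]
  exact ⟨fun h1 => ⟨h1.2.dvd_of_dvd_mul_right h1.1.1, hc⟩,
    fun h1 => ⟨⟨h1.1.mul_right d, mul_ne_zero hc hd⟩, h.coprime_dvd_left h1.1⟩⟩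

/-- With g = gcd(x, m) and x = gy, the condition forces the first factor t to divide y. Then φ((y/t)
g m) = φ(y/t) g φ(m), and ∑_{t ∣ y} φ(y/t) = y. -/
theorem sum_totient_mul_of_squarefree {x m : ℕ} (hx : Squarefree x) :
    ∑ p ∈ x.divisorsAntidiagonal with p.1.Coprime m, (p.2 * m).totient = x * m.totient := by
  have hx0 := hx.ne_zero
  set g := x.gcd m with hg
  have hg0 : 0 < g := Nat.gcd_pos_of_pos_left _ (Nat.pos_of_ne_zero hx0)
  obtain ⟨y, hy⟩ : g ∣ x := Nat.gcd_dvd_left x m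
  have hgm : g ∣ m := Nat.gcd_dvd_right x m
  have hsq : Squarefree (g * y) := hy ▸ hx
  have hgy : g.Coprime y := (Nat.squarefree_mul_iff.mp hsq).1
  have hy0 : y ≠ 0 := fun h => hx0 (by rw [hy, h, mul_zero])
  have hym : y.Coprime m := by
    have h1 : (y.gcd m) ∣ g := Nat.dvd_gcd ((Nat.gcd_dvd_left y m).trans ⟨g, by rw [hy, mul_comm]⟩)
      (Nat.gcd_dvd_right y m)
    exact Nat.eq_one_of_dvd_coprimes hgy h1 (Nat.gcd_dvd_left y m)
  have htot : (g * m).totient = g * m.totient := by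
    have h1 := Nat.totient_gcd_mul_totient_mul g m
    rw [Nat.gcd_eq_left hgm, mul_assoc, mul_comm m.totient] at h1
    exact Nat.eq_of_mul_eq_mul_left (Nat.totient_pos.mpr hg0) h1
  have h2 : ∑ p ∈ x.divisorsAntidiagonal with p.1.Coprime m, (p.2 * m).totient =
      ∑ t ∈ y.divisors, (y / t).totient * (g * m.totient) := by
    rw [Finset.sum_filter, Nat.sum_divisorsAntidiagonal
      (f := fun a b => if a.Coprime m then (b * m).totient else 0), ← Finset.sum_filter]
    have hset : (x.divisors.filter fun t => t.Coprime m) = y.divisors := by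
      ext t
      rw [Finset.mem_filter, Nat.mem_divisors, Nat.mem_divisors]
      constructor
      · rintro ⟨⟨h1, -⟩, h3⟩
        exact ⟨(h3.coprime_dvd_right hgm).dvd_of_dvd_mul_left (hy ▸ h1), hy0⟩
      · rintro ⟨h1, -⟩
        exact ⟨⟨hy ▸ h1.mul_left g, hx0⟩, hym.coprime_dvd_left h1⟩
    rw [hset]
    refine Finset.sum_congr rfl fun t ht => ?_
    have hty := Nat.dvd_of_mem_divisors ht
    have hd : y / t ∣ y := Nat.div_dvd_of_dvd hty
    rw [hy, Nat.mul_div_assoc _ hty, mul_comm g, mul_assoc, Nat.totient_mul, htot]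
    exact ((hgy.symm.mul_right hym)).coprime_dvd_left hd
  rw [h2, ← Finset.sum_mul, Nat.sum_div_divisors y Nat.totient, Nat.sum_totient, hy]
  ring

/-- Regrouping q = (tn)(fm) as q = ym, y = nx, x = tf, which brings t and f together so that they
can be summed first. -/
theorem sum_divisorsAntidiagonal_four (q : ℕ) (F : ℕ → ℕ → ℕ → ℕ → ℂ) :
    ∑ p ∈ q.divisorsAntidiagonal, ∑ a ∈ p.1.divisorsAntidiagonal, ∑ b ∈ p.2.divisorsAntidiagonal,
        F a.1 a.2 b.1 b.2 =
      ∑ p ∈ q.divisorsAntidiagonal, ∑ a ∈ p.1.divisorsAntidiagonal,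
        ∑ b ∈ a.2.divisorsAntidiagonal, F b.1 a.1 b.2 p.2 := by
  rw [Finset.sum_sigma', Finset.sum_sigma', Finset.sum_sigma', Finset.sum_sigma']
  refine Finset.sum_nbij'
    (fun x => ⟨⟨(x.1.2.2 * (x.1.2.1 * x.2.1), x.2.2), (x.1.2.2, x.1.2.1 * x.2.1)⟩, (x.1.2.1, x.2.1)⟩)
    (fun x => ⟨⟨(x.2.1 * x.1.2.1, x.2.2 * x.1.1.2), (x.2.1, x.1.2.1)⟩, (x.2.2, x.1.1.2)⟩)
    ?_ ?_ ?_ ?_ ?_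
  · rintro ⟨⟨⟨c, d⟩, ⟨t, n⟩⟩, ⟨f, m⟩⟩ h
    simp only [Finset.mem_sigma, Nat.mem_divisorsAntidiagonal] at h ⊢
    obtain ⟨⟨⟨h1, h0⟩, rfl, h2⟩, rfl, h3⟩ := h
    subst h1
    simp only [ne_eq, mul_eq_zero, not_or] at h0 h2 h3 ⊢
    refine ⟨⟨⟨by ring, ?_⟩, ?_⟩, ?_⟩ <;> tauto
  · rintro ⟨⟨⟨y, m⟩, ⟨n, x⟩⟩, ⟨t, f⟩⟩ h
    simp only [Finset.mem_sigma, Nat.mem_divisorsAntidiagonal] at h ⊢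
    obtain ⟨⟨⟨h1, h0⟩, rfl, h2⟩, rfl, h3⟩ := h
    subst h1
    simp only [ne_eq, mul_eq_zero, not_or] at h0 h2 h3 ⊢
    refine ⟨⟨⟨by ring, ?_⟩, ?_⟩, ?_⟩ <;> tauto
  · rintro ⟨⟨⟨c, d⟩, ⟨t, n⟩⟩, ⟨f, m⟩⟩ h
    simp only [Finset.mem_sigma, Nat.mem_divisorsAntidiagonal] at h
    obtain ⟨⟨⟨h1, h0⟩, rfl, h2⟩, rfl, h3⟩ := h
    rfl
  · rintro ⟨⟨⟨y, m⟩, ⟨n, x⟩⟩, ⟨t, f⟩⟩ h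
    simp only [Finset.mem_sigma, Nat.mem_divisorsAntidiagonal] at h
    obtain ⟨⟨⟨h1, h0⟩, rfl, h2⟩, rfl, h3⟩ := h
    rfl
  · rintro ⟨⟨⟨c, d⟩, ⟨t, n⟩⟩, ⟨f, m⟩⟩ h
    rfl

theorem sum_factorizations {m n x : ℕ} :
    ∑ b ∈ x.divisorsAntidiagonal, (if (b.1 * n).Coprime (b.2 * m) then
        ((μ (b.1 * n) : ℤ) : ℂ) ^ 2 * ((b.2 * m).totient : ℂ) * ((μ b.1 : ℤ) : ℂ) *
          ((μ b.2 : ℤ) : ℂ) else 0) =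
      if n.Coprime m then (x : ℂ) * (((μ (n * x) : ℤ) : ℂ) * ((μ n : ℤ) : ℂ) * m.totient) else 0 := by
  by_cases h : n.Coprime m ∧ Squarefree (n * x)
  · obtain ⟨hnm, hs⟩ := h
    obtain ⟨hnx, hn, hx⟩ := Nat.squarefree_mul_iff.mp hs
    have hsq : ∀ {k : ℕ}, Squarefree k → ((μ k : ℤ) : ℂ) ^ 2 = 1 := fun {k} hk => by
      exact_mod_cast congrArg (fun r : ℤ => (r : ℂ)) (ArithmeticFunction.moebius_sq_eq_one_of_squarefree hk)
    rw [if_pos hnm, moebius_mul_cast hnx]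
    have h1 : (x : ℂ) * (((μ n : ℤ) : ℂ) * ((μ x : ℤ) : ℂ) * ((μ n : ℤ) : ℂ) * m.totient) =
        ((μ x : ℤ) : ℂ) * ((x * m.totient : ℕ) : ℂ) := by
      push_cast
      linear_combination (x : ℂ) * ((μ x : ℤ) : ℂ) * m.totient * hsq hn
    rw [h1, ← sum_totient_mul_of_squarefree hx, Nat.cast_sum, Finset.mul_sum, Finset.sum_filter]
    refine Finset.sum_congr rfl fun b hb => ?_
    obtain ⟨rfl, -⟩ := Nat.mem_divisorsAntidiagonal.mp hb
    obtain ⟨hbc, hb1, hb2⟩ := Nat.squarefree_mul_iff.mp hx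
    have hnb1 : n.Coprime b.1 := hnx.coprime_dvd_right (dvd_mul_right _ _)
    have hnb2 : n.Coprime b.2 := hnx.coprime_dvd_right (dvd_mul_left _ _)
    have hiff : (b.1 * n).Coprime (b.2 * m) ↔ b.1.Coprime m := by
      rw [Nat.coprime_mul_iff_left, Nat.coprime_mul_iff_right, Nat.coprime_mul_iff_right]
      tauto
    simp only [hiff]
    split_ifs
    · rw [hsq (Nat.squarefree_mul_iff.mpr ⟨hnb1.symm, hb1, hn⟩), moebius_mul_cast hbc]
      ring
    · rfl
  · have hR : (if n.Coprime m then
        (x : ℂ) * (((μ (n * x) : ℤ) : ℂ) * ((μ n : ℤ) : ℂ) * m.totient) else 0) = 0 := by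
      split_ifs with hnm
      · rw [ArithmeticFunction.moebius_eq_zero_of_not_squarefree fun hs => h ⟨hnm, hs⟩]; simp
      · rfl
    rw [hR]
    refine Finset.sum_eq_zero fun b hb => ?_
    obtain ⟨rfl, -⟩ := Nat.mem_divisorsAntidiagonal.mp hb
    split_ifs with hc
    · by_cases hs1 : Squarefree (b.1 * n)
      · by_cases hs2 : Squarefree b.2
        · refine absurd ?_ h
          rw [Nat.coprime_mul_iff_left, Nat.coprime_mul_iff_right, Nat.coprime_mul_iff_right] at hc
          obtain ⟨h1, h2, h3⟩ := Nat.squarefree_mul_iff.mp hs1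
          refine ⟨hc.2.2, Nat.squarefree_mul_iff.mpr ⟨Nat.Coprime.mul_right h1.symm hc.2.1, h3,
            Nat.squarefree_mul_iff.mpr ⟨hc.1.1, h2, hs2⟩⟩⟩
        · rw [ArithmeticFunction.moebius_eq_zero_of_not_squarefree hs2]; simp
      · rw [ArithmeticFunction.moebius_eq_zero_of_not_squarefree hs1]; simp
    · rfl

/-- A Möbius sum of correlation sums over one of the arguments. -/
noncomputable def dedSum (q : ℕ) (s w : ℂ) (m n : ℕ) : ℂ :=
  ∑ e ∈ q.divisors, ((μ e : ℤ) : ℂ) * ((e : ℂ) ^ (-s) * ded s w e m n)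

/-- Split the Möbius variable as ft with t ∣ c and f ∣ d. The part f is prime to the modulus c and
cancels against d = fm; the part t lowers the level c = tn to n. -/
theorem dualSum_eq {δ : ℝ} (hδ : δ < 1 / 2) {s : ℂ} (hs : ‖s - 1 / 2‖ ≤ δ) (w : ℂ) {c d : ℕ}
    (hc : c ≠ 0) (hd : d ≠ 0) (hcd : c.Coprime d) :
    dualSum (c * d) s w c d = ∑ a ∈ c.divisorsAntidiagonal, ∑ b ∈ d.divisorsAntidiagonal,
      ((μ a.1 : ℤ) : ℂ) * ((μ b.1 : ℤ) : ℂ) * (((b.1 * a.1 : ℕ) : ℂ) ^ (w - 1) *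
        (a.2 : ℂ) ^ (-s) * dedSum (c * d) s w b.2 a.2) := by
  have h1 : dualSum (c * d) s w c d = ∑ n ∈ (c * d).divisors, ((μ n : ℤ) : ℂ) *
      ((n : ℂ) ^ (w - 1) * (c : ℂ) ^ (-s) * ∑ n₁ ∈ (c * d).divisors, ((μ n₁ : ℤ) : ℂ) *
        ((n₁ : ℂ) ^ (-s) * ded s w (n * n₁) d c)) := by
    rw [dualSum]
    refine Finset.sum_congr rfl fun n _ => ?_
    rw [Finset.mul_sum, Finset.mul_sum]
    refine Finset.sum_congr rfl fun n₁ _ => ?_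
    ring
  rw [h1, sum_moebius_mul_divisors hc hd hcd, Nat.sum_divisorsAntidiagonal (n := c)
    (f := fun t n => ∑ b ∈ d.divisorsAntidiagonal, ((μ t : ℤ) : ℂ) * ((μ b.1 : ℤ) : ℂ) *
      (((b.1 * t : ℕ) : ℂ) ^ (w - 1) * (n : ℂ) ^ (-s) * dedSum (c * d) s w b.2 n))]
  refine Finset.sum_congr rfl fun t ht => ?_
  rw [Nat.sum_divisorsAntidiagonal (n := d)
    (f := fun f m => ((μ t : ℤ) : ℂ) * ((μ f : ℤ) : ℂ) *
      (((f * t : ℕ) : ℂ) ^ (w - 1) * ((c / t : ℕ) : ℂ) ^ (-s) * dedSum (c * d) s w m (c / t)))]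
  refine Finset.sum_congr rfl fun f hf => ?_
  congr 1
  obtain ⟨n, rfl⟩ := Nat.dvd_of_mem_divisors ht
  obtain ⟨m, rfl⟩ := Nat.dvd_of_mem_divisors hf
  have ht0 : t ≠ 0 := left_ne_zero_of_mul hc
  have hn0 : n ≠ 0 := right_ne_zero_of_mul hc
  have hf0 : f ≠ 0 := left_ne_zero_of_mul hd
  rw [Nat.mul_div_cancel_left _ (Nat.pos_of_ne_zero ht0),
    Nat.mul_div_cancel_left _ (Nat.pos_of_ne_zero hf0), dedSum, mul_assoc,
    mul_assoc (((f * t : ℕ) : ℂ) ^ (w - 1)) ((n : ℂ) ^ (-s))]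
  congr 1
  rw [Finset.mul_sum, Finset.mul_sum]
  refine Finset.sum_congr rfl fun e _ => ?_
  have hmt : m.Coprime t :=
    (hcd.coprime_dvd_left (dvd_mul_right t n)).symm.coprime_dvd_left (dvd_mul_left m f)
  rw [mul_assoc f t e, ded_mul_left hc (hcd.symm.coprime_dvd_left (dvd_mul_right f m)),
    ded_mul_level ht0 hn0 hmt (ne_one_of_near_half hδ hs), Nat.cast_mul, natCast_mul_natCast_cpow]
  have h2 : (t : ℂ) ^ (-s) * (t : ℂ) ^ s = 1 := by
    rw [← cpow_add _ _ (by exact_mod_cast ht0)]; simp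
  linear_combination ((n : ℂ) ^ (-s) * (((μ e : ℤ) : ℂ) * ((e : ℂ) ^ (-s) * ded s w e m n))) * h2

/-- The average of the reciprocal terms of the reciprocity formula is a sum of dual sums. -/
theorem levelAvg_reciprocal {δ : ℝ} (hδ : δ < 1 / 2) {s : ℂ} (hs : ‖s - 1 / 2‖ ≤ δ) (w : ℂ) {q : ℕ}
    (hq : q ≠ 0) :
    levelAvg q (s + w) (fun n₁ n₂ k =>
        (n₁ : ℂ) ^ (-s) * (n₂ : ℂ) ^ (-(s + w)) * (k : ℂ) ^ s * ded s w n₁ k n₂) =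
      ∑ p ∈ q.divisorsAntidiagonal with p.1.Coprime p.2,
        ((μ p.1 : ℤ) : ℂ) ^ 2 * p.2.totient * ((q : ℂ) ^ (-w) * dualSum q s w p.1 p.2) := by
  set F : ℕ → ℕ → ℕ → ℕ → ℂ := fun t n f m => if (t * n).Coprime (f * m) then
    ((μ (t * n) : ℤ) : ℂ) ^ 2 * ((f * m).totient : ℂ) * ((μ t : ℤ) : ℂ) * ((μ f : ℤ) : ℂ) *
      (((t * f : ℕ) : ℂ)⁻¹ * ((n : ℂ) ^ (-(s + w)) * (m : ℂ) ^ (-w) * dedSum q s w m n)) else 0 with hF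
  have hR : ∑ p ∈ q.divisorsAntidiagonal with p.1.Coprime p.2,
      ((μ p.1 : ℤ) : ℂ) ^ 2 * p.2.totient * ((q : ℂ) ^ (-w) * dualSum q s w p.1 p.2) =
      ∑ p ∈ q.divisorsAntidiagonal, ∑ a ∈ p.1.divisorsAntidiagonal,
        ∑ b ∈ p.2.divisorsAntidiagonal, F a.1 a.2 b.1 b.2 := by
    rw [Finset.sum_filter]
    refine Finset.sum_congr rfl fun p hp => ?_
    obtain ⟨c, d⟩ := p
    obtain ⟨rfl, -⟩ := Nat.mem_divisorsAntidiagonal.mp hp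
    have hc := left_ne_zero_of_mul hq
    have hd := right_ne_zero_of_mul hq
    split_ifs with hcd
    · simp only at hcd hc hd ⊢
      rw [dualSum_eq hδ hs w hc hd hcd, Finset.mul_sum, Finset.mul_sum]
      refine Finset.sum_congr rfl fun a ha => ?_
      rw [Finset.mul_sum, Finset.mul_sum]
      refine Finset.sum_congr rfl fun b hb => ?_
      obtain ⟨t, n⟩ := a
      obtain ⟨f, m⟩ := b
      obtain ⟨rfl, -⟩ := Nat.mem_divisorsAntidiagonal.mp ha
      obtain ⟨rfl, -⟩ := Nat.mem_divisorsAntidiagonal.mp hb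
      simp only [hF]
      have ht0 : (t : ℂ) ≠ 0 := by exact_mod_cast left_ne_zero_of_mul hc
      have hn0 : (n : ℂ) ≠ 0 := by exact_mod_cast right_ne_zero_of_mul hc
      have hf0 : (f : ℂ) ≠ 0 := by exact_mod_cast left_ne_zero_of_mul hd
      rw [if_pos hcd]
      have e1 : (((t * n * (f * m) : ℕ)) : ℂ) ^ (-w) * (((f * t : ℕ) : ℂ) ^ (w - 1) * (n : ℂ) ^ (-s)) =
          ((t * f : ℕ) : ℂ)⁻¹ * ((n : ℂ) ^ (-(s + w)) * (m : ℂ) ^ (-w)) := by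
        have e0 : ((t * n * (f * m) : ℕ) : ℂ) ^ (-w) =
            (t : ℂ) ^ (-w) * (n : ℂ) ^ (-w) * ((f : ℂ) ^ (-w) * (m : ℂ) ^ (-w)) := by
          rw [Nat.cast_mul, natCast_mul_natCast_cpow, Nat.cast_mul, natCast_mul_natCast_cpow,
            Nat.cast_mul, natCast_mul_natCast_cpow]
        rw [e0, Nat.cast_mul, natCast_mul_natCast_cpow, Nat.cast_mul, neg_add, cpow_add _ _ hn0, cpow_sub _ _ ht0, cpow_sub _ _ hf0, cpow_neg _ w, cpow_neg _ w,
          cpow_neg _ w, cpow_neg _ w, cpow_one, cpow_one]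
        have e2 : (t : ℂ) ^ w ≠ 0 := by simp [cpow_eq_zero_iff, ht0]
        have e3 : (f : ℂ) ^ w ≠ 0 := by simp [cpow_eq_zero_iff, hf0]
        field_simp
      linear_combination (((μ (t * n) : ℤ) : ℂ) ^ 2 * ((f * m).totient : ℂ) * ((μ t : ℤ) : ℂ) *
        ((μ f : ℤ) : ℂ) * dedSum (t * n * (f * m)) s w m n) * e1
    · symm
      refine Finset.sum_eq_zero fun a ha => Finset.sum_eq_zero fun b hb => ?_
      obtain ⟨rfl, -⟩ := Nat.mem_divisorsAntidiagonal.mp ha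
      obtain ⟨rfl, -⟩ := Nat.mem_divisorsAntidiagonal.mp hb
      exact if_neg hcd
  rw [hR, sum_divisorsAntidiagonal_four, levelAvg, Nat.sum_divisorsAntidiagonal' (n := q)
    (f := fun y m => ∑ a ∈ y.divisorsAntidiagonal, ∑ b ∈ a.2.divisorsAntidiagonal, F b.1 a.1 b.2 m)]
  refine Finset.sum_congr rfl fun m hm => ?_
  obtain ⟨y, hy⟩ := Nat.dvd_of_mem_divisors hm
  have hm0 : m ≠ 0 := fun h => hq (by rw [hy, h, zero_mul])
  have hy0 : y ≠ 0 := fun h => hq (by rw [hy, h, mul_zero])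
  have hqm : q / m = y := by rw [hy, Nat.mul_div_cancel_left _ (Nat.pos_of_ne_zero hm0)]
  have hmq : m ∣ q := ⟨y, hy⟩
  have hmc : (m : ℂ) ≠ 0 := by exact_mod_cast hm0
  rw [hqm]
  -- Multiplying both arguments by e, which is prime to the modulus n₂, replaces (n₁, m/e) by (e n₁,
  -- m); e and n₁ then merge into a single divisor of q.
  have hL : ∑ n₁ ∈ q.divisors with n₁.Coprime m, ∑ n₂ ∈ q.divisors with n₂.Coprime m,
      ((μ n₁ : ℤ) : ℂ) * ((μ n₂ : ℤ) : ℂ) * ∑ e ∈ m.divisors, ((μ e : ℤ) : ℂ) *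
        ((n₁ : ℂ) ^ (-s) * (n₂ : ℂ) ^ (-(s + w)) * ((m / e : ℕ) : ℂ) ^ s * ded s w n₁ (m / e) n₂) =
      ∑ n ∈ y.divisors with n.Coprime m, ((μ n : ℤ) : ℂ) * ((n : ℂ) ^ (-(s + w)) *
        ((m : ℂ) ^ s * dedSum q s w m n)) := by
    have hset : (q.divisors.filter fun n => n.Coprime m) = y.divisors.filter fun n => n.Coprime m := by
      ext n
      simp only [Finset.mem_filter, Nat.mem_divisors]
      constructor
      · rintro ⟨⟨h1, -⟩, h2⟩
        exact ⟨⟨h2.dvd_of_dvd_mul_left (hy ▸ h1), hy0⟩, h2⟩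
      · rintro ⟨⟨h1, -⟩, h2⟩
        exact ⟨⟨hy ▸ h1.mul_left m, hq⟩, h2⟩
    rw [Finset.sum_comm, ← hset]
    refine Finset.sum_congr rfl fun n₂ hn₂ => ?_
    rw [Finset.mem_filter] at hn₂
    have hn0 := (Nat.pos_of_mem_divisors hn₂.1).ne'
    rw [dedSum, ← sum_moebius_split hq hmq, Finset.mul_sum, Finset.mul_sum, Finset.mul_sum]
    refine Finset.sum_congr rfl fun n₁ _ => ?_
    rw [Finset.mul_sum, Finset.mul_sum, Finset.mul_sum, Finset.mul_sum]
    refine Finset.sum_congr rfl fun e he => ?_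
    have hem := Nat.dvd_of_mem_divisors he
    have he0 := (Nat.pos_of_mem_divisors he).ne'
    rw [natCast_div_cpow hem he0, ← ded_mul_left hn0 (hn₂.2.symm.coprime_dvd_left hem) s w n₁ (m / e),
      Nat.mul_div_cancel' hem, Nat.cast_mul, natCast_mul_natCast_cpow]
    ring
  rw [hL, Finset.sum_filter]
  rw [Nat.sum_divisorsAntidiagonal (n := y)
    (f := fun n x => ∑ b ∈ x.divisorsAntidiagonal, F b.1 n b.2 m), Finset.mul_sum, Finset.mul_sum]
  refine Finset.sum_congr rfl fun n hn => ?_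
  obtain ⟨x, hx⟩ := Nat.dvd_of_mem_divisors hn
  have hn0 : n ≠ 0 := fun h => hy0 (by rw [hx, h, zero_mul])
  have hx0 : x ≠ 0 := fun h => hy0 (by rw [hx, h, mul_zero])
  have hyn : y / n = x := by rw [hx, Nat.mul_div_cancel_left _ (Nat.pos_of_ne_zero hn0)]
  rw [hyn]
  have h3 : ∑ b ∈ x.divisorsAntidiagonal, F b.1 n b.2 m =
      (∑ b ∈ x.divisorsAntidiagonal, (if (b.1 * n).Coprime (b.2 * m) then
        ((μ (b.1 * n) : ℤ) : ℂ) ^ 2 * ((b.2 * m).totient : ℂ) * ((μ b.1 : ℤ) : ℂ) *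
          ((μ b.2 : ℤ) : ℂ) else 0)) *
        ((x : ℂ)⁻¹ * ((n : ℂ) ^ (-(s + w)) * (m : ℂ) ^ (-w) * dedSum q s w m n)) := by
    rw [Finset.sum_mul]
    refine Finset.sum_congr rfl fun b hb => ?_
    obtain ⟨rfl, -⟩ := Nat.mem_divisorsAntidiagonal.mp hb
    simp only [hF]
    split_ifs
    · rfl
    · rw [zero_mul]
  rw [h3, sum_factorizations, hx]
  have hxc : (x : ℂ) ≠ 0 := by exact_mod_cast hx0
  have h4 : (m : ℂ) ^ (-(s + w)) * (m : ℂ) ^ s = (m : ℂ) ^ (-w) := by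
    rw [← cpow_add _ _ hmc]; congr 1; ring
  split_ifs
  · rw [← h4]
    field_simp
  · ring

end DirichletMeanSquare

namespace DirichletMeanSquare

open Complex HurwitzZeta Filter Topology MeasureTheory
open scoped ArithmeticFunction.Moebius

/-! ### The divisor bound -/

/-- Compare a + 1 with p^(ηa) prime by prime. The comparison holds outright once p^η ≥ 2, and with a
factor K for the fewer than P + 1 smaller primes. -/
theorem exists_card_divisors_le {η : ℝ} (hη : 0 < η) :
    ∃ C : ℝ, 0 ≤ C ∧ ∀ n : ℕ, n ≠ 0 → (n.divisors.card : ℝ) ≤ C * (n : ℝ) ^ η := by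
  obtain ⟨P, hP⟩ := exists_nat_gt ((2 : ℝ) ^ η⁻¹)
  have hl : 0 < η * Real.log 2 := mul_pos hη (Real.log_pos one_lt_two)
  set K : ℝ := 1 + (η * Real.log 2)⁻¹ with hK
  have hK1 : 1 ≤ K := le_add_of_nonneg_right (inv_nonneg.mpr hl.le)
  have hK0 : 0 ≤ K := zero_le_one.trans hK1
  have hsmall : ∀ p : ℕ, 2 ≤ p → ∀ a : ℕ, (a : ℝ) + 1 ≤ K * ((p : ℝ) ^ η) ^ a := by
    intro p hp a
    have h1 : Real.exp (η * Real.log 2 * a) ≤ ((p : ℝ) ^ η) ^ a := by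
      have : Real.exp (η * Real.log 2 * a) = ((2 : ℝ) ^ η) ^ a := by
        rw [Real.rpow_def_of_pos two_pos, ← Real.exp_nat_mul]; congr 1; ring
      rw [this]
      have : (2 : ℝ) ≤ p := by exact_mod_cast hp
      gcongr
    have h2 := Real.add_one_le_exp (η * Real.log 2 * a)
    have ha : (0 : ℝ) ≤ a := Nat.cast_nonneg a
    have h3 : (a : ℝ) + 1 ≤ K * (η * Real.log 2 * a + 1) := by
      have : K * (η * Real.log 2 * a + 1) =
          η * Real.log 2 * a + 1 + (a + (η * Real.log 2)⁻¹) := by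
        rw [hK]; field_simp
      rw [this]
      have h4 : 0 ≤ η * Real.log 2 * a := mul_nonneg hl.le ha
      have h5 : 0 ≤ (η * Real.log 2)⁻¹ := inv_nonneg.mpr hl.le
      linarith
    exact h3.trans (mul_le_mul_of_nonneg_left (h2.trans h1) hK0)
  have hlarge : ∀ p : ℕ, P ≤ p → ∀ a : ℕ, (a : ℝ) + 1 ≤ ((p : ℝ) ^ η) ^ a := by
    intro p hp a
    have h1 : (2 : ℝ) ≤ (p : ℝ) ^ η := by
      have h2 : (2 : ℝ) = ((2 : ℝ) ^ η⁻¹) ^ η := by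
        rw [← Real.rpow_mul two_pos.le, inv_mul_cancel₀ hη.ne', Real.rpow_one]
      have h3 : (2 : ℝ) ^ η⁻¹ ≤ p := hP.le.trans (by exact_mod_cast hp)
      rw [h2]
      exact Real.rpow_le_rpow (by positivity) h3 hη.le
    calc (a : ℝ) + 1 ≤ 2 ^ a := by exact_mod_cast Nat.lt_two_pow_self
      _ ≤ _ := by gcongr
  refine ⟨K ^ P, by positivity, fun n hn => ?_⟩
  have h1 : (n : ℝ) ^ η = ∏ p ∈ n.primeFactors, ((p : ℝ) ^ η) ^ n.factorization p := by
    conv_lhs => rw [← Nat.prod_factorization_pow_eq_self hn]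
    rw [Finsupp.prod, Nat.support_factorization, Nat.cast_prod,
      ← Real.finsetProd_rpow _ _ fun _ _ => Nat.cast_nonneg _]
    refine Finset.prod_congr rfl fun p _ => ?_
    rw [Nat.cast_pow, ← Real.rpow_natCast, ← Real.rpow_natCast, ← Real.rpow_mul (Nat.cast_nonneg _),
      ← Real.rpow_mul (Nat.cast_nonneg _), mul_comm]
  have h2 : ∏ p ∈ n.primeFactors, (if p < P then K else 1) ≤ K ^ P := by
    rw [Finset.prod_ite, Finset.prod_const, Finset.prod_const_one, mul_one]
    refine pow_le_pow_right₀ hK1 ?_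
    refine (Finset.card_le_card (t := Finset.range P) fun p hp => ?_).trans (Finset.card_range P).le
    exact Finset.mem_range.mpr (Finset.mem_filter.mp hp).2
  rw [Nat.card_divisors hn, h1]
  push_cast
  refine le_trans ?_ (mul_le_mul_of_nonneg_right h2 (Finset.prod_nonneg fun _ _ => by positivity))
  rw [← Finset.prod_mul_distrib]
  refine Finset.prod_le_prod (fun _ _ => by positivity) fun p hp => ?_
  split_ifs with h
  · exact hsmall p (Nat.prime_of_mem_primeFactors hp).two_le _
  · rw [one_mul]
    exact hlarge p (not_lt.mp h) _

/-! ### Powers with exponents close to the critical line -/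

/-- For ρ ≤ C / log q, integers polynomial in q have bounded 2ρ-th power; this makes shifts of the
exponents harmless. -/
theorem natCast_rpow_le_exp {n q a : ℕ} (hn : n ≠ 0) (h : n ≤ q ^ a) {C ρ t : ℝ} (hρ : 0 ≤ ρ)
    (hC : ρ * Real.log q ≤ C) (ht : t ≤ 2 * ρ) : (n : ℝ) ^ t ≤ Real.exp (2 * a * C) := by
  have hn1 : (1 : ℝ) ≤ n := by exact_mod_cast Nat.one_le_iff_ne_zero.mpr hn
  have h1 : Real.log n ≤ a * Real.log q := by
    rw [← Real.log_pow]
    exact Real.log_le_log (by linarith) (by exact_mod_cast h)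
  have h0 := Real.log_nonneg hn1
  rw [Real.rpow_def_of_pos (by linarith)]
  refine Real.exp_le_exp.mpr ?_
  have ha : (0 : ℝ) ≤ a := Nat.cast_nonneg a
  calc Real.log n * t ≤ Real.log n * (2 * ρ) := mul_le_mul_of_nonneg_left ht h0
    _ ≤ a * Real.log q * (2 * ρ) := mul_le_mul_of_nonneg_right h1 (by linarith)
    _ = 2 * a * (ρ * Real.log q) := by ring
    _ ≤ 2 * a * C := mul_le_mul_of_nonneg_left hC (by positivity)

theorem norm_natCast_cpow_le {n q : ℕ} (hn : n ≠ 0) (h : n ≤ q ^ 2) {C ρ r : ℝ} (hρ : 0 ≤ ρ)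
    (hC : ρ * Real.log q ≤ C) {u : ℂ} (hu : u.re ≤ r + 2 * ρ) :
    ‖(n : ℂ) ^ u‖ ≤ (n : ℝ) ^ r * Real.exp (4 * C) := by
  have hn0 : (0 : ℝ) < n := by exact_mod_cast Nat.pos_of_ne_zero hn
  rw [norm_natCast_cpow_of_pos (Nat.pos_of_ne_zero hn), show u.re = r + (u.re - r) by ring,
    Real.rpow_add hn0]
  have h1 := natCast_rpow_le_exp hn h hρ hC (t := u.re - r) (by linarith)
  refine mul_le_mul_of_nonneg_left (h1.trans (le_of_eq ?_)) (by positivity)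
  congr 1; push_cast; ring

theorem natCast_rpow_one_add_le {n q : ℕ} (hn : n ≠ 0) (h : n ≤ q ^ 3) {C ρ η : ℝ} (hρ : 0 ≤ ρ)
    (hη : 0 ≤ η) (hC : ρ * Real.log q ≤ C) :
    (n : ℝ) ^ (1 + 2 * ρ + η) ≤ n * (Real.exp (6 * C) * (q : ℝ) ^ (3 * η)) := by
  have hn0 : (0 : ℝ) < n := by exact_mod_cast Nat.pos_of_ne_zero hn
  rw [Real.rpow_add hn0, Real.rpow_add hn0, Real.rpow_one, mul_assoc]
  have h1 := natCast_rpow_le_exp hn h hρ hC (t := 2 * ρ) le_rfl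
  have h2 : (n : ℝ) ^ η ≤ (q : ℝ) ^ (3 * η) := by
    rw [Real.rpow_mul (Nat.cast_nonneg q)]
    refine Real.rpow_le_rpow hn0.le ?_ hη
    exact_mod_cast h
  refine mul_le_mul_of_nonneg_left (mul_le_mul (h1.trans (le_of_eq ?_)) h2 (by positivity)
    (by positivity)) hn0.le
  congr 1; push_cast; ring

/-- |e^y - 1| ≤ |y| e^|y| with y = u log x: the factor u cancels the pole of J at u = 0 and only a
logarithm is lost. -/
theorem norm_mul_cpow_sub_one_le {x : ℝ} (hx : 0 < x) {J u : ℂ} {B M T : ℝ} (hB : 0 ≤ B)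
    (hJ : ‖u * J‖ ≤ B) (hx1 : |Real.log x| ≤ M) (hu : ‖u‖ * M ≤ T) :
    ‖J * ((x : ℂ) ^ u - 1)‖ ≤ B * (M * Real.exp T) := by
  have hx0 : (x : ℂ) ≠ 0 := by exact_mod_cast hx.ne'
  rw [cpow_def_of_ne_zero hx0, ← ofReal_log hx.le]
  have h1 := Complex.norm_exp_sub_sum_le_norm_mul_exp ((Real.log x : ℂ) * u) 1
  simp only [Finset.range_one, Finset.sum_singleton, pow_zero, Nat.factorial_zero, Nat.cast_one,
    div_one, pow_one, norm_mul, Complex.norm_real, Real.norm_eq_abs] at h1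
  have h2 : |Real.log x| * ‖u‖ ≤ T := by
    rw [mul_comm]
    exact (mul_le_mul_of_nonneg_left hx1 (norm_nonneg _)).trans hu
  have hM : 0 ≤ M := (abs_nonneg _).trans hx1
  rw [norm_mul]
  rw [norm_mul] at hJ
  calc ‖J‖ * ‖cexp (Real.log x * u) - 1‖
      ≤ ‖J‖ * (|Real.log x| * ‖u‖ * Real.exp (|Real.log x| * ‖u‖)) :=
        mul_le_mul_of_nonneg_left h1 (norm_nonneg _)
    _ = ‖u‖ * ‖J‖ * (|Real.log x| * Real.exp (|Real.log x| * ‖u‖)) := by ring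
    _ ≤ B * (M * Real.exp T) := by
        refine mul_le_mul hJ (mul_le_mul hx1 (Real.exp_le_exp.mpr h2) (Real.exp_pos _).le hM)
          (by positivity) hB

end DirichletMeanSquare

namespace DirichletMeanSquare

open Complex HurwitzZeta Filter Topology MeasureTheory
open scoped ArithmeticFunction.Moebius

/-! ### Exchanging the two moduli in the dual sums -/

-- Apply reciprocity with multipliers N = n n₁ and c, and level d. Divided by c^s d^s N^w, it has
-- both sums of the difference among its terms. The rest is the error, a sum of modulus N bounded
-- trivially, and the ζ(s + w) and mean terms, which have to be taken together.
set_option maxHeartbeats 1000000 in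
theorem exists_norm_ded_sub_ded_le {δ η : ℝ} (hδ0 : 0 ≤ δ) (hδ : δ < 1 / 2) (hη0 : 0 < η)
    (hη : η + δ ≤ 1 / 2) (C : ℝ) :
    ∃ K : ℝ, 0 ≤ K ∧ ∀ s w : ℂ, ‖s - 1 / 2‖ ≤ δ → ‖w - 1 / 2‖ ≤ δ → s + w ≠ 1 →
      ∀ ρ : ℝ, ‖s - 1 / 2‖ ≤ ρ → ‖w - 1 / 2‖ ≤ ρ → ∀ q c d : ℕ, c * d = q → c.Coprime d → d ≤ c →
      1 < q → ρ * Real.log q ≤ C → ∀ n n₁ : ℕ, n ∣ q → n₁ ∣ q →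
      ‖(d.totient : ℂ) * ((q : ℂ) ^ (-w) * ((n : ℂ) ^ (w - 1) * (n₁ : ℂ) ^ (-s) *
        ((c : ℂ) ^ (-s) * ded s w (n * n₁) d c - (d : ℂ) ^ (-s) * ded s w (n * n₁) c d)))‖ ≤
      K * (q : ℝ) ^ (3 * η) := by
  obtain ⟨C₁, hC₁, h₁⟩ := exists_reciprocity_gcd hδ hη0 hη
  obtain ⟨C₂, hC₂, h₂⟩ := exists_norm_ded_le hδ hη0
  obtain ⟨C₃, hC₃, h₃⟩ := exists_norm_riemannZeta_add_kernelMean_le hδ0 hδ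
  set E : ℝ := Real.exp (4 * C) with hE
  set e : ℝ := Real.exp (6 * C) with he
  have hE0 : 0 < E := Real.exp_pos _
  have he0 : 0 < e := Real.exp_pos _
  refine ⟨E ^ 6 * C₁ * e + E ^ 5 * C₂ * e + E ^ 8 * C₃ * (1 + e / η), by positivity, ?_⟩
  intro s w hs hw hz ρ hsρ hwρ q c d hcd hcop hdc hq1 hC n n₁ hn hn₁
  have hρ : 0 ≤ ρ := (norm_nonneg _).trans hsρ
  have hq0 : q ≠ 0 := by omega
  have hc0 : c ≠ 0 := fun h => hq0 (by rw [← hcd, h, zero_mul])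
  have hd0 : d ≠ 0 := fun h => hq0 (by rw [← hcd, h, mul_zero])
  have hqpos := Nat.pos_of_ne_zero hq0
  have hn0 := (Nat.pos_of_dvd_of_pos hn hqpos).ne'
  have hn₁0 := (Nat.pos_of_dvd_of_pos hn₁ hqpos).ne'
  have hnq := Nat.le_of_dvd hqpos hn
  have hn₁q := Nat.le_of_dvd hqpos hn₁
  have hcq : c ≤ q := hcd ▸ Nat.le_mul_of_pos_right c (Nat.pos_of_ne_zero hd0)
  have hdq : d ≤ q := hcd ▸ Nat.le_mul_of_pos_left d (Nat.pos_of_ne_zero hc0)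
  have hqq : q ≤ q ^ 2 := Nat.le_self_pow two_ne_zero q
  obtain ⟨N, hN⟩ : ∃ N, N = n * n₁ := ⟨_, rfl⟩
  have hN0 : N ≠ 0 := hN ▸ mul_ne_zero hn0 hn₁0
  have hNq : N ≤ q ^ 2 := by rw [hN, sq]; exact Nat.mul_le_mul hnq hn₁q
  have hNc0 : N * c ≠ 0 := mul_ne_zero hN0 hc0
  have hNcq : N * c ≤ q ^ 3 := by rw [pow_succ]; exact Nat.mul_le_mul hNq hcq
  rw [← hN]
  obtain ⟨g, hg⟩ : ∃ g, g = N.gcd c := ⟨_, rfl⟩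
  obtain ⟨L, hL⟩ : ∃ L, L = N.lcm c := ⟨_, rfl⟩
  have hgL : g * L = N * c := by rw [hg, hL]; exact Nat.gcd_mul_lcm N c
  have hg0 : g ≠ 0 := fun h => hNc0 (by rw [← hgL, h, zero_mul])
  have hL0 : L ≠ 0 := fun h => hNc0 (by rw [← hgL, h, mul_zero])
  have hgN : g ≤ N := hg ▸ Nat.gcd_le_left c (Nat.pos_of_ne_zero hN0)
  have hgc : g ≤ c := hg ▸ Nat.gcd_le_right N (Nat.pos_of_ne_zero hc0)
  have hLNc : L ≤ N * c := hgL ▸ Nat.le_mul_of_pos_left L (Nat.pos_of_ne_zero hg0)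
  obtain ⟨hsl, hsu⟩ := re_bounds hsρ
  obtain ⟨hwl, hwu⟩ := re_bounds hwρ
  have hcc : (c : ℂ) ≠ 0 := by exact_mod_cast hc0
  have hdc' : (d : ℂ) ≠ 0 := by exact_mod_cast hd0
  have hNC : (N : ℂ) ≠ 0 := by exact_mod_cast hN0
  have hgC : (g : ℂ) ≠ 0 := by exact_mod_cast hg0
  have h1 := h₁ s w hs hw hz ρ hρ (by linarith) N c d hN0 hc0 hd0
    (hcop.coprime_dvd_left (Nat.gcd_dvd_right N c))
  have h2 := h₂ s w hs hw ρ hρ hsu hwu d c N hN0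
  obtain ⟨h3, h4⟩ := h₃ s w hs hw hz
  rw [← hg, ← hL] at h1
  set J := kernelMean s w with hJ
  set err := (c : ℂ) ^ s * (N : ℂ) ^ w * ded s w N c d -
    ((d : ℂ) ^ s * (N : ℂ) ^ w * ded s w N d c + (d : ℂ) ^ w * (c : ℂ) ^ s * ded s w d c N +
      (g : ℂ) ^ (s + w) * (d : ℂ) ^ (s + w) * riemannZeta (s + w) / 2 +
      d * g * (L : ℂ) ^ (s + w - 1) * J) with herr
  set x : ℝ := (L : ℝ) / ((d * g : ℕ) : ℝ) with hx
  have hdg0 : (0 : ℝ) < ((d * g : ℕ) : ℝ) := by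
    exact_mod_cast Nat.pos_of_ne_zero (mul_ne_zero hd0 hg0)
  have hLr : (0 : ℝ) < L := by exact_mod_cast Nat.pos_of_ne_zero hL0
  have hx0 : 0 < x := div_pos hLr hdg0
  have hlq : 0 < Real.log q := Real.log_pos (by exact_mod_cast hq1)
  have hlogx : |Real.log x| ≤ 3 * Real.log q := by
    have hL1 : 0 ≤ Real.log L := Real.log_natCast_nonneg L
    have hdg1 : 0 ≤ Real.log ((d * g : ℕ) : ℝ) := Real.log_natCast_nonneg _
    have hL2 : Real.log L ≤ 3 * Real.log q := by
      have := Real.log_le_log hLr (y := ((q ^ 3 : ℕ) : ℝ)) (by exact_mod_cast hLNc.trans hNcq)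
      rwa [Nat.cast_pow, Real.log_pow] at this
    have hdg2 : Real.log ((d * g : ℕ) : ℝ) ≤ 2 * Real.log q := by
      have := Real.log_le_log hdg0 (y := ((q ^ 2 : ℕ) : ℝ))
        (by rw [sq]; exact_mod_cast Nat.mul_le_mul hdq (hgc.trans hcq))
      rwa [Nat.cast_pow, Real.log_pow] at this
    rw [hx, Real.log_div hLr.ne' hdg0.ne', abs_le]
    constructor <;> linarith
  have hu : ‖s + w - 1‖ ≤ 2 * ρ := by
    have : s + w - 1 = (s - 1 / 2) + (w - 1 / 2) := by ring
    rw [this]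
    exact (norm_add_le _ _).trans (by linarith)
  have h5 : ‖J * ((x : ℂ) ^ (s + w - 1) - 1)‖ ≤ C₃ * (3 * Real.log q * e) := by
    refine norm_mul_cpow_sub_one_le hx0 hC₃ h4 hlogx ?_
    calc ‖s + w - 1‖ * (3 * Real.log q) ≤ 2 * ρ * (3 * Real.log q) :=
          mul_le_mul_of_nonneg_right hu (by positivity)
      _ = 6 * (ρ * Real.log q) := by ring
      _ ≤ 6 * C := by linarith
  -- Writes the mean term as the ζ(s + w) term's power times x^(s + w - 1), x = L/(dg). In ζ(s +
  -- w)/2 + J + J (x^(s + w - 1) - 1) the first sum is bounded and the last product is O(log q).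
  have hxpow : (g : ℂ) ^ (s + w) * (d : ℂ) ^ (s + w) * (x : ℂ) ^ (s + w - 1) =
      d * g * (L : ℂ) ^ (s + w - 1) := by
    have e1 : (L : ℂ) = (x : ℂ) * (((d * g : ℕ) : ℝ) : ℂ) := by
      rw [hx, ← ofReal_mul, div_mul_cancel₀ _ hdg0.ne', ofReal_natCast]
    have e2 : ∀ {k : ℂ}, k ≠ 0 → k ^ (s + w) = k * k ^ (s + w - 1) := fun {k} hk => by
      rw [cpow_sub _ _ hk, cpow_one]; field_simp
    rw [e1, mul_cpow_ofReal_nonneg hx0.le hdg0.le, ofReal_natCast, Nat.cast_mul,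
      natCast_mul_natCast_cpow, e2 hgC, e2 hdc']
    ring
  set X := (c : ℂ) ^ (-s) * (d : ℂ) ^ (-s) * (N : ℂ) ^ (-w) with hX
  set t₂ := (d : ℂ) ^ (w - s) * (N : ℂ) ^ (-w) * ded s w d c N with ht₂
  set t₃ := X * ((g : ℂ) ^ (s + w) * (d : ℂ) ^ (s + w)) *
    (riemannZeta (s + w) / 2 + J + J * ((x : ℂ) ^ (s + w - 1) - 1)) with ht₃
  have hid : (c : ℂ) ^ (-s) * ded s w N d c - (d : ℂ) ^ (-s) * ded s w N c d =
      -(X * err + t₂ + t₃) := by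
    have inv : ∀ {k : ℂ} (v : ℂ), k ≠ 0 → k ^ (-v) * k ^ v = 1 := fun {k} v hk => by
      rw [← cpow_add _ _ hk]; simp
    have hc1 := inv s hcc
    have hd1 := inv s hdc'
    have hN1 := inv w hNC
    have hdd : (d : ℂ) ^ (w - s) = (d : ℂ) ^ (-s) * (d : ℂ) ^ w := by
      rw [← cpow_add _ _ hdc']; congr 1; ring
    have ht : t₃ = X * ((g : ℂ) ^ (s + w) * (d : ℂ) ^ (s + w) * riemannZeta (s + w) / 2 +
        d * g * (L : ℂ) ^ (s + w - 1) * J) := by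
      rw [← hxpow, ht₃]; ring
    have hXe : X * err = (d : ℂ) ^ (-s) * ded s w N c d - (c : ℂ) ^ (-s) * ded s w N d c
        - t₂ - t₃ := by
      rw [ht, ht₂, hdd, herr, hX]
      linear_combination ((d : ℂ) ^ (-s) * ded s w N c d * ((N : ℂ) ^ (-w) * (N : ℂ) ^ w)
          - (d : ℂ) ^ (-s) * (N : ℂ) ^ (-w) * (d : ℂ) ^ w * ded s w d c N) * hc1
        + ((d : ℂ) ^ (-s) * ded s w N c d - (c : ℂ) ^ (-s) * ded s w N d c) * hN1
        - (c : ℂ) ^ (-s) * ded s w N d c * ((N : ℂ) ^ (-w) * (N : ℂ) ^ w) * hd1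
    rw [hXe]; ring
  rw [hid]
  set a : ℝ := (q : ℝ) ^ (-(1 / 2) : ℝ) with ha
  set b : ℝ := (N : ℝ) ^ (-(1 / 2) : ℝ) with hb
  have hqr : (0 : ℝ) < q := by exact_mod_cast hqpos
  have hNr : (0 : ℝ) < N := by exact_mod_cast Nat.pos_of_ne_zero hN0
  have hdr : (0 : ℝ) ≤ d := Nat.cast_nonneg d
  have hcr : (0 : ℝ) ≤ c := Nat.cast_nonneg c
  have hgr : (0 : ℝ) ≤ g := Nat.cast_nonneg g
  have ha0 : 0 < a := Real.rpow_pos_of_pos hqr _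
  have hb0 : 0 < b := Real.rpow_pos_of_pos hNr _
  have sq_inv : ∀ {y : ℝ}, 0 < y → y ^ (-(1 / 2) : ℝ) * y ^ (-(1 / 2) : ℝ) * y = 1 := by
    intro y hy
    rw [← Real.rpow_add hy]
    norm_num
    rw [Real.rpow_neg_one, inv_mul_cancel₀ hy.ne']
  have haq : a * a * (c * d) = 1 := by
    rw [← Nat.cast_mul, hcd]
    exact sq_inv hqr
  have hbN : b * b * N = 1 := sq_inv hNr
  have hacd : (c : ℝ) ^ (-(1 / 2) : ℝ) * (d : ℝ) ^ (-(1 / 2) : ℝ) = a := by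
    rw [ha, ← hcd, Nat.cast_mul, Real.mul_rpow hcr hdr]
  have hbn : (n : ℝ) ^ (-(1 / 2) : ℝ) * (n₁ : ℝ) ^ (-(1 / 2) : ℝ) = b := by
    rw [hb, hN, Nat.cast_mul, Real.mul_rpow (Nat.cast_nonneg _) (Nat.cast_nonneg _)]
  -- The one place where d ≤ c is needed: it gives d ≤ √q, so the weight φ(d) q^(-1/2) does not
  -- grow.
  have hda2 : d * a * (d * a) ≤ 1 := by
    rw [← haq]
    have : (d : ℝ) ≤ c := by exact_mod_cast hdc
    calc (d : ℝ) * a * (d * a) = a * a * (d * d) := by ring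
      _ ≤ a * a * (c * d) := by gcongr
  have hda : d * a ≤ 1 := by
    by_contra h
    push Not at h
    nlinarith
  have hbg : b * b * g ≤ 1 := by
    rw [← hbN]
    have : (g : ℝ) ≤ N := by exact_mod_cast hgN
    gcongr
  have nb : ∀ {k : ℕ} {u : ℂ} (r : ℝ), k ≠ 0 → k ≤ q ^ 2 → u.re ≤ r + 2 * ρ →
      ‖(k : ℂ) ^ u‖ ≤ (k : ℝ) ^ r * E := fun r hk hkq hu => norm_natCast_cpow_le hk hkq hρ hC hu
  have hWb : ‖(d.totient : ℂ) * ((q : ℂ) ^ (-w) * ((n : ℂ) ^ (w - 1) * (n₁ : ℂ) ^ (-s)))‖ ≤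
      d * a * b * E ^ 3 := by
    have e1 : ‖(d.totient : ℂ)‖ ≤ d := by
      rw [Complex.norm_natCast]; exact_mod_cast Nat.totient_le d
    have e2 : ‖(q : ℂ) ^ (-w)‖ ≤ a * E := nb _ hq0 hqq (by rw [neg_re]; linarith)
    have e3 : ‖(n : ℂ) ^ (w - 1)‖ ≤ (n : ℝ) ^ (-(1 / 2) : ℝ) * E :=
      nb _ hn0 (hnq.trans hqq) (by rw [sub_re, one_re]; linarith)
    have e4 : ‖(n₁ : ℂ) ^ (-s)‖ ≤ (n₁ : ℝ) ^ (-(1 / 2) : ℝ) * E :=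
      nb _ hn₁0 (hn₁q.trans hqq) (by rw [neg_re]; linarith)
    rw [norm_mul, norm_mul, norm_mul]
    calc _ ≤ (d : ℝ) * (a * E * ((n : ℝ) ^ (-(1 / 2) : ℝ) * E * ((n₁ : ℝ) ^ (-(1 / 2) : ℝ) * E))) := by
          gcongr
      _ = _ := by rw [← hbn]; ring
  have hNw : ‖(N : ℂ) ^ (-w)‖ ≤ b * E := nb _ hN0 hNq (by rw [neg_re]; linarith)
  have hXb : ‖X‖ ≤ a * b * E ^ 3 := by
    have e1 : ‖(c : ℂ) ^ (-s)‖ ≤ (c : ℝ) ^ (-(1 / 2) : ℝ) * E :=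
      nb _ hc0 (hcq.trans hqq) (by rw [neg_re]; linarith)
    have e2 : ‖(d : ℂ) ^ (-s)‖ ≤ (d : ℝ) ^ (-(1 / 2) : ℝ) * E :=
      nb _ hd0 (hdq.trans hqq) (by rw [neg_re]; linarith)
    rw [hX, norm_mul, norm_mul]
    calc _ ≤ (c : ℝ) ^ (-(1 / 2) : ℝ) * E * ((d : ℝ) ^ (-(1 / 2) : ℝ) * E) * (b * E) := by gcongr
      _ = _ := by rw [← hacd]; ring
  set Q : ℝ := (q : ℝ) ^ (3 * η) with hQ
  have hQ0 : 0 < Q := Real.rpow_pos_of_pos hqr _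
  have hQ1 : 1 ≤ Q := Real.one_le_rpow (by exact_mod_cast hqpos) (by positivity)
  have hlogQ : 3 * Real.log q ≤ Q / η := by
    have := Real.log_le_rpow_div hqr.le (ε := 3 * η) (by positivity)
    rw [le_div_iff₀ (by positivity)] at this ⊢
    linarith
  have hE1 : ‖err‖ ≤ C₁ * (N * c * (e * Q)) := by
    refine h1.trans (mul_le_mul_of_nonneg_left ?_ hC₁)
    have := natCast_rpow_one_add_le hNc0 hNcq hρ hη0.le hC
    push_cast at this ⊢
    exact this
  have hT2 : ‖t₂‖ ≤ E * (b * E) * (C₂ * (N * (e * Q))) := by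
    have e1 : ‖(d : ℂ) ^ (w - s)‖ ≤ E := by
      have := nb (k := d) (u := w - s) 0 hd0 (hdq.trans hqq) (by rw [sub_re]; linarith)
      rwa [Real.rpow_zero, one_mul] at this
    have e2 := h2.trans (mul_le_mul_of_nonneg_left
      (natCast_rpow_one_add_le hN0 (hNq.trans (Nat.pow_le_pow_right hqpos (by norm_num))) hρ hη0.le hC)
      hC₂)
    rw [ht₂, norm_mul, norm_mul]
    gcongr
  have hT3 : ‖t₃‖ ≤ a * b * E ^ 3 * (g * E * (d * E)) * (C₃ + C₃ * (Q / η * e)) := by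
    have e1 : ‖(g : ℂ) ^ (s + w)‖ ≤ g * E := by
      have := nb (k := g) (u := s + w) 1 hg0 ((hgc.trans hcq).trans hqq) (by rw [add_re]; linarith)
      rwa [Real.rpow_one] at this
    have e2 : ‖(d : ℂ) ^ (s + w)‖ ≤ d * E := by
      have := nb (k := d) (u := s + w) 1 hd0 (hdq.trans hqq) (by rw [add_re]; linarith)
      rwa [Real.rpow_one] at this
    have e3 : ‖riemannZeta (s + w) / 2 + J + J * ((x : ℂ) ^ (s + w - 1) - 1)‖ ≤
        C₃ + C₃ * (Q / η * e) := by
      refine (norm_add_le _ _).trans (add_le_add h3 (h5.trans ?_))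
      gcongr
    rw [ht₃, norm_mul, norm_mul X]
    refine mul_le_mul (mul_le_mul hXb ?_ (norm_nonneg _) (by positivity)) e3 (norm_nonneg _)
      (by positivity)
    rw [norm_mul]
    exact mul_le_mul e1 e2 (norm_nonneg _) (by positivity)
  have hfac : (d.totient : ℂ) * ((q : ℂ) ^ (-w) * ((n : ℂ) ^ (w - 1) * (n₁ : ℂ) ^ (-s) *
      -(X * err + t₂ + t₃))) = -((d.totient : ℂ) * ((q : ℂ) ^ (-w) *
        ((n : ℂ) ^ (w - 1) * (n₁ : ℂ) ^ (-s))) * (X * err + t₂ + t₃)) := by ring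
  rw [hfac, norm_neg, norm_mul]
  calc _ ≤ d * a * b * E ^ 3 * (a * b * E ^ 3 * (C₁ * (N * c * (e * Q))) +
        E * (b * E) * (C₂ * (N * (e * Q))) +
        a * b * E ^ 3 * (g * E * (d * E)) * (C₃ + C₃ * (Q / η * e))) := by
        refine mul_le_mul hWb ?_ (norm_nonneg _) (by positivity)
        refine (norm_add₃_le).trans (add_le_add_three ?_ hT2 hT3)
        rw [norm_mul]
        exact mul_le_mul hXb hE1 (norm_nonneg _) (by positivity)
    _ = (a * a * (c * d)) * (b * b * N) * (E ^ 6 * C₁ * e * Q) +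
        (d * a) * (b * b * N) * (E ^ 5 * C₂ * e * Q) +
        (d * a * (d * a)) * (b * b * g) * (E ^ 8 * C₃ * (1 + Q / η * e)) := by ring
    _ ≤ 1 * 1 * (E ^ 6 * C₁ * e * Q) + 1 * 1 * (E ^ 5 * C₂ * e * Q) +
        1 * 1 * (E ^ 8 * C₃ * (Q + Q / η * e)) := by
        rw [haq, hbN]
        gcongr
    _ = _ := by ring

end DirichletMeanSquare

/-! ### Assembling the error terms. -/

namespace DirichletMeanSquare

open Complex HurwitzZeta Filter Topology MeasureTheory
open scoped ArithmeticFunction.Moebius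

theorem exists_norm_dualSum_sub_dualSum_le {δ η : ℝ} (hδ0 : 0 ≤ δ) (hδ : δ < 1 / 2) (hη0 : 0 < η)
    (hη : η + δ ≤ 1 / 2) (C : ℝ) :
    ∃ K : ℝ, 0 ≤ K ∧ ∀ s w : ℂ, ‖s - 1 / 2‖ ≤ δ → ‖w - 1 / 2‖ ≤ δ → s + w ≠ 1 →
      ∀ ρ : ℝ, ‖s - 1 / 2‖ ≤ ρ → ‖w - 1 / 2‖ ≤ ρ → ∀ q c d : ℕ, c * d = q → c.Coprime d →
      1 < q → ρ * Real.log q ≤ C →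
      ‖(d.totient : ℂ) * ((q : ℂ) ^ (-w) *
        (dualSum q s w c d - dualSum q s w (min c d) (max c d)))‖ ≤
      K * (q.divisors.card : ℝ) ^ 2 * (q : ℝ) ^ (3 * η) := by
  obtain ⟨K, hK, h⟩ := exists_norm_ded_sub_ded_le hδ0 hδ hη0 hη C
  refine ⟨K, hK, fun s w hs hw hz ρ hsρ hwρ q c d hcd hcop hq hC => ?_⟩
  rcases le_total c d with hle | hle
  · rw [min_eq_left hle, max_eq_right hle, sub_self, mul_zero, mul_zero, norm_zero]
    positivity
  · rw [min_eq_right hle, max_eq_left hle, dualSum, dualSum, ← Finset.sum_sub_distrib,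
      Finset.mul_sum, Finset.mul_sum]
    have key : ∀ {f : ℕ → ℂ} {b : ℝ}, (∀ n ∈ q.divisors, ‖f n‖ ≤ b) →
        ‖∑ n ∈ q.divisors, f n‖ ≤ q.divisors.card * b := fun {f b} hf => by
      refine (norm_sum_le_of_le _ hf).trans ?_
      rw [Finset.sum_const, nsmul_eq_mul]
    have e : K * (q.divisors.card : ℝ) ^ 2 * (q : ℝ) ^ (3 * η) =
        q.divisors.card * (q.divisors.card * (K * (q : ℝ) ^ (3 * η))) := by ring
    rw [e]
    refine key fun n hn => ?_
    rw [← Finset.sum_sub_distrib, Finset.mul_sum, Finset.mul_sum]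
    refine key fun n₁ hn₁ => ?_
    have h1 := h s w hs hw hz ρ hsρ hwρ q c d hcd hcop hle hq hC n n₁
      (Nat.dvd_of_mem_divisors hn) (Nat.dvd_of_mem_divisors hn₁)
    have h2 : ‖((μ n : ℤ) : ℂ) * ((μ n₁ : ℤ) : ℂ)‖ ≤ 1 := by
      rw [norm_mul]
      exact mul_le_one₀ (norm_moebius_le_one n) (norm_nonneg _) (norm_moebius_le_one n₁)
    refine le_trans (le_of_eq ?_) (h1.trans' (mul_le_of_le_one_left (norm_nonneg _) h2))
    rw [← norm_mul]
    congr 1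
    ring

/-- The remainder of the reciprocity formula, normalized as it occurs in the mean square. -/
noncomputable def reciprocityError (s w : ℂ) (n₁ n₂ k : ℕ) : ℂ :=
  (n₁ : ℂ) ^ (-s) * (n₂ : ℂ) ^ (-w) * ded s w n₁ n₂ k -
    ((n₁ : ℂ) ^ (-s) * (n₂ : ℂ) ^ (-(s + w)) * (k : ℂ) ^ s * ded s w n₁ k n₂ +
      (n₂ : ℂ) ^ (-w) * (n₁ : ℂ) ^ (-(w + s)) * (k : ℂ) ^ w * ded w s n₂ k n₁ +
      (riemannZeta (s + w) / 2 * (((n₁.lcm n₂ : ℕ) : ℂ) ^ (-(s + w)) * (k : ℂ) ^ (s + w)) +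
        kernelMean s w * (((n₁.gcd n₂ : ℕ) : ℂ) ^ (1 - (s + w)) *
          ((n₁.lcm n₂ : ℕ) : ℂ) ^ (-1 : ℂ) * (k : ℂ))))

theorem reciprocityError_eq {n₁ n₂ : ℕ} (hn₁ : n₁ ≠ 0) (hn₂ : n₂ ≠ 0) (s w : ℂ) (k : ℕ) :
    reciprocityError s w n₁ n₂ k = (n₁ : ℂ) ^ (-(s + w)) * (n₂ : ℂ) ^ (-(s + w)) *
      ((n₂ : ℂ) ^ s * (n₁ : ℂ) ^ w * ded s w n₁ n₂ k
        - ((k : ℂ) ^ s * (n₁ : ℂ) ^ w * ded s w n₁ k n₂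
          + (k : ℂ) ^ w * (n₂ : ℂ) ^ s * ded s w k n₂ n₁
          + ((n₁.gcd n₂ : ℕ) : ℂ) ^ (s + w) * (k : ℂ) ^ (s + w) * riemannZeta (s + w) / 2
          + k * (n₁.gcd n₂ : ℕ) * ((n₁.lcm n₂ : ℕ) : ℂ) ^ (s + w - 1) * kernelMean s w)) := by
  have c₁ : (n₁ : ℂ) ≠ 0 := by exact_mod_cast hn₁
  have c₂ : (n₂ : ℂ) ≠ 0 := by exact_mod_cast hn₂
  have cg : ((n₁.gcd n₂ : ℕ) : ℂ) ≠ 0 := by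
    exact_mod_cast (Nat.gcd_pos_of_pos_left _ (Nat.pos_of_ne_zero hn₁)).ne'
  have cl : ((n₁.lcm n₂ : ℕ) : ℂ) ≠ 0 := by exact_mod_cast Nat.lcm_ne_zero hn₁ hn₂
  have e₁ : (n₁ : ℂ) ^ (-(s + w)) * (n₁ : ℂ) ^ w = (n₁ : ℂ) ^ (-s) := by
    rw [← cpow_add _ _ c₁]; congr 1; ring
  have e₂ : (n₂ : ℂ) ^ (-(s + w)) * (n₂ : ℂ) ^ s = (n₂ : ℂ) ^ (-w) := by
    rw [← cpow_add _ _ c₂]; congr 1; ring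
  have egl : (n₁ : ℂ) ^ (-(s + w)) * (n₂ : ℂ) ^ (-(s + w)) =
      ((n₁.gcd n₂ : ℕ) : ℂ) ^ (-(s + w)) * ((n₁.lcm n₂ : ℕ) : ℂ) ^ (-(s + w)) := by
    rw [← natCast_mul_natCast_cpow, ← natCast_mul_natCast_cpow, ← Nat.cast_mul, ← Nat.cast_mul,
      Nat.gcd_mul_lcm]
  have eg : ((n₁.gcd n₂ : ℕ) : ℂ) ^ (-(s + w)) * ((n₁.gcd n₂ : ℕ) : ℂ) ^ (s + w) = 1 := by
    rw [← cpow_add _ _ cg]; simp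
  have eg' : ((n₁.gcd n₂ : ℕ) : ℂ) ^ (1 - (s + w)) =
      ((n₁.gcd n₂ : ℕ) : ℂ) ^ (-(s + w)) * ((n₁.gcd n₂ : ℕ) : ℂ) := by
    rw [sub_eq_neg_add, cpow_add _ _ cg, cpow_one]
  have el : ((n₁.lcm n₂ : ℕ) : ℂ) ^ (-(s + w)) * ((n₁.lcm n₂ : ℕ) : ℂ) ^ (s + w - 1) =
      ((n₁.lcm n₂ : ℕ) : ℂ) ^ (-1 : ℂ) := by
    rw [← cpow_add _ _ cl]; congr 1; ring
  rw [reciprocityError, eg', ← el, ← e₁, ← e₂, add_comm w s, ded_swap w s]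
  linear_combination (-((n₁.gcd n₂ : ℕ) : ℂ) ^ (s + w) * (k : ℂ) ^ (s + w) * riemannZeta (s + w) / 2
    - k * (n₁.gcd n₂ : ℕ) * ((n₁.lcm n₂ : ℕ) : ℂ) ^ (s + w - 1) * kernelMean s w) * (-egl) +
    ((n₁.lcm n₂ : ℕ) : ℂ) ^ (-(s + w)) * (k : ℂ) ^ (s + w) * riemannZeta (s + w) / 2 * eg

/-- The normalization contributes about (n₁ n₂)^(-1) and the reciprocity error is about (n₁ n₂)^(1 +
η), while φ(m) m^(-s - w) is bounded. Only q^(3η) and the number of divisors remain. -/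
theorem exists_norm_levelAvg_reciprocityError_le {δ η : ℝ} (hδ : δ < 1 / 2) (hη0 : 0 < η)
    (hη : η + δ ≤ 1 / 2) (C : ℝ) :
    ∃ K : ℝ, 0 ≤ K ∧ ∀ s w : ℂ, ‖s - 1 / 2‖ ≤ δ → ‖w - 1 / 2‖ ≤ δ → s + w ≠ 1 →
      ∀ ρ : ℝ, ‖s - 1 / 2‖ ≤ ρ → ‖w - 1 / 2‖ ≤ ρ → ∀ q : ℕ, q ≠ 0 → ρ * Real.log q ≤ C →
      ‖levelAvg q (s + w) (reciprocityError s w)‖ ≤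
      K * (q.divisors.card : ℝ) ^ 4 * (q : ℝ) ^ (3 * η) := by
  obtain ⟨C₁, hC₁, h₁⟩ := exists_reciprocity_gcd hδ hη0 hη
  set E : ℝ := Real.exp (4 * C) with hE
  have hE0 : 0 < E := Real.exp_pos _
  refine ⟨E ^ 3 * C₁ * Real.exp (6 * C), by positivity, ?_⟩
  intro s w hs hw hz ρ hsρ hwρ q hq hC
  have hρ : 0 ≤ ρ := (norm_nonneg _).trans hsρ
  obtain ⟨hsl, hsu⟩ := re_bounds hsρ
  obtain ⟨hwl, hwu⟩ := re_bounds hwρ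
  have hdiv : ∀ {k : ℕ}, k ∣ q → k ≠ 0 ∧ k ≤ q := fun hk =>
    ⟨fun h => hq (Nat.eq_zero_of_zero_dvd (h ▸ hk)), Nat.le_of_dvd (Nat.pos_of_ne_zero hq) hk⟩
  have hqq : q ≤ q ^ 2 := Nat.le_self_pow two_ne_zero q
  have nb : ∀ {k : ℕ}, k ∣ q → ‖(k : ℂ) ^ (-(s + w))‖ ≤ (k : ℝ)⁻¹ * E := fun {k} hk => by
    have := norm_natCast_cpow_le (hdiv hk).1 ((hdiv hk).2.trans hqq) hρ hC (u := -(s + w)) (r := -1)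
      (by rw [neg_re, add_re]; linarith)
    rwa [Real.rpow_neg_one] at this
  set B : ℝ := E ^ 2 * C₁ * (Real.exp (6 * C) * (q : ℝ) ^ (3 * η)) with hB
  have hB0 : 0 ≤ B := by positivity
  refine (norm_levelAvg_le hq hE0.le hB0 (fun m hm => ?_) fun n₁ n₂ k hn₁ hn₂ hk hc₁ hc₂ => ?_).trans
    (le_of_eq (by rw [hB]; ring))
  · have hm0 : (0 : ℝ) < m := by exact_mod_cast Nat.pos_of_ne_zero (hdiv hm).1
    rw [norm_mul, Complex.norm_natCast]
    calc (m.totient : ℝ) * ‖(m : ℂ) ^ (-(s + w))‖ ≤ m * ((m : ℝ)⁻¹ * E) := by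
          gcongr
          · exact Nat.totient_le m
          · exact nb hm
      _ = E := by field_simp
  · obtain ⟨h1, h1q⟩ := hdiv hn₁
    obtain ⟨h2, h2q⟩ := hdiv hn₂
    have hr1 : (0 : ℝ) < n₁ := by exact_mod_cast Nat.pos_of_ne_zero h1
    have hr2 : (0 : ℝ) < n₂ := by exact_mod_cast Nat.pos_of_ne_zero h2
    rw [reciprocityError_eq h1 h2, norm_mul, norm_mul]
    have h3 := h₁ s w hs hw hz ρ hρ (by linarith) n₁ n₂ k h1 h2 (hdiv hk).1
      (hc₁.coprime_dvd_left (Nat.gcd_dvd_left _ _))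
    have h4 := natCast_rpow_one_add_le (mul_ne_zero h1 h2)
      ((Nat.mul_le_mul h1q h2q).trans ((sq q).symm.le.trans
        (Nat.pow_le_pow_right (Nat.pos_of_ne_zero hq) (by norm_num)))) hρ hη0.le hC
    have h5 := h3.trans (mul_le_mul_of_nonneg_left h4 hC₁)
    calc _ ≤ (n₁ : ℝ)⁻¹ * E * ((n₂ : ℝ)⁻¹ * E) *
          (C₁ * (((n₁ * n₂ : ℕ) : ℝ) * (Real.exp (6 * C) * (q : ℝ) ^ (3 * η)))) :=
          mul_le_mul (mul_le_mul (nb hn₁) (nb hn₂) (norm_nonneg _) (by positivity)) h5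
            (norm_nonneg _) (by positivity)
      _ = B := by
          rw [hB]; push_cast; field_simp

theorem rpow_le_errorBound (ε D : ℝ) (q : ℕ) : (q : ℝ) ^ ε ≤ errorBound ε D q := by
  have h1 : (0 : ℝ) ≤ 1 / (q : ℝ) * (∑ d ∈ q.divisors with ((d : ℕ) : ℝ) ≤ D,
      (d.totient : ℝ) * (d : ℝ) ^ (3 / 2 : ℝ)) :=
    mul_nonneg (by positivity) (Finset.sum_nonneg fun _ _ => by positivity)
  have h2 : (0 : ℝ) ≤ Real.sqrt q * (∑ d ∈ q.divisors with D < ((d : ℕ) : ℝ),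
      (d.totient : ℝ) / (d : ℝ) ^ (3 / 2 : ℝ)) :=
    mul_nonneg (Real.sqrt_nonneg _) (Finset.sum_nonneg fun _ _ => by positivity)
  have h3 : (0 : ℝ) ≤ (q : ℝ) ^ (ε - 1) * D ^ 2 := by positivity
  rw [errorBound]
  linarith

/-- An exact identity: averaging the definition of `reciprocityError` cancels the main term, and the
reciprocal terms differ from the secondary term only in having modulus c where it has min(c, d). -/
theorem evenMeanSquare_sub_eq {δ : ℝ} (hδ0 : 0 ≤ δ) (hδ : δ < 1 / 2) {α β : ℂ} (hα : ‖α‖ ≤ δ)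
    (hβ : ‖β‖ ≤ δ) (hne : α + β ≠ 0) {q : ℕ} [NeZero q] :
    evenMeanSquare q α β - mainTerm q α β - secondaryTerm q α β =
      (∑ p ∈ q.divisorsAntidiagonal with p.1.Coprime p.2, ((μ p.1 : ℤ) : ℂ) ^ 2 *
        ((p.2.totient : ℂ) * ((q : ℂ) ^ (-(1 / 2 + β)) * (dualSum q (1 / 2 + α) (1 / 2 + β) p.1 p.2 -
          dualSum q (1 / 2 + α) (1 / 2 + β) (min p.1 p.2) (max p.1 p.2))) +
        (p.2.totient : ℂ) * ((q : ℂ) ^ (-(1 / 2 + α)) * (dualSum q (1 / 2 + β) (1 / 2 + α) p.1 p.2 -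
          dualSum q (1 / 2 + β) (1 / 2 + α) (min p.1 p.2) (max p.1 p.2))))) +
      levelAvg q (1 / 2 + α + (1 / 2 + β)) (reciprocityError (1 / 2 + α) (1 / 2 + β)) := by
  have hs : ‖(1 / 2 + α) - 1 / 2‖ ≤ δ := by simpa using hα
  have hw : ‖(1 / 2 + β) - 1 / 2‖ ≤ δ := by simpa using hβ
  have h1 := levelAvg_reciprocal hδ hs (1 / 2 + β) (NeZero.ne q)
  have h2 := levelAvg_reciprocal hδ hw (1 / 2 + α) (NeZero.ne q)
  rw [← levelAvg_swap, add_comm (1 / 2 + β) (1 / 2 + α)] at h2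
  rw [evenMeanSquare_eq_levelAvg (ne_one_of_near_half hδ hs) (ne_one_of_near_half hδ hw),
    mainTerm_eq hδ0 hδ hα hβ hne, secondaryTerm_eq hδ hα hβ]
  set s := 1 / 2 + α with hs'
  set w := 1 / 2 + β with hw'
  have h3 : ∀ P Q R S : ℕ → ℕ → ℕ → ℂ, levelAvg q (s + w) (fun n₁ n₂ k =>
      P n₁ n₂ k + Q n₁ n₂ k + R n₁ n₂ k + S n₁ n₂ k) = levelAvg q (s + w) P +
        levelAvg q (s + w) Q + levelAvg q (s + w) R + levelAvg q (s + w) S := fun P Q R S => by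
    rw [levelAvg_add q _ (fun n₁ n₂ k => P n₁ n₂ k + Q n₁ n₂ k + R n₁ n₂ k),
      levelAvg_add q _ (fun n₁ n₂ k => P n₁ n₂ k + Q n₁ n₂ k), levelAvg_add]
  have h4 : levelAvg q (s + w) (fun n₁ n₂ k =>
      (n₁ : ℂ) ^ (-s) * (n₂ : ℂ) ^ (-w) * ded s w n₁ n₂ k) = _ :=
    (levelAvg_congr (q := q) (s + w) fun n₁ n₂ k _ _ _ _ _ => by
      simp only [reciprocityError]
      rw [add_comm w s]
      ring).trans (h3
      (fun n₁ n₂ k => (n₁ : ℂ) ^ (-s) * (n₂ : ℂ) ^ (-(s + w)) * (k : ℂ) ^ s * ded s w n₁ k n₂)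
      (fun n₁ n₂ k => (n₂ : ℂ) ^ (-w) * (n₁ : ℂ) ^ (-(s + w)) * (k : ℂ) ^ w * ded w s n₂ k n₁)
      (fun n₁ n₂ k =>
        riemannZeta (s + w) / 2 * (((n₁.lcm n₂ : ℕ) : ℂ) ^ (-(s + w)) * (k : ℂ) ^ (s + w)) +
        kernelMean s w * (((n₁.gcd n₂ : ℕ) : ℂ) ^ (1 - (s + w)) *
          ((n₁.lcm n₂ : ℕ) : ℂ) ^ (-1 : ℂ) * (k : ℂ)))
      (reciprocityError s w))
  rw [h4, h1, h2]
  have h5 : ∀ A B M R S T : ℂ, A + B - S = T → A + B + M + R - M - S = T + R := by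
    intro A B M R S T h; rw [← h]; ring
  refine h5 _ _ _ _ _ _ ?_
  rw [← Finset.sum_add_distrib, ← Finset.sum_sub_distrib]
  refine Finset.sum_congr rfl fun p _ => ?_
  ring

/-- The error in the asymptotic formula is `O(q ^ ε)`. -/
theorem exists_norm_evenMeanSquare_sub_le {C δ ε : ℝ} (hδ0 : 0 ≤ δ) (hδ : δ < 1 / 2) (hε : 0 < ε) :
    ∃ K : ℝ, 0 ≤ K ∧ ∀ (q : ℕ) [NeZero q], 1 < q →
      ∀ α β : ℂ, ‖α‖ ≤ C / Real.log q → ‖β‖ ≤ C / Real.log q → ‖α‖ ≤ δ → ‖β‖ ≤ δ → α + β ≠ 0 →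
        ‖evenMeanSquare q α β - mainTerm q α β - secondaryTerm q α β‖ ≤ K * (q : ℝ) ^ ε := by
  -- The largest error is τ(q)⁴ q^(3η) ≪ q^(7η).
  obtain ⟨η, hη0, hη, hηε⟩ : ∃ η : ℝ, 0 < η ∧ η + δ ≤ 1 / 2 ∧ 7 * η ≤ ε := by
    refine ⟨min (1 / 2 - δ) (ε / 7), lt_min (by linarith) (by positivity), ?_, ?_⟩
    · linarith [min_le_left (1 / 2 - δ) (ε / 7)]
    · linarith [min_le_right (1 / 2 - δ) (ε / 7)]
  obtain ⟨T, hT0, hT⟩ := exists_card_divisors_le hη0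
  obtain ⟨K₁, hK₁, h₁⟩ := exists_norm_dualSum_sub_dualSum_le hδ0 hδ hη0 hη C
  obtain ⟨K₂, hK₂, h₂⟩ := exists_norm_levelAvg_reciprocityError_le hδ hη0 hη C
  refine ⟨2 * K₁ * T ^ 3 + K₂ * T ^ 4, by positivity, ?_⟩
  intro q _ hq α β hαC hβC hα hβ hne
  have hq0 : q ≠ 0 := by omega
  have hq1 : (1 : ℝ) ≤ q := by exact_mod_cast hq.le
  have hlog : 0 < Real.log q := Real.log_pos (by exact_mod_cast hq)
  have hs : ∀ {γ : ℂ} {r : ℝ}, ‖γ‖ ≤ r → ‖(1 / 2 + γ) - 1 / 2‖ ≤ r := fun h => by simpa using h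
  have hz : (1 / 2 + α) + (1 / 2 + β) ≠ 1 := fun h => hne (by linear_combination h)
  have hρ : C / Real.log q * Real.log q ≤ C := (div_mul_cancel₀ C hlog.ne').le
  set τ : ℝ := (q.divisors.card : ℝ) with hτ
  have hτ0 : 0 ≤ τ := Nat.cast_nonneg _
  set Q : ℝ := (q : ℝ) ^ η with hQ
  have hQ0 : 0 < Q := Real.rpow_pos_of_pos (by linarith) _
  have hQ1 : 1 ≤ Q := Real.one_le_rpow hq1 hη0.le
  have hτQ : τ ≤ T * Q := hT q hq0
  have hQ3 : (q : ℝ) ^ (3 * η) = Q ^ 3 := by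
    rw [hQ, ← Real.rpow_natCast, ← Real.rpow_mul (by linarith)]; congr 1; push_cast; ring
  have hQ7 : Q ^ 7 ≤ (q : ℝ) ^ ε := by
    rw [hQ, ← Real.rpow_natCast, ← Real.rpow_mul (by linarith)]
    exact Real.rpow_le_rpow_of_exponent_le hq1 (by push_cast; linarith)
  have hE := h₂ _ _ (hs hα) (hs hβ) hz _ (hs hαC) (hs hβC) q hq0 hρ
  have hS : ‖∑ p ∈ q.divisorsAntidiagonal with p.1.Coprime p.2, ((μ p.1 : ℤ) : ℂ) ^ 2 *
        ((p.2.totient : ℂ) * ((q : ℂ) ^ (-(1 / 2 + β)) * (dualSum q (1 / 2 + α) (1 / 2 + β) p.1 p.2 -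
          dualSum q (1 / 2 + α) (1 / 2 + β) (min p.1 p.2) (max p.1 p.2))) +
        (p.2.totient : ℂ) * ((q : ℂ) ^ (-(1 / 2 + α)) * (dualSum q (1 / 2 + β) (1 / 2 + α) p.1 p.2 -
          dualSum q (1 / 2 + β) (1 / 2 + α) (min p.1 p.2) (max p.1 p.2))))‖ ≤
      τ * (K₁ * τ ^ 2 * Q ^ 3 + K₁ * τ ^ 2 * Q ^ 3) := by
    refine (norm_sum_le_of_le _ (n := fun _ => K₁ * τ ^ 2 * Q ^ 3 + K₁ * τ ^ 2 * Q ^ 3)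
      fun p hp => ?_).trans ?_
    · rw [Finset.mem_filter, Nat.mem_divisorsAntidiagonal] at hp
      have e1 := h₁ _ _ (hs hα) (hs hβ) hz _ (hs hαC) (hs hβC) q p.1 p.2 hp.1.1 hp.2 hq hρ
      have e2 := h₁ _ _ (hs hβ) (hs hα) (by rwa [add_comm]) _ (hs hβC) (hs hαC) q p.1 p.2 hp.1.1
        hp.2 hq hρ
      rw [hQ3] at e1 e2
      rw [norm_mul, norm_pow]
      have e3 : ‖((μ p.1 : ℤ) : ℂ)‖ ^ 2 ≤ 1 := pow_le_one₀ (norm_nonneg _) (norm_moebius_le_one _)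
      exact (mul_le_of_le_one_left (norm_nonneg _) e3).trans ((norm_add_le _ _).trans
        (add_le_add e1 e2))
    · rw [Finset.sum_const, nsmul_eq_mul]
      refine mul_le_mul_of_nonneg_right ?_ (by positivity)
      rw [hτ, ← Nat.map_div_right_divisors]
      refine Nat.cast_le.mpr ((Finset.card_filter_le _ _).trans ?_)
      rw [Finset.card_map]
  rw [evenMeanSquare_sub_eq hδ0 hδ hα hβ hne]
  rw [hQ3] at hE
  calc _ ≤ τ * (K₁ * τ ^ 2 * Q ^ 3 + K₁ * τ ^ 2 * Q ^ 3) + K₂ * τ ^ 4 * Q ^ 3 :=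
        (norm_add_le _ _).trans (add_le_add hS hE)
    _ = 2 * K₁ * τ ^ 3 * Q ^ 3 + K₂ * τ ^ 4 * Q ^ 3 := by ring
    _ ≤ 2 * K₁ * (T * Q) ^ 3 * Q ^ 3 + K₂ * (T * Q) ^ 4 * Q ^ 3 := by gcongr
    _ = 2 * K₁ * T ^ 3 * Q ^ 6 + K₂ * T ^ 4 * Q ^ 7 := by ring
    _ ≤ 2 * K₁ * T ^ 3 * Q ^ 7 + K₂ * T ^ 4 * Q ^ 7 := by
        gcongr
        · norm_num
    _ = (2 * K₁ * T ^ 3 + K₂ * T ^ 4) * Q ^ 7 := by ring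
    _ ≤ _ := by gcongr

end DirichletMeanSquare

theorem theorem5 :
    ∀ C δ ε : ℝ, 0 < C → 0 < δ → δ < 1 / 2 → 0 < ε →
      ∃ K : ℝ, ∀ (q : ℕ) [NeZero q], 1 < q →
        ∀ α β : ℂ, ‖α‖ ≤ C / Real.log q → ‖β‖ ≤ C / Real.log q →
          ‖α‖ ≤ δ → ‖β‖ ≤ δ → α + β ≠ 0 →
          ∀ D : ℝ,
            ‖DirichletMeanSquare.evenMeanSquare q α β
                - DirichletMeanSquare.mainTerm q α β
                - DirichletMeanSquare.secondaryTerm q α β‖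
              ≤ K * DirichletMeanSquare.errorBound ε D q := by
  intro C δ ε _ hδ0 hδ hε
  obtain ⟨K, hK, h⟩ := DirichletMeanSquare.exists_norm_evenMeanSquare_sub_le (C := C) hδ0.le hδ hε
  refine ⟨K, fun q _ hq α β hα hβ hα' hβ' hne D => ?_⟩
  exact (h q hq α β hα hβ hα' hβ' hne).trans
    (mul_le_mul_of_nonneg_left (DirichletMeanSquare.rpow_le_errorBound ε D q) hK)
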